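/- **Theorem 1.2.** A *comparator circuit* on variables $x_1,\dots,x_n$ consists of finitely many wires, each labelled by a literal $x_i$ or $\neg x_i$, a sequence of gates, each an ordered pair of wires, and a designated output wire. On an input $a\in\{0,1\}^n$ every wire is initialised with the value of its literal; then the gates are applied in order, where a gate $(u,v)$ replaces the values $\alpha,\beta$ of $u,v$ by $\alpha\wedge\beta$ and $\alpha\vee\beta$ respectively; the final value of the output wire is $C(a)$. There are a constant $d>1$ and a deterministic algorithm (a program for a random access machine with addition and truncated subtraction, under the logarithmic cost measure) with the following property. For every polynomial $p$ there is a polynomial $q$ such that, for all integers $n$ and $k$ with $1\le k\le n/4$, given any comparator circuit $C$ on $n$ variables with at most $$\frac{n^{1.5}}{d\cdot k\cdot\sqrt{\log_2 n}}$$ wires and at most $p(n)$ gates, the algorithm outputs the number $|\{a\in\{0,1\}^n : C(a)=1\}|$ of satisfying assignments of $C$ in time at most $2^{n-k}\cdot q(n)$. The constant $d$ and the algorithm depend on none of $p,n,k,C$, and the algorithm receives only $C$ as input. -/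

import Mathlib

/-- A comparator circuit on the variables `x_0, …, x_{n-1}`: finitely many wires, each labelled by
an input literal, a sequence of gates, which are ordered pairs of wires, and an output wire. -/
structure ComparatorCircuit (n : ℕ) where
  /-- the number of wires -/
  wires : ℕ
  /-- the literal on each wire: `(i, false)` is the variable `x_i`, `(i, true)` its negation -/
  label : Fin wires → Fin n × Bool
  /-- the gates, in the order in which they are applied -/
  gates : List (Fin wires × Fin wires)
  /-- the designated output wire -/
  out : Fin wires

namespace ComparatorCircuit

variable {n : ℕ}

/-- The effect of the gate `g = (u, v)` on the values of the wires: `u` receives the conjunction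
and `v` the disjunction of the two previous values. -/
def applyGate {ℓ : ℕ} (val : Fin ℓ → Bool) (g : Fin ℓ × Fin ℓ) : Fin ℓ → Bool :=
  Function.update (Function.update val g.1 (val g.1 && val g.2)) g.2 (val g.1 || val g.2)

/-- The initial values of the wires on the input `a`. -/
def initVal (C : ComparatorCircuit n) (a : Fin n → Bool) : Fin C.wires → Bool :=
  fun w => xor (a (C.label w).1) (C.label w).2

/-- The value computed by the circuit on the input `a`. -/
def eval (C : ComparatorCircuit n) (a : Fin n → Bool) : Bool :=
  C.gates.foldl applyGate (C.initVal a) C.out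

/-- The number of satisfying assignments. -/
def numSat (C : ComparatorCircuit n) : ℕ :=
  (Finset.univ.filter fun a : Fin n → Bool => C.eval a = true).card

/-- The circuit written as a list of numbers: the number of variables, of wires and of gates, the
output wire, then two numbers for each wire (variable, and 1 if negated, 0 if not), then two
numbers for each gate. -/
def encode (C : ComparatorCircuit n) : List ℕ :=
  [n, C.wires, C.gates.length, (C.out : ℕ)] ++
    (List.finRange C.wires).flatMap
      (fun w => [((C.label w).1 : ℕ), if (C.label w).2 then 1 else 0]) ++
    C.gates.flatMap (fun g => [(g.1 : ℕ), (g.2 : ℕ)])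

end ComparatorCircuit

/-! Deterministic random access machines with logarithmic cost. -/

namespace RAM

/-- A configuration: the contents of the registers, which a program addresses directly, and of the
memory cells, which it addresses through the registers. -/
structure State where
  reg : ℕ → ℕ
  mem : ℕ → ℕ

/-- Programs. A program is a finite object and so uses finitely many registers and constants. -/
inductive Program where
  /-- do nothing -/
  | skip : Program
  /-- `R_i := c` -/
  | const (i c : ℕ) : Program
  /-- `R_i := R_j + R_k` -/
  | add (i j k : ℕ) : Program
  /-- `R_i := max(R_j - R_k, 0)` -/
  | sub (i j k : ℕ) : Program
  /-- `R_i := M[R_j]` -/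
  | load (i j : ℕ) : Program
  /-- `M[R_i] := R_j` -/
  | store (i j : ℕ) : Program
  /-- first `P`, then `Q` -/
  | seq (P Q : Program) : Program
  /-- if `R_i ≠ 0` then `P` else `Q` -/
  | cond (i : ℕ) (P Q : Program) : Program
  /-- while `R_i ≠ 0` do `P` -/
  | loop (i : ℕ) (P : Program) : Program

/-- Write a value to a register. -/
def State.setReg (σ : State) (i x : ℕ) : State := { σ with reg := Function.update σ.reg i x }

/-- Write a value to a memory cell. -/
def State.setMem (σ : State) (i x : ℕ) : State := { σ with mem := Function.update σ.mem i x }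

/-- `Exec P σ t τ`: started in `σ`, the program `P` halts in the configuration `τ` after time `t`.
Each elementary step and each test costs 1 plus the bit lengths of all the numbers, addresses
included, that it operates on (`Nat.size` is the length of the binary expansion). -/
inductive Exec : Program → State → ℕ → State → Prop where
  | skip (σ : State) : Exec .skip σ 1 σ
  | const (i c : ℕ) (σ : State) : Exec (.const i c) σ (1 + Nat.size c) (σ.setReg i c)
  | add (i j k : ℕ) (σ : State) :
      Exec (.add i j k) σ (1 + Nat.size (σ.reg j) + Nat.size (σ.reg k))
        (σ.setReg i (σ.reg j + σ.reg k))
  | sub (i j k : ℕ) (σ : State) :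
      Exec (.sub i j k) σ (1 + Nat.size (σ.reg j) + Nat.size (σ.reg k))
        (σ.setReg i (σ.reg j - σ.reg k))
  | load (i j : ℕ) (σ : State) :
      Exec (.load i j) σ (1 + Nat.size (σ.reg j) + Nat.size (σ.mem (σ.reg j)))
        (σ.setReg i (σ.mem (σ.reg j)))
  | store (i j : ℕ) (σ : State) :
      Exec (.store i j) σ (1 + Nat.size (σ.reg i) + Nat.size (σ.reg j))
        (σ.setMem (σ.reg i) (σ.reg j))
  | seq {P Q : Program} {σ τ υ : State} {s t : ℕ} :
      Exec P σ s τ → Exec Q τ t υ → Exec (.seq P Q) σ (s + t) υ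
  | condTrue {i : ℕ} {P Q : Program} {σ τ : State} {t : ℕ} :
      σ.reg i ≠ 0 → Exec P σ t τ → Exec (.cond i P Q) σ (1 + Nat.size (σ.reg i) + t) τ
  | condFalse {i : ℕ} {P Q : Program} {σ τ : State} {t : ℕ} :
      σ.reg i = 0 → Exec Q σ t τ → Exec (.cond i P Q) σ (1 + Nat.size (σ.reg i) + t) τ
  | loopStop {i : ℕ} {P : Program} {σ : State} :
      σ.reg i = 0 → Exec (.loop i P) σ (1 + Nat.size (σ.reg i)) σ
  | loopStep {i : ℕ} {P : Program} {σ τ υ : State} {s t : ℕ} :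
      σ.reg i ≠ 0 → Exec P σ s τ → Exec (.loop i P) τ t υ →
      Exec (.loop i P) σ (1 + Nat.size (σ.reg i) + s + t) υ

/-- Execution is deterministic: the final configuration and the time are determined. -/
theorem Exec.deterministic {P : Program} {σ τ : State} {t : ℕ} (h : Exec P σ t τ) :
    ∀ {t' : ℕ} {τ' : State}, Exec P σ t' τ' → t = t' ∧ τ = τ' := by
  induction h with
  | skip | const | add | sub | load | store => intro t' τ' h'; cases h'; exact ⟨rfl, rfl⟩
  | seq _ _ ih₁ ih₂ =>
    intro t' τ' h'
    cases h' with
    | seq h₁ h₂ =>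
      obtain ⟨rfl, rfl⟩ := ih₁ h₁
      obtain ⟨rfl, rfl⟩ := ih₂ h₂
      exact ⟨rfl, rfl⟩
  | condTrue h _ ih =>
    intro t' τ' h'
    cases h' with
    | condTrue _ h₁ => obtain ⟨rfl, rfl⟩ := ih h₁; exact ⟨rfl, rfl⟩
    | condFalse h₀ _ => exact absurd h₀ h
  | condFalse h _ ih =>
    intro t' τ' h'
    cases h' with
    | condTrue h₀ _ => exact absurd h h₀
    | condFalse _ h₁ => obtain ⟨rfl, rfl⟩ := ih h₁; exact ⟨rfl, rfl⟩
  | loopStop h =>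
    intro t' τ' h'
    cases h' with
    | loopStop _ => exact ⟨rfl, rfl⟩
    | loopStep h₀ _ _ => exact absurd h h₀
  | loopStep h _ _ ih₁ ih₂ =>
    intro t' τ' h'
    cases h' with
    | loopStop h₀ => exact absurd h₀ h
    | loopStep _ h₁ h₂ =>
      obtain ⟨rfl, rfl⟩ := ih₁ h₁
      obtain ⟨rfl, rfl⟩ := ih₂ h₂
      exact ⟨rfl, rfl⟩

/-- The initial configuration: the input list in the first memory cells, zeros everywhere else. -/
def initState (input : List ℕ) : State where
  reg := fun _ => 0
  mem := fun i => input.getD i 0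

/-- On the given input, `P` halts within time `T` and leaves the result `y` in register 0. -/
def OutputsWithin (P : Program) (input : List ℕ) (y T : ℕ) : Prop :=
  ∃ t τ, Exec P (initState input) t τ ∧ t ≤ T ∧ τ.reg 0 = y

end RAM

/-! Fix a block of `m` cyclically consecutive variables as live and enumerate the `2 ^ (n - m)`
assignments of the others. Each of these leaves a network in which only `w` wires (`liveCount`)
start with live literals, while the rest start with constants. Few distinct functions of the live
variables can arise in this way, so each is counted once by brute force and afterwards looked up in
a table.

To bound their number, let tokens travel on the wires and keep track of inequalities between token
values that hold for all live inputs. A gate between tokens known to be comparable does nothing or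
exchanges them. A gate between incomparable tokens replaces them by their meet and join and is
logged; this strictly decreases the number of incomparable pairs (`potential_leGate_lt`). Constants
are comparable with everything, so the log mentions live tokens only and has at most `w ^ 2` entries
(`length_log_run_le`). The log, together with the token that ends on the output wire, determines the
function (`foldl_eq_of_signature_eq`). Encoded as one number, the signature, it takes at most `(ℓ +
2) ^ (2 * w ^ 2 + 1)` values, where `ℓ` is the number of wires (`signature_lt`).

Up to polynomial factors the work is `2 ^ (n - m) + 2 ^ (2 * w ^ 2 * L + m)` whenever `ℓ + 2 ≤ 2 ^
L` (`den_enumerate`). Averaging over the cyclic shifts yields a block with `n * w ≤ m * ℓ`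
(`exists_liveCount_le`). For `m = 2 * k` the bound on the wires then forces `8 * w ^ 2 * L ≤ n`
(`exists_suitable`), and both exponents are at most `n - k`. Since `k` is not part of the input, the
program searches for the largest `m`, and a shift, that satisfy this inequality and `2 * m ≤ n`
(`den_search`).

The algorithm is written in a small total language whose effect and cost are functions of the state,
and compiled to the machine with an overhead logarithmic in the input length (`exec_cmd`). Pieces of
polynomial length are bounded generically (`bdd_den_and_vol_le`). The two loops of exponential
length need explicit invariants, and clearing the scratch variables in each round keeps all numbers
short (`den_innerLoop`, `den_outerStep`). -/

/-- The state of the simplification of a comparator network whose inputs are tokens. Token `pos w`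
sits on wire `w`, `le` is the order between the values of the tokens that is known so far, and `log`
lists the gates between incomparable tokens, the most recent one first. -/
structure Tokens (ℓ : ℕ) where
  pos : Fin ℓ → Fin ℓ
  le : Fin ℓ → Fin ℓ → Bool
  log : List (Fin ℓ × Fin ℓ)

/-! ### Simplification of a comparator network with some constant inputs -/

namespace Tokens

variable {ℓ : ℕ}

/-- The columns of a relation after token `u` has been replaced by the meet of `u` and `v`, and
token `v` by their join. -/
def leCol (R : Fin ℓ → Fin ℓ → Bool) (u v : Fin ℓ) : Fin ℓ → Fin ℓ → Bool :=
  fun i j => if j = u then R i u && R i v else if j = v then R i u || R i v else R i j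

/-- The rows of a relation after token `u` has been replaced by the meet of `u` and `v`, and
token `v` by their join. -/
def leRow (R : Fin ℓ → Fin ℓ → Bool) (u v : Fin ℓ) : Fin ℓ → Fin ℓ → Bool :=
  fun i j => if i = u then R u j || R v j else if i = v then R u j && R v j else R i j

/-- The known order after a gate between the tokens `u` and `v`. -/
def leGate (R : Fin ℓ → Fin ℓ → Bool) (u v : Fin ℓ) : Fin ℓ → Fin ℓ → Bool :=
  fun i j => if i = u ∧ j = u then true else leRow (leCol R u v) u v i j

/-- The effect of a gate: nothing or an exchange if the tokens are known to be comparable. -/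
def step (S : Tokens ℓ) (g : Fin ℓ × Fin ℓ) : Tokens ℓ :=
  if S.le (S.pos g.1) (S.pos g.2) then S
  else if S.le (S.pos g.2) (S.pos g.1) then
    { S with pos := Function.update (Function.update S.pos g.1 (S.pos g.2)) g.2 (S.pos g.1) }
  else
    { S with
      le := leGate S.le (S.pos g.1) (S.pos g.2)
      log := (S.pos g.1, S.pos g.2) :: S.log }

/-- The initial state; `st i` is the value of token `i` if it is constant, and `none` if not. -/
def init (st : Fin ℓ → Option Bool) : Tokens ℓ where
  pos := id
  le := fun i j => decide (i = j) || decide (st i = some false) || decide (st j = some true)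
  log := []

/-- The state after all gates. -/
def run (st : Fin ℓ → Option Bool) (gates : List (Fin ℓ × Fin ℓ)) : Tokens ℓ :=
  gates.foldl step (init st)

/-- A numerical code for a log. -/
def enc (B : ℕ) : List (Fin ℓ × Fin ℓ) → ℕ
  | [] => 0
  | g :: L => (enc B L * B + (g.1 + 1)) * B + (g.2 + 1)

/-- The digit that describes the token on the output wire. -/
def digit (st : Fin ℓ → Option Bool) (t : Fin ℓ) : ℕ :=
  match st t with
  | some b => b.toNat
  | none => t + 2

/-- The signature: it determines the function computed by the network. -/
def signature (st : Fin ℓ → Option Bool) (gates : List (Fin ℓ × Fin ℓ)) (out : Fin ℓ) : ℕ :=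
  enc (ℓ + 2) (run st gates).log * (ℓ + 2) + digit st ((run st gates).pos out)

/-- The invariant of the simplification. -/
structure Inv (st : Fin ℓ → Option Bool) (S : Tokens ℓ) : Prop where
  inj : Function.Injective S.pos
  refl : ∀ i, S.le i i = true
  trans : ∀ i j k, S.le i j = true → S.le j k = true → S.le i k = true
  bot : ∀ i, st i = some false → ∀ j, S.le i j = true
  top : ∀ j, st j = some true → ∀ i, S.le i j = true
  live : ∀ g ∈ S.log, st g.1 = none ∧ st g.2 = none

theorem inv_init (st : Fin ℓ → Option Bool) : Inv st (init st) where
  inj := Function.injective_id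
  refl i := by simp [init]
  trans i j k := by
    simp only [init, Bool.or_eq_true, decide_eq_true_eq]
    grind
  bot i h j := by simp [init, h]
  top j h i := by simp [init, h]
  live := by simp [init]

/-- An element below the meet is below both `u` and `v`, and whatever is above the meet was put
there by being above one of them, so chains through the new `u` compose; the new `v` is dual.
Incomparability excludes a chain from the join back to the meet, which would give `u ≤ v`. -/
theorem leGate_trans {R : Fin ℓ → Fin ℓ → Bool} {u v : Fin ℓ}
    (refl : ∀ i, R i i = true) (trans : ∀ i j k, R i j = true → R j k = true → R i k = true)
    (huv : R u v = false) (hvu : R v u = false) (i j k : Fin ℓ)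
    (hij : leGate R u v i j = true) (hjk : leGate R u v j k = true) :
    leGate R u v i k = true := by
  have hne : u ≠ v := fun h => by simp [h, refl] at huv
  simp only [leGate, leRow, leCol] at *
  by_cases i1 : i = u <;> by_cases i2 : i = v <;> by_cases j1 : j = u <;> by_cases j2 : j = v <;>
    by_cases k1 : k = u <;> by_cases k2 : k = v <;> simp_all <;> grind

/-- A constant token is below or above every token. This is why only live tokens enter the log. -/
theorem Inv.none_of_incomparable {st : Fin ℓ → Option Bool} {S : Tokens ℓ} (h : Inv st S)
    {u v : Fin ℓ} (huv : S.le u v = false) (hvu : S.le v u = false) : st u = none := by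
  rcases hu : st u with _ | _ | _
  · rfl
  · simp [h.bot u hu v] at huv
  · simp [h.top u hu v] at hvu

theorem Inv.step {st : Fin ℓ → Option Bool} {S : Tokens ℓ} (h : Inv st S) (g : Fin ℓ × Fin ℓ) :
    Inv st (S.step g) := by
  unfold Tokens.step
  split_ifs with h1 h2
  · exact h
  · refine ⟨?_, h.refl, h.trans, h.bot, h.top, h.live⟩
    have : Function.update (Function.update S.pos g.1 (S.pos g.2)) g.2 (S.pos g.1) =
        S.pos ∘ Equiv.swap g.1 g.2 := by
      funext w
      simp only [Function.update_apply, Function.comp, Equiv.swap_apply_def]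
      grind
    change Function.Injective (Function.update (Function.update S.pos g.1 (S.pos g.2)) g.2 (S.pos g.1))
    rw [this]
    exact h.inj.comp (Equiv.injective _)
  · simp only [Bool.not_eq_true] at h1 h2
    have hu := h.none_of_incomparable h1 h2
    have hv := h.none_of_incomparable h2 h1
    refine ⟨h.inj, ?_, leGate_trans h.refl h.trans h1 h2, ?_, ?_, ?_⟩
    -- At `u` reflexivity rests on the separate clause of `leGate`: the row and column rules alone
    -- would make the meet incomparable with itself.
    · intro i
      simp only [leGate, leRow, leCol]
      have := h.refl
      grind
    · intro i hi j
      have := h.bot i hi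
      simp only [leGate, leRow, leCol]
      grind
    · intro j hj i
      have := h.top j hj
      simp only [leGate, leRow, leCol]
      grind
    · intro g' hg'
      rcases List.mem_cons.1 hg' with rfl | hg'
      · exact ⟨hu, hv⟩
      · exact h.live g' hg'

theorem inv_run (st : Fin ℓ → Option Bool) (gates : List (Fin ℓ × Fin ℓ)) :
    Inv st (run st gates) := by
  unfold run
  generalize hS : init st = S
  have h : Inv st S := hS ▸ inv_init st
  clear hS
  induction gates generalizing S with
  | nil => exact h
  | cons g gs ih => exact ih _ (h.step g)

/-! ### The number of incomparable pairs bounds the length of the log -/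

/-- Incomparability as a number. -/
def inc (R : Fin ℓ → Fin ℓ → Bool) (i j : Fin ℓ) : ℕ := if R i j || R j i then 0 else 1

/-- The number of ordered pairs of incomparable tokens. -/
def potential (R : Fin ℓ → Fin ℓ → Bool) : ℕ := ∑ i, ∑ j, inc R i j

/-- Averages over a permutation in each index. A gate can make a single pair incomparable that was
comparable before; only the sums over orbits of the exchange of `u` and `v` are monotone. -/
theorem four_mul_potential (R : Fin ℓ → Fin ℓ → Bool) (π : Equiv.Perm (Fin ℓ)) :
    4 * potential R =
      ∑ i, ∑ j, (inc R i j + inc R (π i) j + inc R i (π j) + inc R (π i) (π j)) := by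
  simp only [Finset.sum_add_distrib]
  have h1 : ∀ i, ∑ j, inc R i (π j) = ∑ j, inc R i j := fun i => Equiv.sum_comp π (inc R i)
  simp only [h1]
  have h2 : ∑ i, ∑ j, inc R (π i) j = ∑ i, ∑ j, inc R i j :=
    Equiv.sum_comp π (fun i => ∑ j, inc R i j)
  rw [h2]
  unfold potential
  ring

/-- The pair `u`, `v` becomes comparable, and no other token loses more comparabilities with the two
than it gains. -/
theorem potential_leGate_lt {R : Fin ℓ → Fin ℓ → Bool} {u v : Fin ℓ}
    (refl : ∀ i, R i i = true) (trans : ∀ i j k, R i j = true → R j k = true → R i k = true)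
    (huv : R u v = false) (hvu : R v u = false) :
    potential (leGate R u v) < potential R := by
  have hne : u ≠ v := fun h => by simp [h, refl] at huv
  -- A token below one of `u`, `v` is below the join, and one above is above the meet. A token
  -- comparable with both cannot lie between them, since that would compare `u` with `v`; so it is
  -- below both or above both, hence comparable with the meet and with the join.
  have key : ∀ h, h ≠ u → h ≠ v → inc (leGate R u v) h u + inc (leGate R u v) h v ≤
      inc R h u + inc R h v := by
    intro h h1 h2
    have t1 := trans u h v
    have t2 := trans v h u
    simp only [inc, leGate, leRow, leCol]
    simp only [h1, h2, hne, hne.symm, if_true, if_false, false_and, and_false]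
    cases R h u <;> cases R h v <;> cases R u h <;> cases R v h <;> simp_all
  have symm : ∀ (Q : Fin ℓ → Fin ℓ → Bool) i j, inc Q i j = inc Q j i := by
    intro Q i j
    simp only [inc, Bool.or_comm]
  have other : ∀ i j, i ≠ u → i ≠ v → j ≠ u → j ≠ v → inc (leGate R u v) i j = inc R i j := by
    intro i j h1 h2 h3 h4
    simp [inc, leGate, leRow, leCol, h1, h2, h3, h4]
  have huu : inc (leGate R u v) u u = 0 := by simp [inc, leGate]
  have hvv : inc (leGate R u v) v v = 0 := by
    simp [inc, leGate, leRow, leCol, hne.symm, refl]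
  have huv' : inc (leGate R u v) u v = 0 := by
    simp [inc, leGate, leRow, leCol, hne.symm, refl]
  have ruv : inc R u v = 1 := by simp [inc, huv, hvu]
  have main : 4 * potential (leGate R u v) < 4 * potential R := by
    rw [four_mul_potential _ (Equiv.swap u v), four_mul_potential R (Equiv.swap u v)]
    have pt : ∀ i j, inc (leGate R u v) i j + inc (leGate R u v) (Equiv.swap u v i) j +
        inc (leGate R u v) i (Equiv.swap u v j) +
        inc (leGate R u v) (Equiv.swap u v i) (Equiv.swap u v j) ≤
        inc R i j + inc R (Equiv.swap u v i) j + inc R i (Equiv.swap u v j) +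
        inc R (Equiv.swap u v i) (Equiv.swap u v j) := by
      intro i j
      have k1 := key i
      have k2 := key j
      have s1 := symm (leGate R u v)
      have s2 := symm R
      have o := other i j
      have hvu' : inc (leGate R u v) v u = 0 := by rw [s1]; exact huv'
      by_cases i1 : i = u
      · subst i1
        simp only [Equiv.swap_apply_left]
        by_cases j1 : j = i
        · subst j1; simp only [Equiv.swap_apply_left]; omega
        by_cases j2 : j = v
        · subst j2; simp only [Equiv.swap_apply_right]; omega
        rw [Equiv.swap_apply_of_ne_of_ne j1 j2, s1 i j, s1 v j, s2 i j, s2 v j]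
        have := k2 j1 j2
        omega
      by_cases i2 : i = v
      · subst i2
        simp only [Equiv.swap_apply_right]
        by_cases j1 : j = u
        · subst j1; simp only [Equiv.swap_apply_left]; omega
        by_cases j2 : j = i
        · subst j2; simp only [Equiv.swap_apply_right]; omega
        rw [Equiv.swap_apply_of_ne_of_ne j1 j2, s1 i j, s1 u j, s2 i j, s2 u j]
        have := k2 j1 j2
        omega
      rw [Equiv.swap_apply_of_ne_of_ne i1 i2]
      by_cases j1 : j = u
      · subst j1; simp only [Equiv.swap_apply_left]; have := k1 i1 i2; omega
      by_cases j2 : j = v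
      · subst j2; simp only [Equiv.swap_apply_right]; have := k1 i1 i2; omega
      rw [Equiv.swap_apply_of_ne_of_ne j1 j2]
      have := o i1 i2 j1 j2
      omega
    -- The orbit of `(u, v)` supplies the strict inequality: its sum drops from a positive value to
    -- zero.
    refine Finset.sum_lt_sum (fun i _ => Finset.sum_le_sum fun j _ => pt i j)
      ⟨u, Finset.mem_univ _, Finset.sum_lt_sum (fun j _ => pt u j) ⟨v, Finset.mem_univ _, ?_⟩⟩
    simp only [Equiv.swap_apply_left, Equiv.swap_apply_right]
    rw [symm (leGate R u v) v u, huu, hvv, huv', ruv]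
    omega
  omega

/-- The tokens that are not constant. -/
def liveSet (st : Fin ℓ → Option Bool) : Finset (Fin ℓ) := Finset.univ.filter fun i => st i = none

/-- Initially every pair that contains a constant is comparable, which leaves the ordered pairs of
live tokens. -/
theorem potential_init_le (st : Fin ℓ → Option Bool) :
    potential (init st).le ≤ (liveSet st).card ^ 2 := by
  have : ∀ i j, inc (init st).le i j ≤
      (if st i = none then 1 else 0) * (if st j = none then 1 else 0) := by
    intro i j
    have const : ∀ k, st k ≠ none → st k = some false ∨ st k = some true := by
      intro k
      rcases st k with _ | _ | _ <;> simp
    by_cases hi : st i = none <;> by_cases hj : st j = none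
    · simp only [inc, hi, hj, if_true]
      split_ifs <;> simp
    · rcases const j hj with h | h <;> simp [inc, init, h]
    · rcases const i hi with h | h <;> simp [inc, init, h]
    · rcases const i hi with h | h <;> simp [inc, init, h]
  calc potential (init st).le
      ≤ ∑ i, ∑ j, (if st i = none then 1 else 0) * (if st j = none then 1 else 0) :=
        Finset.sum_le_sum fun i _ => Finset.sum_le_sum fun j _ => this i j
    _ = (liveSet st).card ^ 2 := by
        rw [← Finset.sum_mul_sum, sq, liveSet, Finset.card_filter]

/-- Each new log entry is paid for by the potential, so the length of the log plus the potential
never increases. -/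
theorem length_log_run_le (st : Fin ℓ → Option Bool) (gates : List (Fin ℓ × Fin ℓ)) :
    (run st gates).log.length ≤ (liveSet st).card ^ 2 := by
  have gen : ∀ S, Inv st S → (gates.foldl step S).log.length +
      potential (gates.foldl step S).le ≤ S.log.length + potential S.le := by
    induction gates with
    | nil => intro S _; simp
    | cons g gs ih =>
      intro S hS
      refine (ih _ (hS.step g)).trans ?_
      unfold step
      split_ifs with h1 h2
      · exact le_rfl
      · exact le_rfl
      · simp only [Bool.not_eq_true] at h1 h2
        have := potential_leGate_lt hS.refl hS.trans h1 h2
        simp only [List.length_cons]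
        omega
  have := gen _ (inv_init st)
  have h2 := potential_init_le st
  have h3 : (init st).log.length = 0 := rfl
  unfold run
  omega

/-! ### Logs and signatures as numbers -/

theorem enc_lt {B : ℕ} (hB : ℓ + 1 ≤ B) (L : List (Fin ℓ × Fin ℓ)) :
    enc B L < B ^ (2 * L.length) := by
  induction L with
  | nil => simp [enc]
  | cons g L ih =>
    have h1 := g.1.2
    have h2 := g.2.2
    simp only [enc, List.length_cons]
    have e : B ^ (2 * (L.length + 1)) = B ^ (2 * L.length) * B * B := by ring
    rw [e]
    have a : enc B L * B + (g.1 + 1) < B ^ (2 * L.length) * B := by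
      calc enc B L * B + (g.1 + 1) < enc B L * B + B := by omega
        _ = (enc B L + 1) * B := by ring
        _ ≤ _ := Nat.mul_le_mul_right _ ih
    calc (enc B L * B + (g.1 + 1)) * B + (g.2 + 1) < (enc B L * B + (g.1 + 1)) * B + B := by omega
      _ = (enc B L * B + (g.1 + 1) + 1) * B := by ring
      _ ≤ _ := Nat.mul_le_mul_right _ a

theorem mul_add_inj {B a b x y : ℕ} (hx : x < B) (hy : y < B) (h : a * B + x = b * B + y) :
    a = b ∧ x = y := by
  have hB : 0 < B := by omega
  have h1 : (a * B + x) / B = a := by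
    rw [mul_comm, Nat.mul_add_div hB, Nat.div_eq_of_lt hx, add_zero]
  have h2 : (b * B + y) / B = b := by
    rw [mul_comm, Nat.mul_add_div hB, Nat.div_eq_of_lt hy, add_zero]
  have : a = b := by rw [← h1, ← h2, h]
  subst this
  exact ⟨rfl, by omega⟩

/-- All digits are shifted by one and hence nonzero, so logs of different lengths have different
codes; the base must exceed the largest digit `ℓ`. -/
theorem enc_injective {B : ℕ} (hB : ℓ + 1 ≤ B) :
    Function.Injective (enc B : List (Fin ℓ × Fin ℓ) → ℕ) := by
  intro L
  induction L with
  | nil => intro L' h; cases L' with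
    | nil => rfl
    | cons g L' => simp [enc] at h
  | cons g L ih => intro L' h; cases L' with
    | nil => simp [enc] at h
    | cons g' L' =>
      have := g.1.2
      have := g.2.2
      have := g'.1.2
      have := g'.2.2
      simp only [enc] at h
      obtain ⟨h, e2⟩ := mul_add_inj (by omega) (by omega) h
      obtain ⟨h, e1⟩ := mul_add_inj (by omega) (by omega) h
      rw [ih h, Prod.ext (Fin.ext (by omega : (g.1 : ℕ) = g'.1)) (Fin.ext (by omega : (g.2 : ℕ) = g'.2))]

theorem digit_lt (st : Fin ℓ → Option Bool) (t : Fin ℓ) : digit st t < ℓ + 2 := by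
  unfold digit
  split
  · next b _ => have := b.toNat_le; omega
  · omega

theorem signature_lt (st : Fin ℓ → Option Bool) (gates : List (Fin ℓ × Fin ℓ)) (out : Fin ℓ) :
    signature st gates out < (ℓ + 2) ^ (2 * (liveSet st).card ^ 2) * (ℓ + 2) := by
  have h1 := enc_lt (by omega : ℓ + 1 ≤ ℓ + 2) (run st gates).log
  have h2 : (ℓ + 2) ^ (2 * (run st gates).log.length) ≤ (ℓ + 2) ^ (2 * (liveSet st).card ^ 2) :=
    Nat.pow_le_pow_right (by omega) (Nat.mul_le_mul_left _ (length_log_run_le st gates))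
  have h3 := digit_lt st ((run st gates).pos out)
  calc signature st gates out < enc (ℓ + 2) (run st gates).log * (ℓ + 2) + (ℓ + 2) := by
        unfold signature; omega
    _ = (enc (ℓ + 2) (run st gates).log + 1) * (ℓ + 2) := by ring
    _ ≤ _ := Nat.mul_le_mul_right _ (h1.trans_le h2)

/-! ### The signature determines the function -/

/-- The values of the tokens after the gates of a log. -/
def values (f : Fin ℓ → Bool) (L : List (Fin ℓ × Fin ℓ)) : Fin ℓ → Bool :=
  L.foldr (fun g f => ComparatorCircuit.applyGate f g) f

/-- The invariant that relates the tokens to the network with initial values `f`. -/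
structure Sound (f : Fin ℓ → Bool) (S : Tokens ℓ) (val : Fin ℓ → Bool) : Prop where
  val_eq : ∀ w, val w = values f S.log (S.pos w)
  le : ∀ i j, S.le i j = true → values f S.log i ≤ values f S.log j

/-- Token values change only at a logged gate. There the row and column rules are the lattice laws:
being above either of two elements suffices to be above their meet, being below the meet means being
below both, and dually for joins. -/
theorem Sound.step {st : Fin ℓ → Option Bool} {f : Fin ℓ → Bool} {S : Tokens ℓ}
    {val : Fin ℓ → Bool} (hI : Inv st S) (h : Sound f S val) (g : Fin ℓ × Fin ℓ) :
    Sound f (S.step g) (ComparatorCircuit.applyGate val g) := by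
  unfold Tokens.step
  split_ifs with h1 h2
  · refine ⟨fun w => ?_, h.le⟩
    have := h.le _ _ h1
    have e1 := h.val_eq g.1
    have e2 := h.val_eq g.2
    rw [← e1, ← e2] at this
    have e3 := h.val_eq w
    rw [← e3]
    simp only [ComparatorCircuit.applyGate, Function.update_apply]
    revert this
    split_ifs with c1 c2
    · subst c1; cases val g.1 <;> cases val g.2 <;> simp
    · subst c2; cases val g.1 <;> cases val g.2 <;> simp
    · simp
  · refine ⟨fun w => ?_, h.le⟩
    have := h.le _ _ h2
    have e1 := h.val_eq g.1
    have e2 := h.val_eq g.2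
    rw [← e1, ← e2] at this
    have e3 := h.val_eq w
    simp only [ComparatorCircuit.applyGate, Function.update_apply]
    revert this
    split_ifs with c1 c2
    · rw [← e1]; cases val g.1 <;> cases val g.2 <;> simp
    · rw [← e2]; cases val g.1 <;> cases val g.2 <;> simp
    · simp [e3]
  · simp only [Bool.not_eq_true] at h1 h2
    have hne : S.pos g.1 ≠ S.pos g.2 := fun e => by rw [e, hI.refl] at h1; simp at h1
    constructor
    · intro w
      simp only [values, List.foldr_cons]
      change _ = ComparatorCircuit.applyGate (values f S.log) _ _
      simp only [ComparatorCircuit.applyGate, Function.update_apply, h.val_eq, hI.inj.eq_iff]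
    · intro i j hij
      simp only [values, List.foldr_cons]
      change ComparatorCircuit.applyGate (values f S.log) _ _ ≤
        ComparatorCircuit.applyGate (values f S.log) _ _
      have H := h.le
      generalize values f S.log = x at *
      generalize S.pos g.1 = u at *
      generalize S.pos g.2 = v at *
      simp only [ComparatorCircuit.applyGate, Function.update_apply]
      simp only [leGate, leRow, leCol] at hij
      have a1 := H i u
      have a2 := H i v
      have a3 := H u j
      have a4 := H v j
      have a5 := H i j
      by_cases i1 : i = u
      · by_cases j1 : j = u
        · simp [i1, j1]
        · by_cases j2 : j = v
          · simp only [i1, j2, hne, hne.symm, if_true, if_false]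
            cases x u <;> cases x v <;> simp
          · simp only [i1, j1, j2, hne, if_true, if_false, and_false, Bool.or_eq_true] at hij ⊢
            revert a3 a4 hij
            cases x u <;> cases x v <;> cases x j <;> cases S.le u j <;> cases S.le v j <;> simp
      · by_cases i2 : i = v
        · by_cases j1 : j = u
          · simp [i2, j1, hne.symm, h1, h2] at hij
          · by_cases j2 : j = v
            · simp [i2, j2]
            · simp only [i2, j1, j2, hne.symm, if_true, if_false, and_false,
                Bool.and_eq_true] at hij ⊢
              revert a3 a4 hij
              cases x u <;> cases x v <;> cases x j <;> cases S.le u j <;> cases S.le v j <;> simp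
        · by_cases j1 : j = u
          · simp only [i1, i2, j1, hne, if_true, if_false, false_and,
              Bool.and_eq_true] at hij ⊢
            revert a1 a2 hij
            cases x u <;> cases x v <;> cases x i <;> cases S.le i u <;> cases S.le i v <;> simp
          · by_cases j2 : j = v
            · simp only [i1, i2, j2, hne.symm, if_true, if_false, false_and,
                Bool.or_eq_true] at hij ⊢
              revert a1 a2 hij
              cases x u <;> cases x v <;> cases x i <;> cases S.le i u <;> cases S.le i v <;> simp
            · simp only [i1, i2, j1, j2, if_false, false_and] at hij ⊢
              exact a5 hij

/-- `f` extends the constants `st`. -/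
def Consistent (st : Fin ℓ → Option Bool) (f : Fin ℓ → Bool) : Prop :=
  ∀ i b, st i = some b → f i = b

theorem sound_run {st : Fin ℓ → Option Bool} {f : Fin ℓ → Bool} (hf : Consistent st f)
    (gates : List (Fin ℓ × Fin ℓ)) :
    Sound f (run st gates) (gates.foldl ComparatorCircuit.applyGate f) := by
  have h0 : Sound f (init st) f := by
    refine ⟨fun w => rfl, fun i j h => ?_⟩
    simp only [init, Bool.or_eq_true, decide_eq_true_eq] at h
    change f i ≤ f j
    rcases h with (rfl | h) | h
    · exact le_rfl
    · rw [hf _ _ h]; exact Bool.false_le _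
    · rw [hf _ _ h]; exact Bool.le_true _
  have gen : ∀ S val, Inv st S → Sound f S val →
      Sound f (gates.foldl step S) (gates.foldl ComparatorCircuit.applyGate val) := by
    induction gates with
    | nil => exact fun S val _ h => h
    | cons g gs ih => exact fun S val hI h => ih _ _ (hI.step g) (h.step hI g)
  exact gen _ _ (inv_init st) h0

/-- The logged gates form a network on the live tokens alone, so the constants have no influence on
it. -/
theorem values_eq_of_live {st : Fin ℓ → Option Bool} {f f' : Fin ℓ → Bool}
    {L : List (Fin ℓ × Fin ℓ)} (hL : ∀ g ∈ L, st g.1 = none ∧ st g.2 = none)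
    (h : ∀ i, st i = none → f i = f' i) (i : Fin ℓ) (hi : st i = none) :
    values f L i = values f' L i := by
  induction L generalizing i with
  | nil => exact h i hi
  | cons g L ih =>
    have ih' := ih fun g hg => hL g (List.mem_cons_of_mem _ hg)
    obtain ⟨h1, h2⟩ := hL g List.mem_cons_self
    change ComparatorCircuit.applyGate (values f L) g i =
      ComparatorCircuit.applyGate (values f' L) g i
    simp only [ComparatorCircuit.applyGate, Function.update_apply, ih' _ h1, ih' _ h2, ih' _ hi]

theorem values_eq_of_const {st : Fin ℓ → Option Bool} {f : Fin ℓ → Bool}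
    {L : List (Fin ℓ × Fin ℓ)} (hL : ∀ g ∈ L, st g.1 = none ∧ st g.2 = none)
    (i : Fin ℓ) (hi : st i ≠ none) : values f L i = f i := by
  induction L with
  | nil => rfl
  | cons g L ih =>
    have ih' := ih fun g hg => hL g (List.mem_cons_of_mem _ hg)
    obtain ⟨h1, h2⟩ := hL g List.mem_cons_self
    change ComparatorCircuit.applyGate (values f L) g i = _
    have n1 : i ≠ g.1 := fun e => hi (e ▸ h1)
    have n2 : i ≠ g.2 := fun e => hi (e ▸ h2)
    simp only [ComparatorCircuit.applyGate, Function.update_apply, n1, n2, if_false, ih']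

/-- Networks with the same signature compute the same function of the live inputs. -/
theorem foldl_eq_of_signature_eq {st st' : Fin ℓ → Option Bool} {f f' : Fin ℓ → Bool}
    {gates : List (Fin ℓ × Fin ℓ)} {out : Fin ℓ} (hf : Consistent st f) (hf' : Consistent st' f')
    (h : ∀ i, st i = none → f i = f' i)
    (hs : signature st gates out = signature st' gates out) :
    gates.foldl ComparatorCircuit.applyGate f out =
      gates.foldl ComparatorCircuit.applyGate f' out := by
  obtain ⟨h1, h2⟩ := mul_add_inj (digit_lt _ _) (digit_lt _ _) hs
  -- The two final states may differ on other wires; only the logs and the tokens on the output wire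
  -- are compared.
  have hL := enc_injective (by omega) h1
  rw [(sound_run hf gates).val_eq, (sound_run hf' gates).val_eq, ← hL]
  have hlive := (inv_run st gates).live
  have hlive' := (inv_run st' gates).live
  rw [← hL] at hlive'
  generalize (run st gates).pos out = t at *
  generalize (run st' gates).pos out = t' at *
  -- Constants have the digits 0 and 1, live tokens the digits from 2 on, so the two mixed cases
  -- contradict the equality of digits.
  rcases e : st t with _ | b <;> rcases e' : st' t' with _ | b'
  · simp only [digit, e, e'] at h2
    obtain rfl : t = t' := Fin.ext (by omega)
    exact values_eq_of_live hlive h t e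
  · simp only [digit, e, e'] at h2
    have := b'.toNat_le
    omega
  · simp only [digit, e, e'] at h2
    have := b.toNat_le
    omega
  · simp only [digit, e, e'] at h2
    rw [values_eq_of_const hlive t (by simp [e]), values_eq_of_const hlive' t' (by simp [e']),
      hf _ _ e, hf' _ _ e']
    revert h2
    cases b <;> cases b' <;> simp

/-- If no input is live, then the signature is the output. -/
theorem signature_const (f : Fin ℓ → Bool) (gates : List (Fin ℓ × Fin ℓ)) (out : Fin ℓ) :
    signature (fun i => some (f i)) gates out =
      (gates.foldl ComparatorCircuit.applyGate f out).toNat := by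
  have hc : Consistent (fun i => some (f i)) f := fun i b h => by simpa using h
  have hl : (run (fun i => some (f i)) gates).log = [] := by
    rw [List.eq_nil_iff_forall_not_mem]
    intro g hg
    simpa using ((inv_run _ gates).live g hg).1
  rw [(sound_run hc gates).val_eq, signature, hl]
  simp [enc, digit, values]

end Tokens

/-! A total imperative language with variables `V`, arrays `A` and bounded repetition, and its
compilation to random access machines. -/

namespace Imp

open RAM (Program Exec)

/-- Expressions; `inp e` reads the input at position `e`. -/
inductive Exp (V A : Type) where
  | lit (c : ℕ) : Exp V A
  | var (r : V) : Exp V A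
  | add (e f : Exp V A) : Exp V A
  | sub (e f : Exp V A) : Exp V A
  | inp (e : Exp V A) : Exp V A
  | get (k : A) (e : Exp V A) : Exp V A

/-- Commands; `rep r c` repeats `c` as often as the value of `r` at the beginning says. -/
inductive Cmd (V A : Type) where
  | skip : Cmd V A
  | set (r : V) (e : Exp V A) : Cmd V A
  | put (k : A) (e f : Exp V A) : Cmd V A
  | seq (c d : Cmd V A) : Cmd V A
  | ite (e : Exp V A) (c d : Cmd V A) : Cmd V A
  | rep (r : V) (c : Cmd V A) : Cmd V A

/-- The values of the variables and arrays. -/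
@[ext] structure St (V A : Type) where
  reg : V → ℕ
  arr : A → ℕ → ℕ

variable {V A : Type}

/-- The value of an expression on the input `I`. -/
def Exp.eval (I : ℕ → ℕ) (σ : St V A) : Exp V A → ℕ
  | .lit c => c
  | .var r => σ.reg r
  | .add e f => e.eval I σ + f.eval I σ
  | .sub e f => e.eval I σ - f.eval I σ
  | .inp e => I (e.eval I σ)
  | .get k e => σ.arr k (e.eval I σ)

/-- The logarithmic cost of an expression, up to a factor. -/
def Exp.vol (I : ℕ → ℕ) (σ : St V A) : Exp V A → ℕ
  | .lit c => 1 + Nat.size c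
  | .var r => 1 + Nat.size (σ.reg r)
  | .add e f => e.vol I σ + f.vol I σ + 1 + Nat.size (e.eval I σ) + Nat.size (f.eval I σ)
  | .sub e f => e.vol I σ + f.vol I σ + 1 + Nat.size (e.eval I σ) + Nat.size (f.eval I σ)
  | .inp e => e.vol I σ + 1 + Nat.size (e.eval I σ) + Nat.size (I (e.eval I σ))
  | .get k e => e.vol I σ + 1 + Nat.size (e.eval I σ) + Nat.size (σ.arr k (e.eval I σ))

variable [DecidableEq V] [DecidableEq A]

/-- The effect of a command on the input `I`. -/
def Cmd.den (I : ℕ → ℕ) : Cmd V A → St V A → St V A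
  | .skip, σ => σ
  | .set r e, σ => { σ with reg := Function.update σ.reg r (e.eval I σ) }
  | .put k e f, σ =>
    { σ with
      arr := Function.update σ.arr k (Function.update (σ.arr k) (e.eval I σ) (f.eval I σ)) }
  | .seq c d, σ => d.den I (c.den I σ)
  | .ite e c d, σ => if e.eval I σ ≠ 0 then c.den I σ else d.den I σ
  | .rep r c, σ => (c.den I)^[σ.reg r] σ

/-- The logarithmic cost of a command, up to a factor. -/
def Cmd.vol (I : ℕ → ℕ) : Cmd V A → St V A → ℕ
  | .skip, _ => 1
  | .set _ e, σ => e.vol I σ + 1 + Nat.size (e.eval I σ)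
  | .put _ e f, σ =>
    e.vol I σ + f.vol I σ + 1 + Nat.size (e.eval I σ) + Nat.size (f.eval I σ)
  | .seq c d, σ => c.vol I σ + d.vol I (c.den I σ)
  | .ite e c d, σ =>
    e.vol I σ + 1 + Nat.size (e.eval I σ) + if e.eval I σ ≠ 0 then c.vol I σ else d.vol I σ
  | .rep r c, σ => 1 + Nat.size (σ.reg r) +
      ∑ i ∈ Finset.range (σ.reg r), (2 + Nat.size (σ.reg r) + c.vol I ((c.den I)^[i] σ))

/-! ### Compilation -/

/-- Turns the index in the temporary register `3 * d + 4` into the address of the cell of the array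
number `k`. -/
def address (d k : ℕ) : Program :=
  .seq (.add (3 * d + 4) (3 * d + 4) (3 * d + 4)) <|
  .seq (.add (3 * d + 4) (3 * d + 4) (3 * d + 4)) <|
  .seq (.add (3 * d + 4) (3 * d + 4) (3 * d + 4)) <|
  .seq (.add (3 * d + 4) (3 * d + 4) 1) <|
  .seq (.const (3 * d + 7) k) (.add (3 * d + 4) (3 * d + 4) (3 * d + 7))

variable (x : V → ℕ) (y : A → ℕ)

/-- Evaluates an expression into the register `3 * d + 4`. -/
def Exp.compile (d : ℕ) : Exp V A → Program
  | .lit c => .const (3 * d + 4) c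
  | .var r => .add (3 * d + 4) (3 * x r + 3) 2
  | .add e f =>
    .seq (e.compile d) (.seq (f.compile (d + 1)) (.add (3 * d + 4) (3 * d + 4) (3 * d + 7)))
  | .sub e f =>
    .seq (e.compile d) (.seq (f.compile (d + 1)) (.sub (3 * d + 4) (3 * d + 4) (3 * d + 7)))
  | .inp e => .seq (e.compile d) (.seq (.sub (3 * d + 7) 1 (3 * d + 4))
      (.cond (3 * d + 7) (.load (3 * d + 4) (3 * d + 4)) (.const (3 * d + 4) 0)))
  | .get k e => .seq (e.compile d) (.seq (address d (y k)) (.load (3 * d + 4) (3 * d + 4)))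

/-- The program of a command inside `d` loops. -/
def Cmd.compile (d : ℕ) : Cmd V A → Program
  | .skip => .skip
  | .set r e => .seq (e.compile x y 0) (.add (3 * x r + 3) 4 2)
  | .put k e f => .seq (.seq (e.compile x y 0) (address 0 (y k)))
      (.seq (f.compile x y 1) (.store 4 7))
  | .seq c c' => .seq (c.compile d) (c'.compile d)
  | .ite e c c' => .seq (e.compile x y 0) (.cond 4 (c.compile d) (c'.compile d))
  | .rep r c => .seq (.add (3 * d + 5) (3 * x r + 3) 2)
      (.loop (3 * d + 5) (.seq (c.compile (d + 1))
        (.seq (.const 4 1) (.sub (3 * d + 5) (3 * d + 5) 4))))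

variable {x y}

/-- The configuration `ρ` of the machine represents `σ`. -/
structure Sim (x : V → ℕ) (y : A → ℕ) (I : ℕ → ℕ) (base : ℕ) (σ : St V A) (ρ : RAM.State) :
    Prop where
  reg_one : ρ.reg 1 = base
  zero : ρ.reg 2 = 0
  reg : ∀ r, ρ.reg (3 * x r + 3) = σ.reg r
  arr : ∀ k i, ρ.mem (base + 8 * i + y k) = σ.arr k i
  inp : ∀ i < base, ρ.mem i = I i

theorem reg_setReg (ρ : RAM.State) (i j v : ℕ) :
    (ρ.setReg i v).reg j = if j = i then v else ρ.reg j := by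
  simp [RAM.State.setReg, Function.update_apply]

theorem mem_setReg (ρ : RAM.State) (i v : ℕ) : (ρ.setReg i v).mem = ρ.mem := rfl

theorem reg_setMem (ρ : RAM.State) (i v : ℕ) : (ρ.setMem i v).reg = ρ.reg := rfl

theorem mem_setMem (ρ : RAM.State) (i j v : ℕ) :
    (ρ.setMem i v).mem j = if j = i then v else ρ.mem j := by
  simp [RAM.State.setMem, Function.update_apply]

omit [DecidableEq V] [DecidableEq A] in
-- Registers are sorted by residue modulo 3: program variables sit at `3 * x r + 3`, temporaries at
-- `3 * d + 4`, loop counters at `3 * d + 5`. The small registers 1 and 2 hold the input length and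
-- zero. Hence evaluating an expression, which touches only temporaries, preserves the simulation.
theorem Sim.congr {I : ℕ → ℕ} {base : ℕ} {σ : St V A} {ρ ρ' : RAM.State}
    (h : Sim x y I base σ ρ) (hm : ρ'.mem = ρ.mem)
    (hr : ∀ r, r % 3 ≠ 1 ∨ r < 4 → ρ'.reg r = ρ.reg r) : Sim x y I base σ ρ' where
  reg_one := by rw [hr 1 (by omega), h.reg_one]
  zero := by rw [hr 2 (by omega), h.zero]
  reg r := by rw [hr _ (by omega), h.reg]
  arr k i := by rw [hm, h.arr]
  inp i hi := by rw [hm, h.inp i hi]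

theorem size_add_le (a b : ℕ) : Nat.size (a + b) ≤ Nat.size a + Nat.size b + 1 := by
  rw [Nat.size_le]
  have h1 := Nat.lt_size_self a
  have h2 := Nat.lt_size_self b
  have h3 : 2 ^ Nat.size a ≤ 2 ^ (Nat.size a + Nat.size b) :=
    Nat.pow_le_pow_right (by omega) (by omega)
  have h4 : 2 ^ Nat.size b ≤ 2 ^ (Nat.size a + Nat.size b) :=
    Nat.pow_le_pow_right (by omega) (by omega)
  rw [pow_succ]
  omega

theorem size_double_le (a : ℕ) : Nat.size (a + a) ≤ Nat.size a + 1 := by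
  rw [Nat.size_le]
  have h1 := Nat.lt_size_self a
  rw [pow_succ]
  omega

theorem size_le_self (a : ℕ) : Nat.size a ≤ a := by
  rw [Nat.size_le]
  exact Nat.lt_two_pow_self

/-- Addresses carry about `Nat.size base` extra bits. Since each volume term is at least 1, this
additive overhead is absorbed into the factor `Nat.size base + 1`. -/
theorem factor_le (β v : ℕ) (hv : 1 ≤ v) : β + v ≤ (β + 1) * v := by
  nlinarith

/-- Three doublings give the stride 8, so up to eight unbounded arrays are interleaved above the
input without multiplication. -/
theorem exec_address (d k : ℕ) (hk : k < 8) (ρ : RAM.State) :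
    ∃ t ρ', Exec (address d k) ρ t ρ' ∧ ρ'.mem = ρ.mem ∧
      ρ'.reg (3 * d + 4) = ρ.reg 1 + 8 * ρ.reg (3 * d + 4) + k ∧
      (∀ r, r % 3 ≠ 1 ∨ r < 3 * d + 4 → ρ'.reg r = ρ.reg r) ∧
      t ≤ 34 + 8 * Nat.size (ρ.reg (3 * d + 4)) + 2 * Nat.size (ρ.reg 1) := by
  refine ⟨_, _, .seq (.add _ _ _ _) (.seq (.add _ _ _ _) (.seq (.add _ _ _ _)
    (.seq (.add _ _ _ _) (.seq (.const _ _ _) (.add _ _ _ _))))), ?_, ?_, ?_, ?_⟩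
  · simp only [mem_setReg]
  · simp only [reg_setReg]
    simp
    ring
  · intro r hr
    have h1 : r ≠ 3 * d + 4 := by omega
    have h2 : r ≠ 3 * d + 7 := by omega
    simp [reg_setReg, h1, h2]
  · simp only [reg_setReg]
    simp
    generalize ρ.reg (3 * d + 4) = a
    generalize ρ.reg 1 = b
    have h1 := size_double_le a
    have h2 := size_double_le (a + a)
    have h3 := size_double_le (a + a + (a + a))
    have h4 := size_add_le (a + a + (a + a) + (a + a + (a + a))) b
    have h5 : Nat.size k ≤ 3 := Nat.size_le.2 (by omega)
    omega

omit [DecidableEq V] [DecidableEq A] in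
-- The depth `d` works as the height of an evaluation stack: the second operand is computed one
-- level higher and leaves the first one intact.
theorem exec_exp (hy : ∀ k, y k < 8) {I : ℕ → ℕ} {base : ℕ} (hI : ∀ i, base ≤ i → I i = 0)
    {σ : St V A} (e : Exp V A) : ∀ (d : ℕ) (ρ : RAM.State), Sim x y I base σ ρ →
    ∃ t ρ', Exec (e.compile x y d) ρ t ρ' ∧ ρ'.mem = ρ.mem ∧
      ρ'.reg (3 * d + 4) = e.eval I σ ∧
      (∀ r, r % 3 ≠ 1 ∨ r < 3 * d + 4 → ρ'.reg r = ρ.reg r) ∧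
      t ≤ 64 * ((Nat.size base + 1) * e.vol I σ) := by
  have binary : ∀ (e f : Exp V A) (d : ℕ) (ρ : RAM.State),
      (∀ (d : ℕ) (ρ : RAM.State), Sim x y I base σ ρ →
        ∃ t ρ', Exec (e.compile x y d) ρ t ρ' ∧ ρ'.mem = ρ.mem ∧
        ρ'.reg (3 * d + 4) = e.eval I σ ∧
        (∀ r, r % 3 ≠ 1 ∨ r < 3 * d + 4 → ρ'.reg r = ρ.reg r) ∧
        t ≤ 64 * ((Nat.size base + 1) * e.vol I σ)) →
      (∀ (d : ℕ) (ρ : RAM.State), Sim x y I base σ ρ →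
        ∃ t ρ', Exec (f.compile x y d) ρ t ρ' ∧ ρ'.mem = ρ.mem ∧
        ρ'.reg (3 * d + 4) = f.eval I σ ∧
        (∀ r, r % 3 ≠ 1 ∨ r < 3 * d + 4 → ρ'.reg r = ρ.reg r) ∧
        t ≤ 64 * ((Nat.size base + 1) * f.vol I σ)) → Sim x y I base σ ρ →
      ∃ t ρ' t', ∃ ρ'' : RAM.State, Exec (e.compile x y d) ρ t ρ' ∧
        Exec (f.compile x y (d + 1)) ρ' t' ρ'' ∧
        ρ''.mem = ρ.mem ∧ ρ''.reg (3 * d + 4) = e.eval I σ ∧ ρ''.reg (3 * d + 7) = f.eval I σ ∧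
        (∀ r, r % 3 ≠ 1 ∨ r < 3 * d + 4 → ρ''.reg r = ρ.reg r) ∧
        t + (t' + (1 + Nat.size (e.eval I σ) + Nat.size (f.eval I σ))) ≤
          64 * ((Nat.size base + 1) * (e.vol I σ + f.vol I σ + 1 + Nat.size (e.eval I σ) +
            Nat.size (f.eval I σ))) := by
    intro e f d ρ he hf h
    obtain ⟨t, ρ', h1, h2, h3, h4, h5⟩ := he d ρ h
    obtain ⟨t', ρ'', k1, k2, k3, k4, k5⟩ :=
      hf (d + 1) ρ' (h.congr h2 fun r hr => h4 r (by omega))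
    refine ⟨t, ρ', t', ρ'', h1, k1, k2.trans h2, ?_, k3, ?_, ?_⟩
    · rw [k4 _ (by omega), h3]
    · intro r hr
      rw [k4 r (by omega), h4 r hr]
    · have := factor_le (Nat.size base) (1 + Nat.size (e.eval I σ) + Nat.size (f.eval I σ))
        (by omega)
      rw [show (Nat.size base + 1) * (e.vol I σ + f.vol I σ + 1 + Nat.size (e.eval I σ) +
            Nat.size (f.eval I σ)) = (Nat.size base + 1) * e.vol I σ +
            (Nat.size base + 1) * f.vol I σ + (Nat.size base + 1) *
            (1 + Nat.size (e.eval I σ) + Nat.size (f.eval I σ)) by ring]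
      omega
  induction e with
  | lit c =>
    intro d ρ h
    refine ⟨_, _, .const _ _ _, mem_setReg _ _ _, ?_, ?_, ?_⟩
    · simp [reg_setReg, Exp.eval]
    · intro r hr
      have h1 : r ≠ 3 * d + 4 := by omega
      simp [reg_setReg, h1]
    · have := factor_le (Nat.size base) (1 + Nat.size c) (by omega)
      simp only [Exp.vol]
      omega
  | var r =>
    intro d ρ h
    refine ⟨_, _, .add _ _ _ _, mem_setReg _ _ _, ?_, ?_, ?_⟩
    · simp [reg_setReg, Exp.eval, h.reg, h.zero]
    · intro r hr
      have h1 : r ≠ 3 * d + 4 := by omega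
      simp [reg_setReg, h1]
    · have := factor_le (Nat.size base) (1 + Nat.size (σ.reg r)) (by omega)
      simp only [Exp.vol, h.reg, h.zero, Nat.size_zero]
      omega
  | add e f he hf =>
    intro d ρ h
    obtain ⟨t, ρ', t', ρ'', h1, h2, h3, h4, h5, h6, h7⟩ := binary e f d ρ he hf h
    refine ⟨_, _, .seq h1 (.seq h2 (.add _ _ _ _)), ?_, ?_, ?_, ?_⟩
    · rw [mem_setReg, h3]
    · simp [reg_setReg, h4, h5, Exp.eval]
    · intro r hr
      have : r ≠ 3 * d + 4 := by omega
      simp [reg_setReg, this, h6 r hr]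
    · simp only [h4, h5]
      exact h7
  | sub e f he hf =>
    intro d ρ h
    obtain ⟨t, ρ', t', ρ'', h1, h2, h3, h4, h5, h6, h7⟩ := binary e f d ρ he hf h
    refine ⟨_, _, .seq h1 (.seq h2 (.sub _ _ _ _)), ?_, ?_, ?_, ?_⟩
    · rw [mem_setReg, h3]
    · simp [reg_setReg, h4, h5, Exp.eval]
    · intro r hr
      have : r ≠ 3 * d + 4 := by omega
      simp [reg_setReg, this, h6 r hr]
    · simp only [h4, h5]
      exact h7
  | inp e he =>
    intro d ρ h
    obtain ⟨t, ρ', h1, h2, h3, h4, h5⟩ := he d ρ h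
    have hb : ρ'.reg 1 = base := by rw [h4 1 (by omega), h.reg_one]
    have hs : Nat.size (base - e.eval I σ) ≤ Nat.size base := Nat.size_le_size (by omega)
    have hv := factor_le (Nat.size base)
      (1 + Nat.size (e.eval I σ) + Nat.size (I (e.eval I σ))) (by omega)
    have expand : (Nat.size base + 1) * (e.vol I σ + 1 + Nat.size (e.eval I σ) +
        Nat.size (I (e.eval I σ))) = (Nat.size base + 1) * e.vol I σ + (Nat.size base + 1) *
          (1 + Nat.size (e.eval I σ) + Nat.size (I (e.eval I σ))) := by ring
    -- The cells from `base` on belong to the arrays, so a reading position outside the input must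
    -- not be looked up; the program then produces 0, which is the value of `I` there.
    by_cases hc : e.eval I σ < base
    · refine ⟨_, _, .seq h1 (.seq (.sub _ _ _ _) (.condTrue ?_ (.load _ _ _))), ?_, ?_, ?_, ?_⟩
      · simp only [reg_setReg, hb, h3]
        simp
        omega
      · simp only [mem_setReg, h2]
      · simp only [reg_setReg, mem_setReg, h3, h2, Exp.eval]
        simp [h.inp _ hc]
      · intro r hr
        have n1 : r ≠ 3 * d + 4 := by omega
        have n2 : r ≠ 3 * d + 7 := by omega
        simp [reg_setReg, n1, n2, h4 r hr]
      · simp only [reg_setReg, mem_setReg, h3, h2, hb, Exp.vol]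
        simp [h.inp _ hc]
        omega
    · refine ⟨_, _, .seq h1 (.seq (.sub _ _ _ _) (.condFalse ?_ (.const _ _ _))), ?_, ?_, ?_, ?_⟩
      · simp only [reg_setReg, hb, h3]
        simp
        omega
      · simp only [mem_setReg, h2]
      · simp only [reg_setReg, Exp.eval]
        simp [hI _ (not_lt.1 hc)]
      · intro r hr
        have n1 : r ≠ 3 * d + 4 := by omega
        have n2 : r ≠ 3 * d + 7 := by omega
        simp [reg_setReg, n1, n2, h4 r hr]
      · simp only [reg_setReg, h3, hb, Exp.vol]
        simp
        omega
  | get k e he =>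
    intro d ρ h
    obtain ⟨t, ρ', h1, h2, h3, h4, h5⟩ := he d ρ h
    obtain ⟨t', ρ'', k1, k2, k3, k4, k5⟩ := exec_address d (y k) (hy k) ρ'
    have hb : ρ'.reg 1 = base := by rw [h4 1 (by omega), h.reg_one]
    rw [hb, h3] at k3
    refine ⟨_, _, .seq h1 (.seq k1 (.load _ _ _)), ?_, ?_, ?_, ?_⟩
    · rw [mem_setReg, k2, h2]
    · simp [reg_setReg, k3, k2, h2, h.arr, Exp.eval]
    · intro r hr
      have : r ≠ 3 * d + 4 := by omega
      simp [reg_setReg, this, k4 r hr, h4 r hr]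
    · simp only [k3, k2, h2, h.arr, Exp.vol]
      rw [hb, h3] at k5
      have s1 := size_add_le (base + 8 * e.eval I σ) (y k)
      have s2 := size_add_le base (8 * e.eval I σ)
      have s3 : Nat.size (8 * e.eval I σ) ≤ Nat.size (e.eval I σ) + 3 := by
        rw [Nat.size_le, pow_add]
        have := Nat.lt_size_self (e.eval I σ)
        omega
      have s4 : Nat.size (y k) ≤ 3 := Nat.size_le.2 (hy k)
      have hv := factor_le (Nat.size base)
        (1 + Nat.size (e.eval I σ) + Nat.size (σ.arr k (e.eval I σ))) (by omega)
      rw [show (Nat.size base + 1) * (e.vol I σ + 1 + Nat.size (e.eval I σ) +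
        Nat.size (σ.arr k (e.eval I σ))) = (Nat.size base + 1) * e.vol I σ + (Nat.size base + 1) *
          (1 + Nat.size (e.eval I σ) + Nat.size (σ.arr k (e.eval I σ))) by ring]
      omega

/-- The counter of a repetition is a copy of the variable, so the body may overwrite the variable.
The clause on `d' < d` says that a body leaves the counters of the surrounding loops alone; the
induction needs it. -/
theorem exec_cmd (hx : Function.Injective x) (hy : ∀ k, y k < 8) (hy' : Function.Injective y)
    {I : ℕ → ℕ} {base : ℕ} (hI : ∀ i, base ≤ i → I i = 0) (c : Cmd V A) :
    ∀ (d : ℕ) (σ : St V A) (ρ : RAM.State), Sim x y I base σ ρ →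
    ∃ t ρ', Exec (c.compile x y d) ρ t ρ' ∧ Sim x y I base (c.den I σ) ρ' ∧
      (∀ d' < d, ρ'.reg (3 * d' + 5) = ρ.reg (3 * d' + 5)) ∧
      t ≤ 64 * ((Nat.size base + 1) * c.vol I σ) := by
  induction c with
  | skip =>
    intro d σ ρ h
    refine ⟨_, _, .skip _, h, fun _ _ => rfl, ?_⟩
    simp only [Cmd.vol]
    omega
  | set r e =>
    intro d σ ρ h
    obtain ⟨t, ρ', h1, h2, h3, h4, h5⟩ := exec_exp hy hI e 0 ρ h
    have h' := h.congr h2 h4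
    refine ⟨_, _, .seq h1 (.add _ _ _ _), ⟨?_, ?_, ?_, ?_, ?_⟩, ?_, ?_⟩
    · simp only [reg_setReg]
      rw [if_neg (by omega), h'.reg_one]
    · simp only [reg_setReg]
      rw [if_neg (by omega), h'.zero]
    · intro s
      simp only [reg_setReg, Cmd.den, Function.update_apply]
      by_cases hs : s = r
      · subst hs
        simpa [h'.zero] using h3
      · have : ¬ (3 * x s + 3 = 3 * x r + 3) := fun e => hs (hx (by omega))
        rw [if_neg this, if_neg hs, h'.reg]
    · exact h'.arr
    · exact h'.inp
    · intro d' _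
      simp only [reg_setReg]
      rw [if_neg (by omega), h4 _ (by omega)]
    · have h3' : ρ'.reg 4 = e.eval I σ := h3
      simp only [h3', h'.zero, Cmd.vol, Nat.size_zero]
      have := factor_le (Nat.size base) (1 + Nat.size (e.eval I σ)) (by omega)
      rw [show (Nat.size base + 1) * (e.vol I σ + 1 + Nat.size (e.eval I σ)) =
        (Nat.size base + 1) * e.vol I σ + (Nat.size base + 1) * (1 + Nat.size (e.eval I σ)) by ring]
      omega
  | put k e f =>
    intro d σ ρ h
    obtain ⟨t, ρ', h1, h2, h3, h4, h5⟩ := exec_exp hy hI e 0 ρ h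
    obtain ⟨t', ρ'', k1, k2, k3, k4, k5⟩ := exec_address 0 (y k) (hy k) ρ'
    have hb : ρ'.reg 1 = base := by rw [h4 1 (by omega), h.reg_one]
    rw [hb, h3] at k3 k5
    have h' := (h.congr h2 h4).congr k2 k4
    -- The address waits in register 4, so the stored value is computed at depth 1.
    obtain ⟨t'', ρ''', l1, l2, l3, l4, l5⟩ := exec_exp hy hI f 1 ρ'' h'
    have h'' := h'.congr l2 fun r hr => l4 r (by omega)
    have r4 : ρ'''.reg 4 = base + 8 * e.eval I σ + y k := by rw [l4 4 (by omega)]; exact k3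
    have r7 : ρ'''.reg 7 = f.eval I σ := l3
    refine ⟨_, _, .seq (.seq h1 k1) (.seq l1 (.store _ _ _)), ⟨?_, ?_, ?_, ?_, ?_⟩, ?_, ?_⟩
    · exact h''.reg_one
    · exact h''.zero
    · exact h''.reg
    · intro k' i
      have hk := hy k
      have hk' := hy k'
      simp only [mem_setMem, r4, r7, Cmd.den, Function.update_apply]
      by_cases hkk : k' = k
      · subst hkk
        rw [if_pos rfl]
        by_cases hi : i = e.eval I σ
        · rw [if_pos (by rw [hi]), Function.update_apply, if_pos hi]
        · rw [if_neg (by omega), Function.update_apply, if_neg hi, h''.arr]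
      · have : y k' ≠ y k := fun e => hkk (hy' e)
        rw [if_neg (by omega), if_neg hkk, h''.arr]
    · intro i hi
      simp only [mem_setMem, r4]
      rw [if_neg (by omega), h''.inp i hi]
    · intro d' _
      rw [reg_setMem, l4 _ (by omega), k4 _ (by omega), h4 _ (by omega)]
    · simp only [r4, r7, Cmd.vol]
      have s1 := size_add_le (base + 8 * e.eval I σ) (y k)
      have s2 := size_add_le base (8 * e.eval I σ)
      have s3 : Nat.size (8 * e.eval I σ) ≤ Nat.size (e.eval I σ) + 3 := by
        rw [Nat.size_le, pow_add]
        have := Nat.lt_size_self (e.eval I σ)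
        omega
      have s4 : Nat.size (y k) ≤ 3 := Nat.size_le.2 (hy k)
      have hv := factor_le (Nat.size base)
        (1 + Nat.size (e.eval I σ) + Nat.size (f.eval I σ)) (by omega)
      rw [show (Nat.size base + 1) * (e.vol I σ + f.vol I σ + 1 + Nat.size (e.eval I σ) +
        Nat.size (f.eval I σ)) = (Nat.size base + 1) * e.vol I σ +
          (Nat.size base + 1) * f.vol I σ + (Nat.size base + 1) *
          (1 + Nat.size (e.eval I σ) + Nat.size (f.eval I σ)) by ring]
      omega
  | seq c c' hc hc' =>
    intro d σ ρ h
    obtain ⟨t, ρ', h1, h2, h3, h4⟩ := hc d σ ρ h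
    obtain ⟨t', ρ'', k1, k2, k3, k4⟩ := hc' d _ ρ' h2
    refine ⟨_, _, .seq h1 k1, k2, fun d' hd => (k3 d' hd).trans (h3 d' hd), ?_⟩
    simp only [Cmd.vol, mul_add]
    omega
  | ite e c c' hc hc' =>
    intro d σ ρ h
    obtain ⟨t, ρ', h1, h2, h3, h4, h5⟩ := exec_exp hy hI e 0 ρ h
    have h' := h.congr h2 h4
    have r4 : ρ'.reg 4 = e.eval I σ := h3
    have hv := factor_le (Nat.size base) (1 + Nat.size (e.eval I σ)) (by omega)
    by_cases h0 : e.eval I σ = 0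
    · obtain ⟨t', ρ'', k1, k2, k3, k4⟩ := hc' d σ ρ' h'
      refine ⟨_, _, .seq h1 (.condFalse (by rw [r4, h0]) k1), ?_, ?_, ?_⟩
      · simpa [Cmd.den, h0] using k2
      · intro d' hd
        rw [k3 d' hd, h4 _ (by omega)]
      · simp only [Cmd.vol, r4, h0, ne_eq, not_true_eq_false, if_false]
        rw [h0] at hv
        rw [show ∀ a b z : ℕ, (Nat.size base + 1) * (a + 1 + z + b) = (Nat.size base + 1) * a +
          (Nat.size base + 1) * (1 + z) + (Nat.size base + 1) * b by intros; ring]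
        omega
    · obtain ⟨t', ρ'', k1, k2, k3, k4⟩ := hc d σ ρ' h'
      refine ⟨_, _, .seq h1 (.condTrue (by rw [r4]; exact h0) k1), ?_, ?_, ?_⟩
      · simpa [Cmd.den, h0] using k2
      · intro d' hd
        rw [k3 d' hd, h4 _ (by omega)]
      · simp only [Cmd.vol, r4, h0, ne_eq, not_false_eq_true, if_true]
        rw [show ∀ a b z : ℕ, (Nat.size base + 1) * (a + 1 + z + b) = (Nat.size base + 1) * a +
          (Nat.size base + 1) * (1 + z) + (Nat.size base + 1) * b by intros; ring]
        omega
  | rep r c hc =>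
    intro d σ ρ h
    -- The counter `j` runs down, while the volume charges every round with the size of the initial
    -- count; `N` keeps that count fixed during the induction.
    have loop : ∀ (N j : ℕ) (τ : St V A) (ρ : RAM.State), j ≤ N → Sim x y I base τ ρ →
        ρ.reg (3 * d + 5) = j → ∃ t ρ', Exec (.loop (3 * d + 5) (.seq (c.compile x y (d + 1))
          (.seq (.const 4 1) (.sub (3 * d + 5) (3 * d + 5) 4)))) ρ t ρ' ∧
        Sim x y I base ((c.den I)^[j] τ) ρ' ∧
        (∀ d' < d, ρ'.reg (3 * d' + 5) = ρ.reg (3 * d' + 5)) ∧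
        t ≤ 1 + 64 * ((Nat.size base + 1) *
          ∑ i ∈ Finset.range j, (2 + Nat.size N + c.vol I ((c.den I)^[i] τ))) := by
      intro N j
      induction j with
      | zero =>
        intro τ ρ _ hs hj
        refine ⟨_, _, .loopStop hj, hs, fun _ _ => rfl, ?_⟩
        simp [hj]
      | succ j ih =>
        intro τ ρ hjN hs hj
        obtain ⟨t, ρ', h1, h2, h3, h4⟩ := hc (d + 1) τ ρ hs
        have hl : ρ'.reg (3 * d + 5) = j + 1 := by rw [h3 d (by omega), hj]
        set ρ₂ := (ρ'.setReg 4 1).setReg (3 * d + 5)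
          ((ρ'.setReg 4 1).reg (3 * d + 5) - (ρ'.setReg 4 1).reg 4) with hρ
        have hr : ∀ r, r ≠ 4 → r ≠ 3 * d + 5 → ρ₂.reg r = ρ'.reg r := by
          intro r n1 n2
          simp [hρ, reg_setReg, n1, n2]
        have hs' : Sim x y I base (c.den I τ) ρ₂ := by
          refine ⟨?_, ?_, ?_, h2.arr, h2.inp⟩
          · rw [hr _ (by omega) (by omega), h2.reg_one]
          · rw [hr _ (by omega) (by omega), h2.zero]
          · intro r
            rw [hr _ (by omega) (by omega), h2.reg]
        have hj' : ρ₂.reg (3 * d + 5) = j := by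
          simp [hρ, reg_setReg, hl]
        obtain ⟨t', ρ'', k1, k2, k3, k4⟩ := ih (c.den I τ) ρ₂ (by omega) hs' hj'
        refine ⟨_, _, .loopStep (by omega) (.seq h1 (.seq (.const _ _ _) (.sub _ _ _ _))) k1,
          ?_, ?_, ?_⟩
        · rw [Function.iterate_succ_apply]
          exact k2
        · intro d' hd
          rw [k3 d' hd, hr _ (by omega) (by omega), h3 d' (by omega)]
        · rw [Finset.sum_range_succ']
          simp only [Function.iterate_succ_apply, Function.iterate_zero_apply]
          simp only [reg_setReg, hl, hj]
          simp only [if_true, Nat.size_one]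
          rw [if_neg (by omega)]
          have hsz : Nat.size (j + 1) ≤ Nat.size N := Nat.size_le_size (by omega)
          have hv := factor_le (Nat.size base) (2 + Nat.size N) (by omega)
          rw [mul_add, mul_add (Nat.size base + 1) (2 + Nat.size N)]
          omega
    have hr : ∀ r', r' ≠ 3 * d + 5 → (ρ.setReg (3 * d + 5)
        (ρ.reg (3 * x r + 3) + ρ.reg 2)).reg r' = ρ.reg r' := by
      intro r' n
      simp [reg_setReg, n]
    have hs : Sim x y I base σ (ρ.setReg (3 * d + 5) (ρ.reg (3 * x r + 3) + ρ.reg 2)) := by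
      refine ⟨?_, ?_, ?_, h.arr, h.inp⟩
      · rw [hr _ (by omega), h.reg_one]
      · rw [hr _ (by omega), h.zero]
      · intro s
        rw [hr _ (by omega), h.reg]
    obtain ⟨t, ρ', h1, h2, h3, h4⟩ := loop (σ.reg r) (σ.reg r) σ _ le_rfl hs
      (by simp [reg_setReg, h.reg, h.zero])
    refine ⟨_, _, .seq (.add _ _ _ _) h1, h2, ?_, ?_⟩
    · intro d' hd
      rw [h3 d' hd, hr _ (by omega)]
    · simp only [Cmd.vol, h.reg, h.zero, Nat.size_zero]
      have hv := factor_le (Nat.size base) (1 + Nat.size (σ.reg r)) (by omega)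
      rw [mul_add]
      omega

/-! ### Frame and cost -/

/-- Whether a command may change the variable `r`. -/
def Cmd.sets (r : V) : Cmd V A → Bool
  | .skip => false
  | .set s _ => s = r
  | .put _ _ _ => false
  | .seq c d => c.sets r || d.sets r
  | .ite _ c d => c.sets r || d.sets r
  | .rep _ c => c.sets r

/-- Whether a command may change the array `k`. -/
def Cmd.puts (k : A) : Cmd V A → Bool
  | .skip => false
  | .set _ _ => false
  | .put l _ _ => l = k
  | .seq c d => c.puts k || d.puts k
  | .ite _ c d => c.puts k || d.puts k
  | .rep _ c => c.puts k

/-- Whether all repetitions are over variables in `F`. -/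
def Cmd.loops (F : V → Bool) : Cmd V A → Bool
  | .skip => true
  | .set _ _ => true
  | .put _ _ _ => true
  | .seq c d => c.loops F && d.loops F
  | .ite _ c d => c.loops F && d.loops F
  | .rep r c => F r && c.loops F

theorem reg_den (I : ℕ → ℕ) {c : Cmd V A} {r : V} (h : c.sets r = false) (σ : St V A) :
    (c.den I σ).reg r = σ.reg r := by
  induction c generalizing σ with
  | skip => rfl
  | set s e =>
    simp only [Cmd.sets, decide_eq_false_iff_not] at h
    simp [Cmd.den, Ne.symm h]
  | put => rfl
  | seq c d hc hd =>
    simp only [Cmd.sets, Bool.or_eq_false_iff] at h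
    rw [Cmd.den, hd h.2, hc h.1]
  | ite e c d hc hd =>
    simp only [Cmd.sets, Bool.or_eq_false_iff] at h
    rw [Cmd.den]
    split_ifs
    · exact hc h.1 σ
    · exact hd h.2 σ
  | rep s c hc =>
    rw [Cmd.den]
    generalize σ.reg s = N
    induction N with
    | zero => rfl
    | succ N ih => rw [Function.iterate_succ_apply', hc h, ih]

theorem arr_den (I : ℕ → ℕ) {c : Cmd V A} {k : A} (h : c.puts k = false) (σ : St V A) :
    (c.den I σ).arr k = σ.arr k := by
  induction c generalizing σ with
  | skip => rfl
  | set => rfl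
  | put l e f =>
    simp only [Cmd.puts, decide_eq_false_iff_not] at h
    simp [Cmd.den, Ne.symm h]
  | seq c d hc hd =>
    simp only [Cmd.puts, Bool.or_eq_false_iff] at h
    rw [Cmd.den, hd h.2, hc h.1]
  | ite e c d hc hd =>
    simp only [Cmd.puts, Bool.or_eq_false_iff] at h
    rw [Cmd.den]
    split_ifs
    · exact hc h.1 σ
    · exact hd h.2 σ
  | rep s c hc =>
    rw [Cmd.den]
    generalize σ.reg s = N
    induction N with
    | zero => rfl
    | succ N ih => rw [Function.iterate_succ_apply', hc h, ih]

/-- An invariant of a repetition, with the cost so far. -/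
theorem vol_rep {I : ℕ → ℕ} {r : V} {c : Cmd V A} {σ : St V A} (P : ℕ → ℕ → St V A → Prop)
    (h0 : P 0 0 σ)
    (hs : ∀ i < σ.reg r, ∀ T τ, (∀ r, c.sets r = false → τ.reg r = σ.reg r) →
      (∀ k, c.puts k = false → τ.arr k = σ.arr k) → P i T τ →
      P (i + 1) (T + c.vol I τ) (c.den I τ)) :
    ∃ T, P (σ.reg r) T ((Cmd.rep r c).den I σ) ∧ (Cmd.rep r c).vol I σ =
      1 + Nat.size (σ.reg r) + σ.reg r * (2 + Nat.size (σ.reg r)) + T := by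
  refine ⟨∑ i ∈ Finset.range (σ.reg r), c.vol I ((c.den I)^[i] σ), ?_, ?_⟩
  · rw [Cmd.den]
    have : ∀ j ≤ σ.reg r, (∀ r, c.sets r = false → ((c.den I)^[j] σ).reg r = σ.reg r) ∧
        (∀ k, c.puts k = false → ((c.den I)^[j] σ).arr k = σ.arr k) ∧
        P j (∑ i ∈ Finset.range j, c.vol I ((c.den I)^[i] σ)) ((c.den I)^[j] σ) := by
      intro j hj
      induction j with
      | zero => exact ⟨fun _ _ => rfl, fun _ _ => rfl, by simpa using h0⟩
      | succ j ih =>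
        obtain ⟨h1, h2, h3⟩ := ih (by omega)
        rw [Finset.sum_range_succ, Function.iterate_succ_apply']
        refine ⟨fun r hr => ?_, fun k hk => ?_, hs j (by omega) _ _ h1 h2 h3⟩
        · rw [reg_den I hr, h1 r hr]
        · rw [arr_den I hk, h2 k hk]
    exact (this _ le_rfl).2.2
  · rw [Cmd.vol, Finset.sum_add_distrib]
    simp
    ring

/-- An invariant of a repetition. -/
theorem den_rep {I : ℕ → ℕ} {r : V} {c : Cmd V A} {σ : St V A} (P : ℕ → St V A → Prop)
    (h0 : P 0 σ)
    (hs : ∀ i < σ.reg r, ∀ τ, (∀ r, c.sets r = false → τ.reg r = σ.reg r) →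
      (∀ k, c.puts k = false → τ.arr k = σ.arr k) → P i τ → P (i + 1) (c.den I τ)) :
    P (σ.reg r) ((Cmd.rep r c).den I σ) := by
  obtain ⟨_, h, _⟩ := vol_rep (I := I) (c := c) (fun i _ τ => P i τ) h0
    (fun i hi _ τ h1 h2 h => hs i hi τ h1 h2 h)
  exact h

/-- All numbers have at most `b` bits. -/
structure Bdd (b : ℕ) (σ : St V A) : Prop where
  reg : ∀ r, Nat.size (σ.reg r) ≤ b
  arr : ∀ k i, Nat.size (σ.arr k i) ≤ b

omit [DecidableEq V] [DecidableEq A] in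
theorem Bdd.mono {b b' : ℕ} {σ : St V A} (h : Bdd b σ) (hb : b ≤ b') : Bdd b' σ :=
  ⟨fun r => (h.reg r).trans hb, fun k i => (h.arr k i).trans hb⟩

/-- The size of an expression. -/
def Exp.cost : Exp V A → ℕ
  | .lit c => 1 + Nat.size c
  | .var _ => 1
  | .add e f => e.cost + f.cost + 1
  | .sub e f => e.cost + f.cost + 1
  | .inp e => e.cost + 1
  | .get _ e => e.cost + 1

/-- A bound for the number of steps of a command whose repetitions are over at most `N`. -/
def Cmd.cost (N : ℕ) : Cmd V A → ℕ
  | .skip => 1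
  | .set _ e => e.cost + 1
  | .put _ e f => e.cost + f.cost + 1
  | .seq c d => c.cost N + d.cost N
  | .ite e c d => e.cost + 1 + c.cost N + d.cost N
  | .rep _ c => 1 + N * (c.cost N + 1)

omit [DecidableEq V] [DecidableEq A] in
theorem Cmd.exists_polynomial (c : Cmd V A) :
    ∃ q : Polynomial ℕ, ∀ N, c.cost N = q.eval N := by
  induction c with
  | skip => exact ⟨1, fun N => by simp [Cmd.cost]⟩
  | set r e => exact ⟨Polynomial.C (e.cost + 1), fun N => by simp [Cmd.cost]⟩
  | put k e f => exact ⟨Polynomial.C (e.cost + f.cost + 1), fun N => by simp [Cmd.cost]⟩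
  | seq c d hc hd =>
    obtain ⟨q, hq⟩ := hc
    obtain ⟨q', hq'⟩ := hd
    exact ⟨q + q', fun N => by simp [Cmd.cost, hq, hq']⟩
  | ite e c d hc hd =>
    obtain ⟨q, hq⟩ := hc
    obtain ⟨q', hq'⟩ := hd
    exact ⟨Polynomial.C (e.cost + 1) + q + q', fun N => by simp [Cmd.cost, hq, hq']⟩
  | rep r c hc =>
    obtain ⟨q, hq⟩ := hc
    exact ⟨1 + Polynomial.X * (q + 1), fun N => by simp [Cmd.cost, hq]⟩

omit [DecidableEq V] [DecidableEq A] in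
-- An addition lengthens the longer operand by at most one bit and contributes one to `Exp.cost`;
-- literals contribute their own length.
theorem size_eval_le {I : ℕ → ℕ} {b : ℕ} {σ : St V A} (h : Bdd b σ)
    (hI : ∀ i, Nat.size (I i) ≤ b) (e : Exp V A) : Nat.size (e.eval I σ) ≤ b + e.cost := by
  induction e with
  | lit c => simp only [Exp.eval, Exp.cost]; omega
  | var r => have := h.reg r; simp only [Exp.eval, Exp.cost]; omega
  | add e f he hf =>
    simp only [Exp.eval, Exp.cost]
    have h1 : e.eval I σ < 2 ^ (b + e.cost + f.cost) :=
      Nat.size_le.1 (he.trans (by omega))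
    have h2 : f.eval I σ < 2 ^ (b + e.cost + f.cost) :=
      Nat.size_le.1 (hf.trans (by omega))
    rw [Nat.size_le, show b + (e.cost + f.cost + 1) = (b + e.cost + f.cost) + 1 by ring, pow_succ]
    omega
  | sub e f he hf =>
    simp only [Exp.eval, Exp.cost]
    have : Nat.size (e.eval I σ - f.eval I σ) ≤ Nat.size (e.eval I σ) :=
      Nat.size_le_size (by omega)
    omega
  | inp e he => have := hI (e.eval I σ); simp only [Exp.eval, Exp.cost]; omega
  | get k e he => have := h.arr k (e.eval I σ); simp only [Exp.eval, Exp.cost]; omega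

omit [DecidableEq V] [DecidableEq A] in
theorem Exp.vol_le {I : ℕ → ℕ} {b M : ℕ} {σ : St V A} (h : Bdd b σ)
    (hI : ∀ i, Nat.size (I i) ≤ b) (e : Exp V A) (hM : b + e.cost ≤ M) :
    e.vol I σ ≤ e.cost * (2 + 2 * M) := by
  have bound := fun e => size_eval_le h hI e
  have binary : ∀ (e f : Exp V A), b + (e.cost + f.cost + 1) ≤ M →
      e.vol I σ ≤ e.cost * (2 + 2 * M) → f.vol I σ ≤ f.cost * (2 + 2 * M) →
      e.vol I σ + f.vol I σ + 1 + Nat.size (e.eval I σ) + Nat.size (f.eval I σ) ≤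
        (e.cost + f.cost + 1) * (2 + 2 * M) := by
    intro e f hM he hf
    have h1 := bound e
    have h2 := bound f
    rw [add_mul, add_mul, one_mul]
    omega
  induction e with
  | lit c =>
    simp only [Exp.cost, Exp.vol]
    exact Nat.le_mul_of_pos_right _ (by omega)
  | var r =>
    have := h.reg r
    simp only [Exp.cost, Exp.vol] at *
    omega
  | add e f he hf =>
    simp only [Exp.cost, Exp.vol] at *
    exact binary e f hM (he (by omega)) (hf (by omega))
  | sub e f he hf =>
    simp only [Exp.cost, Exp.vol] at *
    exact binary e f hM (he (by omega)) (hf (by omega))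
  | inp e he =>
    simp only [Exp.cost, Exp.vol] at *
    have h1 := bound e
    have h2 := hI (e.eval I σ)
    have h3 := he (by omega)
    rw [add_mul, one_mul]
    omega
  | get k e he =>
    simp only [Exp.cost, Exp.vol] at *
    have h1 := bound e
    have h2 := h.arr k (e.eval I σ)
    have h3 := he (by omega)
    rw [add_mul, one_mul]
    omega

/-- The numbers grow by at most one bit in each step. -/
theorem bdd_den_and_vol_le {I : ℕ → ℕ} {N M : ℕ} {F : V → Bool} (c : Cmd V A)
    (hF : ∀ r, F r = true → c.sets r = false) (hc : c.loops F = true) :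
    ∀ (b : ℕ) (σ : St V A), Bdd b σ → (∀ i, Nat.size (I i) ≤ b) →
    (∀ r, F r = true → σ.reg r ≤ N) → b + c.cost N ≤ M →
    Bdd (b + c.cost N) (c.den I σ) ∧ c.vol I σ ≤ c.cost N * (5 + 2 * M + N) := by
  have expand : ∀ K, K * (5 + 2 * M + N) = K * (2 + 2 * M) + K * (3 + N) := by
    intro K; ring
  have keep : ∀ {c : Cmd V A}, (∀ r, F r = true → c.sets r = false) → ∀ {σ : St V A},
      (∀ r, F r = true → σ.reg r ≤ N) → ∀ r, F r = true → (c.den I σ).reg r ≤ N := by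
    intro c hF σ hN r hr
    rw [reg_den I (hF r hr)]
    exact hN r hr
  induction c with
  | skip =>
    intro b σ h hI hN hM
    exact ⟨h.mono (by omega), by simp only [Cmd.vol, Cmd.cost]; omega⟩
  | set r e =>
    intro b σ h hI hN hM
    have he := size_eval_le h hI e
    simp only [Cmd.cost] at hM ⊢
    refine ⟨⟨fun s => ?_, fun k i => (h.arr k i).trans (by omega)⟩, ?_⟩
    · simp only [Cmd.den, Function.update_apply]
      split_ifs
      · omega
      · exact (h.reg s).trans (by omega)
    · simp only [Cmd.vol]
      have := e.vol_le (M := M) h hI (by omega)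
      have h2 := expand e.cost
      rw [add_mul, one_mul]
      omega
  | put k e f =>
    intro b σ h hI hN hM
    have he := size_eval_le h hI e
    have hf := size_eval_le h hI f
    simp only [Cmd.cost] at hM ⊢
    refine ⟨⟨fun s => (h.reg s).trans (by omega), fun l i => ?_⟩, ?_⟩
    · simp only [Cmd.den, Function.update_apply]
      split_ifs
      · rw [Function.update_apply]
        split_ifs
        · omega
        · exact (h.arr k i).trans (by omega)
      · exact (h.arr l i).trans (by omega)
    · simp only [Cmd.vol]
      have h1 := e.vol_le (M := M) h hI (by omega)
      have h2 := f.vol_le (M := M) h hI (by omega)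
      have h3 := expand e.cost
      have h4 := expand f.cost
      rw [add_mul, add_mul, one_mul]
      omega
  | seq c d ihc ihd =>
    intro b σ h hI hN hM
    simp only [Cmd.cost, Cmd.sets, Cmd.loops, Bool.and_eq_true, Bool.or_eq_false_iff] at *
    have hFc := fun r hr => (hF r hr).1
    have hFd := fun r hr => (hF r hr).2
    obtain ⟨h1, h2⟩ := ihc hFc hc.1 b σ h hI hN (by omega)
    obtain ⟨k1, k2⟩ := ihd hFd hc.2 (b + c.cost N) _ h1 (fun i => (hI i).trans (by omega))
      (keep hFc hN) (by omega)
    refine ⟨k1.mono (by omega), ?_⟩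
    rw [Cmd.vol, add_mul]
    omega
  | ite e c d ihc ihd =>
    intro b σ h hI hN hM
    simp only [Cmd.cost, Cmd.sets, Cmd.loops, Bool.and_eq_true, Bool.or_eq_false_iff] at *
    have hFc := fun r hr => (hF r hr).1
    have hFd := fun r hr => (hF r hr).2
    obtain ⟨h1, h2⟩ := ihc hFc hc.1 b σ h hI hN (by omega)
    obtain ⟨k1, k2⟩ := ihd hFd hc.2 b σ h hI hN (by omega)
    have he := size_eval_le h hI e
    have h3 := e.vol_le (M := M) h hI (by omega)
    have h4 := expand e.cost
    rw [Cmd.vol, Cmd.den]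
    simp only [add_mul, one_mul]
    split_ifs
    · exact ⟨h1.mono (by omega), by omega⟩
    · exact ⟨k1.mono (by omega), by omega⟩
  | rep r c ih =>
    intro b σ h hI hN hM
    simp only [Cmd.cost, Cmd.sets, Cmd.loops, Bool.and_eq_true] at *
    have hr : σ.reg r ≤ N := hN r hc.1
    have hs : Nat.size (σ.reg r) ≤ N := (size_le_self _).trans hr
    have grow : ∀ i ≤ N, b + i * c.cost N + c.cost N ≤ b + (1 + N * (c.cost N + 1)) + c.cost N := by
      intro i hi
      have := Nat.mul_le_mul_right (c.cost N) hi
      rw [mul_add]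
      omega
    -- Each round may lengthen the numbers by `c.cost N` bits. This remains affordable because the
    -- number of rounds is at most `N`; loops of exponential length need a different argument.
    obtain ⟨T, ⟨h1, h2, h3⟩, h4⟩ := vol_rep (I := I) (r := r) (c := c) (σ := σ)
      (fun i T τ => Bdd (b + i * c.cost N) τ ∧ (∀ r, F r = true → τ.reg r ≤ N) ∧
        T ≤ i * (c.cost N * (5 + 2 * M + N))) ⟨by simpa using h, hN, by simp⟩ (by
        rintro i hi T τ - - ⟨h1, h2, h3⟩
        have hiN : (i + 1) * c.cost N ≤ N * c.cost N := Nat.mul_le_mul_right _ (by omega)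
        rw [mul_add] at hM
        rw [add_mul] at hiN
        obtain ⟨k1, k2⟩ := ih hF hc.2 (b + i * c.cost N) τ h1 (fun i => (hI i).trans (by omega))
          h2 (by omega)
        refine ⟨k1.mono (by rw [add_mul]; omega), keep hF h2, ?_⟩
        rw [add_mul, one_mul]
        omega)
    have hiN : σ.reg r * c.cost N ≤ N * c.cost N := Nat.mul_le_mul_right _ hr
    refine ⟨h1.mono (by rw [mul_add]; omega), ?_⟩
    rw [h4]
    have h5 : σ.reg r * (2 + Nat.size (σ.reg r)) ≤ N * (2 + N) := Nat.mul_le_mul hr (by omega)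
    have h6 : σ.reg r * (c.cost N * (5 + 2 * M + N)) ≤ N * (c.cost N * (5 + 2 * M + N)) :=
      Nat.mul_le_mul_right _ hr
    have h7 : N * (2 + N) ≤ N * (5 + 2 * M + N) := Nat.mul_le_mul_left _ (by omega)
    have h8 : (1 + N * (c.cost N + 1)) * (5 + 2 * M + N) = (5 + 2 * M + N) +
      N * (c.cost N * (5 + 2 * M + N)) + N * (5 + 2 * M + N) := by ring
    omega

end Imp

/-! ### The input -/

namespace ComparatorCircuit

variable {n : ℕ}

/-- The input as a function. -/
def input (C : ComparatorCircuit n) (i : ℕ) : ℕ := C.encode.getD i 0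

theorem length_flatMap_pair {α : Type*} (l : List α) (f g : α → ℕ) :
    (l.flatMap fun a => [f a, g a]).length = 2 * l.length := by
  induction l with
  | nil => rfl
  | cons a l ih => simp [ih]; ring

theorem getD_flatMap_pair {α : Type*} (l : List α) (f g : α → ℕ) (i : ℕ) (hi : i < l.length) :
    (l.flatMap fun a => [f a, g a]).getD (2 * i) 0 = f l[i] ∧
      (l.flatMap fun a => [f a, g a]).getD (2 * i + 1) 0 = g l[i] := by
  induction l generalizing i with
  | nil => simp at hi
  | cons a l ih =>
    cases i with
    | zero => simp
    | succ i =>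
      have := ih i (by simpa using hi)
      simpa [mul_add, List.flatMap_cons] using this

theorem length_encode (C : ComparatorCircuit n) :
    C.encode.length = 4 + 2 * C.wires + 2 * C.gates.length := by
  simp only [encode, List.length_append, length_flatMap_pair, List.length_finRange]
  simp

theorem input_of_le (C : ComparatorCircuit n) {i : ℕ}
    (hi : 4 + 2 * C.wires + 2 * C.gates.length ≤ i) : C.input i = 0 := by
  rw [input, List.getD_eq_default]
  rw [length_encode]
  exact hi

theorem input_vars (C : ComparatorCircuit n) : C.input 0 = n := rfl

theorem input_wires (C : ComparatorCircuit n) : C.input 1 = C.wires := rfl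

theorem input_gates (C : ComparatorCircuit n) : C.input 2 = C.gates.length := rfl

theorem input_out (C : ComparatorCircuit n) : C.input 3 = C.out := rfl

theorem input_label_aux (C : ComparatorCircuit n) (i : ℕ) (hi : i < 2 * C.wires) :
    C.input (4 + i) = ((List.finRange C.wires).flatMap
      (fun w => [((C.label w).1 : ℕ), if (C.label w).2 then 1 else 0])).getD i 0 := by
  rw [input, encode, List.getD_append _ _ _ _ (by
    simp only [List.length_append, length_flatMap_pair, List.length_finRange]
    simp
    omega), List.getD_append_right _ _ _ _ (by simp)]
  simp

theorem input_label (C : ComparatorCircuit n) (w : Fin C.wires) :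
    C.input (4 + 2 * w) = (C.label w).1 ∧ C.input (5 + 2 * w) = (C.label w).2.toNat := by
  have h := getD_flatMap_pair (List.finRange C.wires) (fun w => ((C.label w).1 : ℕ))
    (fun w => if (C.label w).2 then 1 else 0) w (by simp)
  have e : 5 + 2 * (w : ℕ) = 4 + (2 * w + 1) := by ring
  rw [input_label_aux C _ (by omega), e, input_label_aux C _ (by omega), h.1, h.2]
  simp
  cases (C.label w).2 <;> rfl

theorem input_gate (C : ComparatorCircuit n) (i : ℕ) (hi : i < C.gates.length) :
    C.input (4 + 2 * C.wires + 2 * i) = C.gates[i].1 ∧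
      C.input (4 + 2 * C.wires + 2 * i + 1) = C.gates[i].2 := by
  have h := getD_flatMap_pair C.gates (fun g => (g.1 : ℕ)) (fun g => (g.2 : ℕ)) i hi
  have key : ∀ j, C.input (4 + 2 * C.wires + j) =
      (C.gates.flatMap (fun g => [(g.1 : ℕ), (g.2 : ℕ)])).getD j 0 := by
    intro j
    rw [input, encode, List.getD_append_right _ _ _ _ (by
      simp only [List.length_append, length_flatMap_pair, List.length_finRange]
      simp)]
    congr 1
    simp only [List.length_append, length_flatMap_pair, List.length_finRange]
    simp
  rw [key, add_assoc, key, h.1, h.2]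
  exact ⟨rfl, rfl⟩

/-- Used only to bound the bit lengths of the numbers that are read. -/
theorem input_lt (C : ComparatorCircuit n) (i : ℕ) :
    C.input i ≤ n + C.wires + C.gates.length + 1 := by
  rw [input]
  by_cases hi : i < C.encode.length
  · rw [List.getD_eq_getElem _ _ hi]
    have hm := List.getElem_mem hi
    generalize C.encode[i] = v at hm
    simp only [encode, List.mem_append, List.mem_flatMap, List.mem_cons, List.not_mem_nil,
      or_false, List.mem_finRange, true_and] at hm
    rcases hm with (((rfl | rfl | rfl | rfl) | ⟨w, rfl | rfl⟩) | ⟨g, _, rfl | rfl⟩)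
    · omega
    · omega
    · omega
    · have := C.out.2; omega
    · have := (C.label w).1.2; omega
    · split_ifs <;> omega
    · have := g.1.2; omega
    · have := g.2.2; omega
  · rw [List.getD_eq_default _ _ (by omega)]
    omega

end ComparatorCircuit

/-! ### The computation of signatures -/

namespace Imp

/-- The variables of the counting program. -/
inductive Var where
  | vars | wires | gates | out | base | log | shift | best | free | outer | inner | total
  | key | count | live
  | i | j | q | x | w | row | t | u | v | ru | rv | code | cc | res | gp | left | right | carry
  deriving DecidableEq

/-- The arrays of the counting program. -/
inductive Arr where
  | asg | pos | zero | one | rel | table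
  deriving DecidableEq

infixr:60 " ;; " => Cmd.seq
infix:65 " ≔ " => Cmd.set
infixl:70 " ∔ " => Exp.add
infixl:70 " ∸ " => Exp.sub

theorem den_seq (I : ℕ → ℕ) (c d : Cmd Var Arr) (σ : St Var Arr) :
    (c ;; d).den I σ = d.den I (c.den I σ) := rfl

/-- `d := a * b`, for `b` at most the value of `base`. -/
def mul (d a b : Var) : Cmd Var Arr :=
  d ≔ .lit 0 ;; .t ≔ .lit 0 ;; .rep .base
    (.ite (.var b ∸ .var .t) (d ≔ .var d ∔ .var a) .skip ;; .t ≔ .var .t ∔ .lit 1)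

/-- The loop always runs `base` times and the test decides which rounds add, so its length is
controlled by a variable that the program never changes after reading the input. -/
theorem den_mul (I : ℕ → ℕ) {d a b : Var} {σ : St Var Arr} (h1 : d ≠ .t) (h2 : d ≠ .base)
    (h3 : d ≠ a) (h4 : d ≠ b) (h5 : a ≠ .t) (h6 : b ≠ .t) (hb : σ.reg b ≤ σ.reg .base) :
    (mul d a b).den I σ = ⟨Function.update (Function.update σ.reg d (σ.reg a * σ.reg b)) .t
      (σ.reg .base), σ.arr⟩ := by
  unfold mul
  rw [den_seq, den_seq]
  set σ₁ := Cmd.den I (.t ≔ .lit 0) (Cmd.den I (d ≔ .lit 0) σ) with hσ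
  have e : σ₁.reg .base = σ.reg .base := by
    simp [hσ, Cmd.den, h2.symm]
  have := den_rep (I := I) (r := .base) (σ := σ₁)
    (c := .ite (.var b ∸ .var .t) (d ≔ .var d ∔ .var a) .skip ;; .t ≔ .var .t ∔ .lit 1)
    (fun k τ => τ = ⟨Function.update (Function.update σ.reg d (σ.reg a * min k (σ.reg b))) .t k,
      σ.arr⟩) (by
        simp [hσ, Cmd.den, Exp.eval])
    (by
      rintro k hk τ - - rfl
      have n1 := h5
      have n2 := h6
      by_cases hkb : k < σ.reg b
      · have : σ.reg b - k ≠ 0 := by omega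
        have m1 : min k (σ.reg b) = k := by omega
        have m2 : min (k + 1) (σ.reg b) = k + 1 := by omega
        ext r
        · simp only [Cmd.den, Exp.eval, Function.update_apply, n2, h4.symm, h3.symm, n1, h1, this,
            if_false, if_true, ne_eq, not_false_eq_true, m1, m2]
          split_ifs <;> simp_all [mul_add]
        · simp [Cmd.den, Exp.eval, n2, h4.symm, this]
      · have : σ.reg b - k = 0 := by omega
        have m1 : min k (σ.reg b) = σ.reg b := by omega
        have m2 : min (k + 1) (σ.reg b) = σ.reg b := by omega
        ext r
        · simp only [Cmd.den, Exp.eval, Function.update_apply, n2, h4.symm, m1, m2]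
          simp
          split_ifs <;> simp_all
        · simp [Cmd.den, Exp.eval, n2, h4.symm, this])
  rw [this, e, min_eq_right hb]

/-- `q :=` the position, after the cyclic shift, of the variable on the wire `r`. -/
def locate (r : Var) : Cmd Var Arr :=
  .x ≔ .inp (.lit 4 ∔ (.var r ∔ .var r)) ;;
  .ite (.var .shift ∸ .var .x) (.q ≔ .var .x ∔ .var .vars ∸ .var .shift)
    (.q ≔ .var .x ∸ .var .shift)

/-- The position of the variable `x` after a cyclic shift by `s`. -/
def rot (n s x : ℕ) : ℕ := if x < s then x + n - s else x - s

theorem den_locate {n : ℕ} (C : ComparatorCircuit n) {r : Var} {σ : St Var Arr}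
    (hv : σ.reg .vars = n) (i : Fin C.wires) (hi : σ.reg r = i) :
    (locate r).den C.input σ = ⟨Function.update (Function.update σ.reg .x (C.label i).1) .q
      (rot n (σ.reg .shift) (C.label i).1), σ.arr⟩ := by
  have h := (C.input_label i).1
  rw [two_mul] at h
  by_cases hc : ((C.label i).1 : ℕ) < σ.reg .shift
  · have : σ.reg .shift - (C.label i).1 ≠ 0 := by omega
    simp [locate, Cmd.den, Exp.eval, hi, h, this, rot, hc, hv]
  · have : σ.reg .shift - (C.label i).1 = 0 := by omega
    simp [locate, Cmd.den, Exp.eval, hi, h, this, rot, hc]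

/-- One step of `labels`. -/
def labelStep : Cmd Var Arr :=
  locate .i ;;
  .w ≔ (.get .asg (.var .q) ∸ .inp (.lit 5 ∔ (.var .i ∔ .var .i))) ∔
    (.inp (.lit 5 ∔ (.var .i ∔ .var .i)) ∸ .get .asg (.var .q)) ;;
  .ite (.var .live ∸ .var .q)
    (.put .one (.var .i) (.lit 0) ;; .put .zero (.var .i) (.lit 0))
    (.put .one (.var .i) (.var .w) ;; .put .zero (.var .i) (.lit 1 ∸ .var .w)) ;;
  .put .pos (.var .i) (.var .i) ;;
  .i ≔ .var .i ∔ .lit 1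

/-- Marks the constant tokens and places all tokens. -/
def labels : Cmd Var Arr := .i ≔ .lit 0 ;; .rep .wires labelStep

/-- One step of `initRow`. -/
def initCell : Cmd Var Arr :=
  .put .rel (.var .row ∔ .var .j) (.get .zero (.var .i) ∔
    (.get .one (.var .j) ∸ .get .zero (.var .i))) ;;
  .j ≔ .var .j ∔ .lit 1

/-- One step of `initRel`. -/
def initRow : Cmd Var Arr :=
  .j ≔ .lit 0 ;; .rep .wires initCell ;;
  .put .rel (.var .row ∔ .var .i) (.lit 1) ;;
  .row ≔ .var .row ∔ .var .wires ;;
  .i ≔ .var .i ∔ .lit 1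

/-- Computes the order that is known initially. -/
def initRel : Cmd Var Arr :=
  .i ≔ .lit 0 ;; .row ≔ .lit 0 ;; .rep .wires initRow

/-- One step of `updateCols`. -/
def updateCol : Cmd Var Arr :=
  .x ≔ .get .rel (.var .row ∔ .var .u) ;;
  .w ≔ .get .rel (.var .row ∔ .var .v) ;;
  .put .rel (.var .row ∔ .var .u) (.var .x ∸ (.var .x ∸ .var .w)) ;;
  .put .rel (.var .row ∔ .var .v) (.var .x ∔ (.var .w ∸ .var .x)) ;;
  .row ≔ .var .row ∔ .var .wires

/-- Updates the columns of the known order. -/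
def updateCols : Cmd Var Arr := .row ≔ .lit 0 ;; .rep .wires updateCol

/-- One step of `updateRows`. -/
def updateRow : Cmd Var Arr :=
  .x ≔ .get .rel (.var .ru ∔ .var .j) ;;
  .w ≔ .get .rel (.var .rv ∔ .var .j) ;;
  .put .rel (.var .ru ∔ .var .j) (.var .x ∔ (.var .w ∸ .var .x)) ;;
  .put .rel (.var .rv ∔ .var .j) (.var .x ∸ (.var .x ∸ .var .w)) ;;
  .j ≔ .var .j ∔ .lit 1

/-- Updates the rows of the known order. -/
def updateRows : Cmd Var Arr := .j ≔ .lit 0 ;; .rep .wires updateRow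

/-- Appends a gate to the log. -/
def append : Cmd Var Arr :=
  mul .cc .code .base ;; .code ≔ .var .cc ∔ (.var .u ∔ .lit 1) ;;
  mul .cc .code .base ;; .code ≔ .var .cc ∔ (.var .v ∔ .lit 1)

/-- Exchanges two tokens. -/
def exchange : Cmd Var Arr :=
  .put .pos (.var .left) (.var .v) ;; .put .pos (.var .right) (.var .u)

/-- A gate between incomparable tokens. -/
def properGate : Cmd Var Arr :=
  updateCols ;; updateRows ;; .put .rel (.var .ru ∔ .var .u) (.lit 1) ;; append

/-- Reads the tokens at the next gate. -/
def fetch : Cmd Var Arr :=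
  .left ≔ .inp (.var .gp) ;; .right ≔ .inp (.var .gp ∔ .lit 1) ;;
  .u ≔ .get .pos (.var .left) ;; .v ≔ .get .pos (.var .right) ;;
  mul .ru .u .wires ;; mul .rv .v .wires

/-- One step of `allGates`. -/
def gateStep : Cmd Var Arr :=
  fetch ;;
  .ite (.get .rel (.var .ru ∔ .var .v)) .skip
    (.ite (.get .rel (.var .rv ∔ .var .u)) exchange properGate) ;;
  .gp ≔ .var .gp ∔ .lit 2

/-- Applies all gates. -/
def allGates : Cmd Var Arr :=
  .code ≔ .lit 0 ;; .gp ≔ .lit 4 ∔ (.var .wires ∔ .var .wires) ;; .rep .gates gateStep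

/-- Computes the signature from the log and the token on the output wire. -/
def finish : Cmd Var Arr :=
  .x ≔ .get .pos (.var .out) ;; mul .cc .code .base ;;
  .ite (.get .zero (.var .x) ∔ .get .one (.var .x))
    (.res ≔ .var .cc ∔ .get .one (.var .x)) (.res ≔ .var .cc ∔ (.var .x ∔ .lit 2))

/-- Computes the signature. -/
def sig : Cmd Var Arr := labels ;; initRel ;; allGates ;; finish

/-- The constants among the tokens, for the assignment `A` of the variables at the positions from
`m` on. -/
def status {n : ℕ} (C : ComparatorCircuit n) (s m : ℕ) (A : ℕ → ℕ) (i : Fin C.wires) :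
    Option Bool :=
  if rot n s (C.label i).1 < m then none
  else some (xor (decide (A (rot n s (C.label i).1) = 1)) (C.label i).2)

/-- The auxiliary arrays have small entries. -/
def Small (ℓ : ℕ) (σ : St Var Arr) : Prop :=
  ∀ i, σ.arr .pos i ≤ ℓ ∧ σ.arr .zero i ≤ 1 ∧ σ.arr .one i ≤ 1 ∧ σ.arr .rel i ≤ 1

/-- The arrays describe the initial tokens for the constants `st`. -/
def Marked {ℓ : ℕ} (st : Fin ℓ → Option Bool) (σ : St Var Arr) : Prop :=
  ∀ i : Fin ℓ, σ.arr .zero i = (decide (st i = some false)).toNat ∧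
    σ.arr .one i = (decide (st i = some true)).toNat

theorem ite_le {p : Prop} [Decidable p] {v x b : ℕ} (hv : v ≤ b) (hx : x ≤ b) :
    (if p then v else x) ≤ b := by
  split_ifs <;> assumption

/-- One of the two truncated differences vanishes, so their sum is the distance of two bits, which
is their exclusive or. -/
theorem toNat_xor_sub {x : ℕ} (hx : x ≤ 1) (b : Bool) :
    x - b.toNat + (b.toNat - x) = (xor (decide (x = 1)) b).toNat := by
  interval_cases x <;> cases b <;> rfl

theorem den_labels {n : ℕ} (C : ComparatorCircuit n) {σ : St Var Arr}
    (hv : σ.reg .vars = n) (hw : σ.reg .wires = C.wires) (hA : ∀ i, σ.arr .asg i ≤ 1)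
    (hs : Small C.wires σ) :
    Marked (status C (σ.reg .shift) (σ.reg .live) (σ.arr .asg)) (labels.den C.input σ) ∧
      (∀ i : Fin C.wires, (labels.den C.input σ).arr .pos i = i) ∧
      Small C.wires (labels.den C.input σ) := by
  unfold labels
  rw [den_seq]
  set σ₁ := Cmd.den C.input (.i ≔ .lit 0) σ with hσ
  have w₁ : σ₁.reg .wires = C.wires := by simp [hσ, Cmd.den, hw]
  have v₁ : σ₁.reg .vars = n := by simp [hσ, Cmd.den, hv]
  have a₁ : σ₁.arr = σ.arr := rfl
  have l₁ : σ₁.reg .live = σ.reg .live := by simp [hσ, Cmd.den]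
  have s₁ : σ₁.reg .shift = σ.reg .shift := by simp [hσ, Cmd.den]
  generalize hst : status C (σ.reg .shift) (σ.reg .live) (σ.arr .asg) = st
  have := den_rep (I := C.input) (r := .wires) (σ := σ₁) (c := labelStep)
    (fun k τ => τ.reg .i = k ∧ Small C.wires τ ∧
      ∀ i : Fin C.wires, (i : ℕ) < k → (τ.arr .zero i = (decide (st i = some false)).toNat ∧
        τ.arr .one i = (decide (st i = some true)).toNat) ∧ τ.arr .pos i = i)
    ⟨by simp [hσ, Cmd.den, Exp.eval], fun i => hs i, fun i hi => absurd hi (by omega)⟩ (by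
      rintro k hk τ hr ha ⟨h1, h2, h3⟩
      have hw' : τ.reg .wires = C.wires := by rw [hr _ rfl, w₁]
      have hv' : τ.reg .vars = n := by rw [hr _ rfl, v₁]
      have hl' : τ.reg .live = σ.reg .live := by rw [hr _ rfl, l₁]
      have hs' : τ.reg .shift = σ.reg .shift := by rw [hr _ rfl, s₁]
      have hA' : τ.arr .asg = σ.arr .asg := by rw [ha _ rfl, a₁]
      rw [w₁] at hk
      have hloc := den_locate C hv' ⟨k, hk⟩ h1
      rw [hs'] at hloc
      have hneg := (C.input_label ⟨k, hk⟩).2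
      rw [two_mul] at hneg
      simp only at hneg
      have hsk := congrFun hst.symm ⟨k, hk⟩
      rw [status] at hsk
      have hx := toNat_xor_sub (hA (rot n (σ.reg .shift) (C.label ⟨k, hk⟩).1))
        (C.label ⟨k, hk⟩).2
      have hk1 : k ≤ C.wires := hk.le
      generalize rot n (σ.reg .shift) (C.label ⟨k, hk⟩).1 = q at *
      unfold labelStep
      rw [den_seq, hloc]
      by_cases hq : q < σ.reg .live
      · have hq' : σ.reg .live - q ≠ 0 := by omega
        rw [if_pos hq] at hsk
        simp only [Cmd.den, Exp.eval, Function.update_apply, reduceCtorEq, if_true, if_false, h1,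
          hl', hq', ne_eq, not_false_eq_true, Small]
        refine ⟨trivial, fun i => ⟨?_, ?_, ?_, ?_⟩, fun i hi => ?_⟩
        · exact ite_le hk1 (h2 i).1
        · exact ite_le (by omega) (h2 i).2.1
        · exact ite_le (by omega) (h2 i).2.2.1
        · exact (h2 i).2.2.2
        · by_cases hik : (i : ℕ) = k
          · obtain rfl : i = ⟨k, hk⟩ := Fin.ext hik
            simp [hsk]
          · simpa [Function.update_apply, hik] using h3 i (by omega)
      · have hq' : σ.reg .live - q = 0 := by omega
        rw [if_neg hq] at hsk
        simp only [Cmd.den, Exp.eval, Function.update_apply, reduceCtorEq, if_true, if_false, h1,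
          hl', hq', ne_eq, not_true_eq_false, Small, hA', hneg, hx]
        generalize (decide (σ.arr .asg q = 1) ^^ (C.label ⟨k, hk⟩).2) = bit at *
        have hbit := bit.toNat_le
        refine ⟨trivial, fun i => ⟨?_, ?_, ?_, ?_⟩, fun i hi => ?_⟩
        · exact ite_le hk1 (h2 i).1
        · exact ite_le (by omega) (h2 i).2.1
        · exact ite_le (by omega) (h2 i).2.2.1
        · exact (h2 i).2.2.2
        · by_cases hik : (i : ℕ) = k
          · obtain rfl : i = ⟨k, hk⟩ := Fin.ext hik
            cases bit <;> simp [hsk]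
          · simpa [Function.update_apply, hik] using h3 i (by omega))
  rw [w₁] at this
  exact ⟨fun i => (this.2.2 i i.2).1, fun i => (this.2.2 i i.2).2, this.2.1⟩

/-- The array `f` holds the relation `R`. -/
def Mat {ℓ : ℕ} (f : ℕ → ℕ) (R : Fin ℓ → Fin ℓ → Bool) : Prop :=
  ∀ i j : Fin ℓ, f (i * ℓ + j) = (R i j).toNat

/-- Distinct entries of a matrix stored by rows have distinct addresses, by uniqueness of division
with remainder. -/
theorem Mat.update {ℓ : ℕ} {f : ℕ → ℕ} {R R' : Fin ℓ → Fin ℓ → Bool} (h : Mat f R)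
    (i j : Fin ℓ) (b : Bool) {k v : ℕ} (hk : k = i * ℓ + j) (hv : v = b.toNat)
    (hR : ∀ i' j', R' i' j' = if i' = i ∧ j' = j then b else R i' j') :
    Mat (Function.update f k v) R' := by
  intro i' j'
  rw [Function.update_apply, hk, hv, hR]
  by_cases e : i' = i ∧ j' = j
  · rw [if_pos e, if_pos (by rw [e.1, e.2])]
  · rw [if_neg e, if_neg, h]
    intro e'
    obtain ⟨h1, h2⟩ := Tokens.mul_add_inj j'.2 j.2 e'
    exact e ⟨Fin.ext h1, Fin.ext h2⟩

end Imp

/-! ### Verification of the signature program -/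

namespace Imp

variable {I : ℕ → ℕ} {ℓ : ℕ}

/-- The array still holds the relation of an earlier run. Treating the remains as some unknown
relation lets one invariant describe a matrix that is only partly overwritten. -/
theorem exists_mat {f : ℕ → ℕ} (hf : ∀ i, f i ≤ 1) : ∃ R : Fin ℓ → Fin ℓ → Bool, Mat f R := by
  refine ⟨fun i j => decide (f (i * ℓ + j) = 1), fun i j => ?_⟩
  have := hf (i * ℓ + j)
  rcases Nat.le_one_iff_eq_zero_or_eq_one.1 this with h | h <;> simp [h]

/-- With truncated subtraction `x + (w - x)` is the maximum and, in the next lemma, `x - (x - w)`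
the minimum. -/
theorem toNat_or_eq (a b : Bool) : a.toNat + (b.toNat - a.toNat) = (a || b).toNat := by
  cases a <;> cases b <;> rfl

theorem toNat_and_eq (a b : Bool) : a.toNat - (a.toNat - b.toNat) = (a && b).toNat := by
  cases a <;> cases b <;> rfl

theorem den_initRow_loop {σ : St Var Arr} {st : Fin ℓ → Option Bool} (k : Fin ℓ)
    {R : Fin ℓ → Fin ℓ → Bool}
    (hw : σ.reg .wires = ℓ) (hk : σ.reg .i = k) (hrow : σ.reg .row = k * ℓ) (hj : σ.reg .j = 0)
    (hm : Marked st σ) (hs : Small ℓ σ) (hR : Mat (σ.arr .rel) R) :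
    Mat (((Cmd.rep .wires initCell).den I σ).arr .rel) (fun i j =>
        if i = k then decide (st i = some false) || decide (st j = some true) else R i j) ∧
      Small ℓ ((Cmd.rep .wires initCell).den I σ) := by
  have := den_rep (I := I) (r := .wires) (σ := σ) (c := initCell)
    (fun c τ => τ.reg .j = c ∧ Small ℓ τ ∧ Mat (τ.arr .rel) (fun i j =>
        if i = k ∧ (j : ℕ) < c then decide (st i = some false) || decide (st j = some true)
        else R i j))
    ⟨hj, hs, by simpa using hR⟩ (by
      rintro c hc τ hr ha ⟨h1, h2, h3⟩
      rw [hw] at hc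
      have e1 : τ.reg .row = k * ℓ := by rw [hr _ rfl, hrow]
      have e2 : τ.reg .i = k := by rw [hr _ rfl, hk]
      have e3 := (hm k).1
      have e4 := (hm ⟨c, hc⟩).2
      rw [← ha .zero rfl] at e3
      rw [← ha .one rfl] at e4
      simp only at e4
      simp only [initCell, Cmd.den, Exp.eval, Function.update_apply, reduceCtorEq, if_true,
        if_false, h1, e1, e2, e3, e4, toNat_or_eq, Small]
      refine ⟨trivial, fun i => ⟨(h2 i).1, (h2 i).2.1, (h2 i).2.2.1,
        ite_le (Bool.toNat_le _) (h2 i).2.2.2⟩, ?_⟩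
      refine h3.update k ⟨c, hc⟩ _ rfl rfl fun i' j' => ?_
      by_cases hi : i' = k
      · subst hi
        by_cases hj : j' = ⟨c, hc⟩
        · subst hj
          simp
        · have : (j' : ℕ) ≠ c := fun e => hj (Fin.ext e)
          have e : (j' : ℕ) < c + 1 ↔ (j' : ℕ) < c := by omega
          simp [e, hj]
      · simp [hi])
  rw [hw] at this
  refine ⟨?_, this.2.1⟩
  have h := this.2.2
  simp only [Fin.is_lt, and_true] at h
  exact h

theorem den_initRel {σ : St Var Arr} {st : Fin ℓ → Option Bool}
    (hw : σ.reg .wires = ℓ) (hm : Marked st σ) (hs : Small ℓ σ) :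
    Mat ((initRel.den I σ).arr .rel) (Tokens.init st).le ∧ Small ℓ (initRel.den I σ) := by
  unfold initRel
  rw [den_seq, den_seq]
  set σ₁ := Cmd.den I (.row ≔ .lit 0) (Cmd.den I (.i ≔ .lit 0) σ) with hσ
  have w₁ : σ₁.reg .wires = ℓ := by simp [hσ, Cmd.den, hw]
  obtain ⟨R, hR⟩ : ∃ R : Fin ℓ → Fin ℓ → Bool, Mat (σ₁.arr .rel) R :=
    exists_mat fun i => (hs i).2.2.2
  have := den_rep (I := I) (r := .wires) (σ := σ₁) (c := initRow)
    (fun c τ => τ.reg .i = c ∧ τ.reg .row = c * ℓ ∧ Small ℓ τ ∧ Mat (τ.arr .rel) (fun i j =>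
        if (i : ℕ) < c then (Tokens.init st).le i j else R i j))
    ⟨by simp [hσ, Cmd.den, Exp.eval], by simp [hσ, Cmd.den, Exp.eval], hs, by simpa using hR⟩ (by
      rintro c hc τ hr ha ⟨h1, h2, h3, h4⟩
      rw [w₁] at hc
      have e1 : τ.reg .wires = ℓ := by rw [hr _ rfl, w₁]
      have hm' : Marked st τ := by
        intro i
        rw [ha _ rfl, ha _ rfl]
        exact hm i
      unfold initRow
      rw [den_seq, den_seq]
      set τ₁ := Cmd.den I (.j ≔ .lit 0) τ with hτ
      obtain ⟨k1, k2⟩ := den_initRow_loop (I := I) (σ := τ₁) (st := st) ⟨c, hc⟩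
        (by simp [hτ, Cmd.den, e1]) (by simp [hτ, Cmd.den, h1]) (by simp [hτ, Cmd.den, h2])
        (by simp [hτ, Cmd.den, Exp.eval]) hm' h3 h4
      have r1 : (Cmd.den I (.rep .wires initCell) τ₁).reg .i = c := by
        rw [reg_den I rfl]; simp [hτ, Cmd.den, h1]
      have r2 : (Cmd.den I (.rep .wires initCell) τ₁).reg .row = c * ℓ := by
        rw [reg_den I rfl]; simp [hτ, Cmd.den, h2]
      have r3 : (Cmd.den I (.rep .wires initCell) τ₁).reg .wires = ℓ := by
        rw [reg_den I rfl]; simp [hτ, Cmd.den, e1]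
      generalize Cmd.den I (.rep .wires initCell) τ₁ = τ₂ at *
      simp only [Cmd.den, Exp.eval, Function.update_apply, reduceCtorEq, if_true,
        if_false, r1, r2, r3, Small]
      refine ⟨trivial, by ring, fun i => ⟨(k2 i).1, (k2 i).2.1, (k2 i).2.2.1,
        ite_le le_rfl (k2 i).2.2.2⟩, ?_⟩
      refine k1.update ⟨c, hc⟩ ⟨c, hc⟩ true rfl rfl fun i' j' => ?_
      by_cases hi : i' = ⟨c, hc⟩
      · subst hi
        by_cases hj : j' = ⟨c, hc⟩
        · subst hj
          simp [Tokens.init]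
        · simp [Tokens.init, hj, Ne.symm hj]
      · have : (i' : ℕ) ≠ c := fun e => hi (Fin.ext e)
        have e : (i' : ℕ) < c + 1 ↔ (i' : ℕ) < c := by omega
        simp [e, hi])
  rw [w₁] at this
  refine ⟨?_, this.2.2.1⟩
  have h := this.2.2.2
  simp only [Fin.is_lt, if_true] at h
  exact h

theorem den_updateCols {σ : St Var Arr} {R : Fin ℓ → Fin ℓ → Bool} {u v : Fin ℓ} (huv : u ≠ v)
    (hw : σ.reg .wires = ℓ) (hu : σ.reg .u = u) (hv : σ.reg .v = v) (hs : Small ℓ σ)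
    (hR : Mat (σ.arr .rel) R) :
    Mat ((updateCols.den I σ).arr .rel) (Tokens.leCol R u v) ∧ Small ℓ (updateCols.den I σ) := by
  unfold updateCols
  rw [den_seq]
  set σ₁ := Cmd.den I (.row ≔ .lit 0) σ with hσ
  have w₁ : σ₁.reg .wires = ℓ := by simp [hσ, Cmd.den, hw]
  have u₁ : σ₁.reg .u = u := by simp [hσ, Cmd.den, hu]
  have v₁ : σ₁.reg .v = v := by simp [hσ, Cmd.den, hv]
  have := den_rep (I := I) (r := .wires) (σ := σ₁) (c := updateCol)
    (fun c τ => τ.reg .row = c * ℓ ∧ Small ℓ τ ∧ Mat (τ.arr .rel) (fun i j =>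
        if (i : ℕ) < c then Tokens.leCol R u v i j else R i j))
    ⟨by simp [hσ, Cmd.den, Exp.eval], hs, by simpa [hσ, Cmd.den] using hR⟩ (by
      rintro c hc τ hr ha ⟨h1, h2, h3⟩
      rw [w₁] at hc
      have e1 : τ.reg .wires = ℓ := by rw [hr _ rfl, w₁]
      have e2 : τ.reg .u = u := by rw [hr _ rfl, u₁]
      have e3 : τ.reg .v = v := by rw [hr _ rfl, v₁]
      have m1 := h3 ⟨c, hc⟩ u
      have m2 := h3 ⟨c, hc⟩ v
      simp only [lt_irrefl, if_false] at m1 m2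
      simp only [updateCol, Cmd.den, Exp.eval, Function.update_apply, reduceCtorEq, if_true,
        if_false, h1, e1, e2, e3, m1, m2, toNat_and_eq, toNat_or_eq, Small]
      refine ⟨by ring, fun i => ⟨(h2 i).1, (h2 i).2.1, (h2 i).2.2.1,
        ite_le (Bool.toNat_le _) (ite_le (Bool.toNat_le _) (h2 i).2.2.2)⟩, ?_⟩
      refine (h3.update ⟨c, hc⟩ u _ rfl rfl fun i' j' => rfl).update ⟨c, hc⟩ v _ rfl rfl
        fun i' j' => ?_
      by_cases hi : i' = ⟨c, hc⟩
      · subst hi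
        by_cases hj : j' = u <;> by_cases hj' : j' = v
        · exact absurd (hj.symm.trans hj') huv
        · simp [Tokens.leCol, hj, huv]
        · simp [Tokens.leCol, hj', huv.symm]
        · simp [Tokens.leCol, hj, hj']
      · have : (i' : ℕ) ≠ c := fun e => hi (Fin.ext e)
        have e : (i' : ℕ) < c + 1 ↔ (i' : ℕ) < c := by omega
        simp [e, hi])
  rw [w₁] at this
  refine ⟨?_, this.2.1⟩
  have h := this.2.2
  simp only [Fin.is_lt, if_true] at h
  exact h

theorem den_updateRows {σ : St Var Arr} {R : Fin ℓ → Fin ℓ → Bool} {u v : Fin ℓ} (huv : u ≠ v)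
    (hw : σ.reg .wires = ℓ) (hu : σ.reg .ru = u * ℓ) (hv : σ.reg .rv = v * ℓ) (hs : Small ℓ σ)
    (hR : Mat (σ.arr .rel) R) :
    Mat ((updateRows.den I σ).arr .rel) (Tokens.leRow R u v) ∧ Small ℓ (updateRows.den I σ) := by
  unfold updateRows
  rw [den_seq]
  set σ₁ := Cmd.den I (.j ≔ .lit 0) σ with hσ
  have w₁ : σ₁.reg .wires = ℓ := by simp [hσ, Cmd.den, hw]
  have u₁ : σ₁.reg .ru = u * ℓ := by simp [hσ, Cmd.den, hu]
  have v₁ : σ₁.reg .rv = v * ℓ := by simp [hσ, Cmd.den, hv]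
  have := den_rep (I := I) (r := .wires) (σ := σ₁) (c := updateRow)
    (fun c τ => τ.reg .j = c ∧ Small ℓ τ ∧ Mat (τ.arr .rel) (fun i j =>
        if (j : ℕ) < c then Tokens.leRow R u v i j else R i j))
    ⟨by simp [hσ, Cmd.den, Exp.eval], hs, by simpa [hσ, Cmd.den] using hR⟩ (by
      rintro c hc τ hr ha ⟨h1, h2, h3⟩
      rw [w₁] at hc
      have e2 : τ.reg .ru = u * ℓ := by rw [hr _ rfl, u₁]
      have e3 : τ.reg .rv = v * ℓ := by rw [hr _ rfl, v₁]
      have m1 := h3 u ⟨c, hc⟩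
      have m2 := h3 v ⟨c, hc⟩
      simp only [lt_irrefl, if_false] at m1 m2
      simp only [updateRow, Cmd.den, Exp.eval, Function.update_apply, reduceCtorEq, if_true,
        if_false, h1, e2, e3, m1, m2, toNat_and_eq, toNat_or_eq, Small]
      refine ⟨trivial, fun i => ⟨(h2 i).1, (h2 i).2.1, (h2 i).2.2.1,
        ite_le (Bool.toNat_le _) (ite_le (Bool.toNat_le _) (h2 i).2.2.2)⟩, ?_⟩
      refine (h3.update u ⟨c, hc⟩ _ rfl rfl fun i' j' => rfl).update v ⟨c, hc⟩ _ rfl rfl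
        fun i' j' => ?_
      by_cases hi : j' = ⟨c, hc⟩
      · subst hi
        by_cases hj : i' = u <;> by_cases hj' : i' = v
        · exact absurd (hj.symm.trans hj') huv
        · simp [Tokens.leRow, hj, huv]
        · simp [Tokens.leRow, hj', huv.symm]
        · simp [Tokens.leRow, hj, hj']
      · have : (j' : ℕ) ≠ c := fun e => hi (Fin.ext e)
        have e : (j' : ℕ) < c + 1 ↔ (j' : ℕ) < c := by omega
        simp [e, hi])
  rw [w₁] at this
  refine ⟨?_, this.2.1⟩
  have h := this.2.2
  simp only [Fin.is_lt, if_true] at h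
  exact h

theorem den_append {σ : St Var Arr} {B : ℕ} {L : List (Fin ℓ × Fin ℓ)} {u v : Fin ℓ}
    (hB : σ.reg .base = B) (hu : σ.reg .u = u) (hv : σ.reg .v = v)
    (hL : σ.reg .code = Tokens.enc B L) :
    (append.den I σ).reg .code = Tokens.enc B ((u, v) :: L) := by
  unfold append
  rw [den_seq, den_mul I (by decide) (by decide) (by decide) (by decide) (by decide) (by decide)
    le_rfl, den_seq, den_seq, den_mul I (by decide) (by decide) (by decide) (by decide) (by decide)
    (by decide) (by simp [Cmd.den])]
  simp [Cmd.den, Exp.eval, hB, hu, hv, hL, Tokens.enc]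

/-- The arrays and the code describe the tokens. -/
structure Holds (S : Tokens ℓ) (σ : St Var Arr) : Prop where
  pos : ∀ w : Fin ℓ, σ.arr .pos w = S.pos w
  rel : Mat (σ.arr .rel) S.le
  code : σ.reg .code = Tokens.enc (ℓ + 2) S.log

theorem den_fetch {σ : St Var Arr} {g : Fin ℓ × Fin ℓ} {S : Tokens ℓ}
    (hw : σ.reg .wires = ℓ) (hB : σ.reg .base = ℓ + 2) (h : ∀ w : Fin ℓ, σ.arr .pos w = S.pos w)
    (hg : I (σ.reg .gp) = g.1) (hg' : I (σ.reg .gp + 1) = g.2) :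
    (fetch.den I σ).reg .left = g.1 ∧ (fetch.den I σ).reg .right = g.2 ∧
      (fetch.den I σ).reg .u = S.pos g.1 ∧ (fetch.den I σ).reg .v = S.pos g.2 ∧
      (fetch.den I σ).reg .ru = S.pos g.1 * ℓ ∧ (fetch.den I σ).reg .rv = S.pos g.2 * ℓ := by
  unfold fetch
  simp only [den_seq]
  rw [den_mul I (by decide) (by decide) (by decide) (by decide) (by decide) (by decide)
    (by
      rw [reg_den I (rfl : (mul .ru .u .wires).sets .wires = false),
        reg_den I (rfl : (mul .ru .u .wires).sets .base = false)]
      simp [Cmd.den, hw, hB]), den_mul I (by decide) (by decide) (by decide) (by decide)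
    (by decide) (by decide) (by simp [Cmd.den, hw, hB])]
  simp [Cmd.den, Exp.eval, hg, hg', h, hw]

/-- The columns are updated first and the rows then use the new columns, in the order in which
`leRow` and `leCol` are composed in `leGate`; the last write restores the diagonal entry of the
meet. -/
theorem den_properGate {σ : St Var Arr} {S : Tokens ℓ} {u v : Fin ℓ} (huv : u ≠ v)
    (hw : σ.reg .wires = ℓ) (hB : σ.reg .base = ℓ + 2) (hs : Small ℓ σ) (h : Holds S σ)
    (hu : σ.reg .u = u) (hv : σ.reg .v = v) (hru : σ.reg .ru = u * ℓ)
    (hrv : σ.reg .rv = v * ℓ) :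
    Holds { S with le := Tokens.leGate S.le u v, log := (u, v) :: S.log }
      (properGate.den I σ) ∧ Small ℓ (properGate.den I σ) := by
  unfold properGate
  simp only [den_seq]
  obtain ⟨k1, k2⟩ := den_updateCols (I := I) huv hw hu hv hs h.rel
  have a1 : (updateCols.den I σ).arr .pos = σ.arr .pos := arr_den I rfl σ
  have a2 : (updateCols.den I σ).reg .wires = ℓ := (reg_den I rfl σ).trans hw
  have a3 : (updateCols.den I σ).reg .base = ℓ + 2 := (reg_den I rfl σ).trans hB
  have a4 : (updateCols.den I σ).reg .u = u := (reg_den I rfl σ).trans hu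
  have a5 : (updateCols.den I σ).reg .v = v := (reg_den I rfl σ).trans hv
  have a6 : (updateCols.den I σ).reg .ru = u * ℓ := (reg_den I rfl σ).trans hru
  have a7 : (updateCols.den I σ).reg .rv = v * ℓ := (reg_den I rfl σ).trans hrv
  have a8 : (updateCols.den I σ).reg .code = σ.reg .code := reg_den I rfl σ
  generalize updateCols.den I σ = σ₁ at *
  obtain ⟨l1, l2⟩ := den_updateRows (I := I) huv a2 a6 a7 k2 k1
  have b1 : (updateRows.den I σ₁).arr .pos = σ₁.arr .pos := arr_den I rfl σ₁
  have b3 : (updateRows.den I σ₁).reg .base = ℓ + 2 := (reg_den I rfl σ₁).trans a3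
  have b4 : (updateRows.den I σ₁).reg .u = u := (reg_den I rfl σ₁).trans a4
  have b5 : (updateRows.den I σ₁).reg .v = v := (reg_den I rfl σ₁).trans a5
  have b6 : (updateRows.den I σ₁).reg .ru = u * ℓ := (reg_den I rfl σ₁).trans a6
  have b8 : (updateRows.den I σ₁).reg .code = σ₁.reg .code := reg_den I rfl σ₁
  generalize updateRows.den I σ₁ = σ₂ at *
  have hrel : ∀ k, (append.den I (Cmd.den I (.put .rel (.var .ru ∔ .var .u) (.lit 1)) σ₂)).arr k =
      (Cmd.den I (.put .rel (.var .ru ∔ .var .u) (.lit 1)) σ₂).arr k := by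
    intro k
    exact arr_den I (by cases k <;> rfl) _
  refine ⟨⟨?_, ?_, ?_⟩, ?_⟩
  · intro w
    rw [hrel]
    simp [Cmd.den, b1, a1, h.pos]
  · rw [hrel]
    simp only [Cmd.den, Exp.eval, Function.update_self, b6, b4]
    refine l1.update u u true rfl rfl fun i j => ?_
    simp only [Tokens.leGate]
  · refine den_append ?_ ?_ ?_ ?_
    · simpa [Cmd.den] using b3
    · simpa [Cmd.den] using b4
    · simpa [Cmd.den] using b5
    · simp [Cmd.den, b8, a8, h.code]
  · intro i
    simp only [hrel]
    simp only [Cmd.den, Exp.eval, Function.update_apply, reduceCtorEq, if_true, if_false]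
    exact ⟨(l2 i).1, (l2 i).2.1, (l2 i).2.2.1, ite_le le_rfl (l2 i).2.2.2⟩

theorem den_gateStep {σ : St Var Arr} {S : Tokens ℓ} {g : Fin ℓ × Fin ℓ}
    {st : Fin ℓ → Option Bool} (hI : Tokens.Inv st S)
    (hw : σ.reg .wires = ℓ) (hB : σ.reg .base = ℓ + 2) (hs : Small ℓ σ) (h : Holds S σ)
    (hg : I (σ.reg .gp) = g.1) (hg' : I (σ.reg .gp + 1) = g.2) :
    Holds (S.step g) (gateStep.den I σ) ∧ Small ℓ (gateStep.den I σ) ∧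
      (gateStep.den I σ).reg .gp = σ.reg .gp + 2 := by
  obtain ⟨f1, f2, f3, f4, f5, f6⟩ := den_fetch (I := I) hw hB h.pos hg hg'
  unfold gateStep
  rw [den_seq, den_seq]
  have ha : ∀ k, (fetch.den I σ).arr k = σ.arr k := fun k => arr_den I (by cases k <;> rfl) _
  have r1 : (fetch.den I σ).reg .wires = ℓ := (reg_den I rfl σ).trans hw
  have r2 : (fetch.den I σ).reg .base = ℓ + 2 := (reg_den I rfl σ).trans hB
  have r3 : (fetch.den I σ).reg .gp = σ.reg .gp := reg_den I rfl σ
  have r4 : (fetch.den I σ).reg .code = σ.reg .code := reg_den I rfl σ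
  have h' : Holds S (fetch.den I σ) :=
    ⟨fun w => by rw [ha, h.pos], by rw [ha]; exact h.rel, by rw [r4, h.code]⟩
  have hs' : Small ℓ (fetch.den I σ) := fun i => by simp only [ha]; exact hs i
  generalize fetch.den I σ = σ₁ at *
  rw [← r3]
  have e1 := h'.rel (S.pos g.1) (S.pos g.2)
  have e2 := h'.rel (S.pos g.2) (S.pos g.1)
  have last : ∀ {τ : St Var Arr} {S' : Tokens ℓ}, Holds S' τ ∧ Small ℓ τ →
      τ.reg .gp = σ₁.reg .gp → Holds S' (Cmd.den I (.gp ≔ .var .gp ∔ .lit 2) τ) ∧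
      Small ℓ (Cmd.den I (.gp ≔ .var .gp ∔ .lit 2) τ) ∧
      (Cmd.den I (.gp ≔ .var .gp ∔ .lit 2) τ).reg .gp = σ₁.reg .gp + 2 := by
    rintro τ S' ⟨k1, k2⟩ k3
    refine ⟨⟨k1.pos, k1.rel, ?_⟩, k2, ?_⟩
    · simpa [Cmd.den] using k1.code
    · simp [Cmd.den, Exp.eval, k3]
  unfold Tokens.step
  by_cases c1 : S.le (S.pos g.1) (S.pos g.2) = true
  · have : Cmd.den I (.ite (.get .rel (.var .ru ∔ .var .v)) .skip
        (.ite (.get .rel (.var .rv ∔ .var .u)) exchange properGate)) σ₁ = σ₁ := by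
      simp [Cmd.den, Exp.eval, f4, f5, e1, c1]
    rw [this, if_pos c1]
    exact last ⟨h', hs'⟩ rfl
  · by_cases c2 : S.le (S.pos g.2) (S.pos g.1) = true
    · have : Cmd.den I (.ite (.get .rel (.var .ru ∔ .var .v)) .skip
          (.ite (.get .rel (.var .rv ∔ .var .u)) exchange properGate)) σ₁ =
          exchange.den I σ₁ := by
        simp [Cmd.den, Exp.eval, f3, f4, f5, f6, e1, e2, c1, c2]
      rw [this, if_neg c1, if_pos c2]
      refine last ⟨⟨?_, ?_, ?_⟩, ?_⟩ (reg_den I rfl _)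
      · intro w
        simp [exchange, Cmd.den, Exp.eval, f1, f2, f3, f4, Function.update_apply, Fin.ext_iff,
          h'.pos, apply_ite Fin.val]
      · simpa [exchange, Cmd.den] using h'.rel
      · simpa [exchange, Cmd.den] using h'.code
      · intro i
        simp only [exchange, Cmd.den, Exp.eval, Function.update_apply, reduceCtorEq, if_true,
          if_false, f1, f2, f3, f4]
        have b1 := (S.pos g.1).2
        have b2 := (S.pos g.2).2
        exact ⟨ite_le (by omega) (ite_le (by omega) (hs' i).1), (hs' i).2⟩
    · have : Cmd.den I (.ite (.get .rel (.var .ru ∔ .var .v)) .skip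
          (.ite (.get .rel (.var .rv ∔ .var .u)) exchange properGate)) σ₁ =
          properGate.den I σ₁ := by
        simp [Cmd.den, Exp.eval, f3, f4, f5, f6, e1, e2, c1, c2]
      rw [this, if_neg c1, if_neg c2]
      refine last (den_properGate (fun e => ?_) r1 r2 hs' h' f3 f4 f5 f6) (reg_den I rfl _)
      rw [e] at c1
      exact c1 (hI.refl _)

theorem den_allGates {n : ℕ} (C : ComparatorCircuit n) {σ : St Var Arr}
    {st : Fin C.wires → Option Bool}
    (hw : σ.reg .wires = C.wires) (hB : σ.reg .base = C.wires + 2)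
    (hG : σ.reg .gates = C.gates.length) (hs : Small C.wires σ)
    (hpos : ∀ w : Fin C.wires, σ.arr .pos w = w) (hrel : Mat (σ.arr .rel) (Tokens.init st).le) :
    Holds (Tokens.run st C.gates) (allGates.den C.input σ) ∧
      Small C.wires (allGates.den C.input σ) := by
  unfold allGates
  rw [den_seq, den_seq]
  set σ₁ := Cmd.den C.input (.gp ≔ .lit 4 ∔ (.var .wires ∔ .var .wires))
    (Cmd.den C.input (.code ≔ .lit 0) σ) with hσ
  have w₁ : σ₁.reg .wires = C.wires := by simp [hσ, Cmd.den, hw]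
  have b₁ : σ₁.reg .base = C.wires + 2 := by simp [hσ, Cmd.den, hB]
  have g₁ : σ₁.reg .gates = C.gates.length := by simp [hσ, Cmd.den, hG]
  have := den_rep (I := C.input) (r := .gates) (σ := σ₁) (c := gateStep)
    (fun c τ => τ.reg .gp = 4 + 2 * C.wires + 2 * c ∧ Small C.wires τ ∧
      Holds (Tokens.run st (C.gates.take c)) τ)
    ⟨by simp [hσ, Cmd.den, Exp.eval, hw]; ring, hs, hpos, hrel,
      by simp [hσ, Cmd.den, Exp.eval, Tokens.run, Tokens.init, Tokens.enc]⟩ (by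
      rintro c hc τ hr ha ⟨h1, h2, h3⟩
      rw [g₁] at hc
      have e1 : τ.reg .wires = C.wires := by rw [hr _ rfl, w₁]
      have e2 : τ.reg .base = C.wires + 2 := by rw [hr _ rfl, b₁]
      obtain ⟨i1, i2⟩ := C.input_gate c hc
      rw [← h1] at i1 i2
      obtain ⟨k1, k2, k3⟩ := den_gateStep (Tokens.inv_run st _) e1 e2 h2 h3 i1 i2
      refine ⟨by rw [k3, h1]; ring, k2, ?_⟩
      rw [List.take_add_one, List.getElem?_eq_getElem hc, Option.toList_some, Tokens.run,
        List.foldl_append]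
      exact k1)
  rw [g₁, List.take_length] at this
  exact ⟨this.2.2, this.2.1⟩

theorem den_finish {σ : St Var Arr} {st : Fin ℓ → Option Bool} {S : Tokens ℓ} {out : Fin ℓ}
    (hB : σ.reg .base = ℓ + 2) (hout : σ.reg .out = out) (hm : Marked st σ) (h : Holds S σ) :
    (finish.den I σ).reg .res =
      Tokens.enc (ℓ + 2) S.log * (ℓ + 2) + Tokens.digit st (S.pos out) := by
  unfold finish
  rw [den_seq, den_seq, den_mul I (by decide) (by decide) (by decide) (by decide) (by decide)
    (by decide) le_rfl]
  obtain ⟨m1, m2⟩ := hm (S.pos out)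
  rcases e : st (S.pos out) with _ | _ | _ <;> rw [e] at m1 m2 <;>
    simp [Cmd.den, Exp.eval, hout, h.pos, m1, m2, Tokens.digit, e, hB, h.code] at m1 m2 ⊢

/-- `Small` is returned together with the result because the routine runs again and again on its own
remains. -/
theorem den_sig {n : ℕ} (C : ComparatorCircuit n) {σ : St Var Arr}
    (hv : σ.reg .vars = n) (hw : σ.reg .wires = C.wires) (hB : σ.reg .base = C.wires + 2)
    (hG : σ.reg .gates = C.gates.length) (hout : σ.reg .out = C.out)
    (hA : ∀ i, σ.arr .asg i ≤ 1) (hs : Small C.wires σ) :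
    (sig.den C.input σ).reg .res =
      Tokens.signature (status C (σ.reg .shift) (σ.reg .live) (σ.arr .asg)) C.gates C.out ∧
      Small C.wires (sig.den C.input σ) := by
  unfold sig
  rw [den_seq, den_seq, den_seq]
  obtain ⟨h1, h2, h3⟩ := den_labels C hv hw hA hs
  generalize status C (σ.reg .shift) (σ.reg .live) (σ.arr .asg) = st at *
  have w₁ : (labels.den C.input σ).reg .wires = C.wires := (reg_den _ rfl _).trans hw
  have b₁ : (labels.den C.input σ).reg .base = C.wires + 2 := (reg_den _ rfl _).trans hB
  have g₁ : (labels.den C.input σ).reg .gates = C.gates.length := (reg_den _ rfl _).trans hG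
  have o₁ : (labels.den C.input σ).reg .out = C.out := (reg_den _ rfl _).trans hout
  generalize labels.den C.input σ = σ₁ at *
  obtain ⟨k1, k2⟩ := den_initRel (I := C.input) w₁ h1 h3
  have w₂ : (initRel.den C.input σ₁).reg .wires = C.wires := (reg_den _ rfl _).trans w₁
  have b₂ : (initRel.den C.input σ₁).reg .base = C.wires + 2 := (reg_den _ rfl _).trans b₁
  have g₂ : (initRel.den C.input σ₁).reg .gates = C.gates.length := (reg_den _ rfl _).trans g₁
  have o₂ : (initRel.den C.input σ₁).reg .out = C.out := (reg_den _ rfl _).trans o₁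
  have p₂ : (initRel.den C.input σ₁).arr .pos = σ₁.arr .pos := arr_den _ rfl _
  have m₂ : Marked st (initRel.den C.input σ₁) := by
    intro i
    rw [arr_den _ rfl, arr_den _ rfl]
    exact h1 i
  generalize initRel.den C.input σ₁ = σ₂ at *
  obtain ⟨l1, l2⟩ := den_allGates C w₂ b₂ g₂ k2 (by rw [p₂]; exact h2) k1
  have b₃ : (allGates.den C.input σ₂).reg .base = C.wires + 2 := (reg_den _ rfl _).trans b₂
  have o₃ : (allGates.den C.input σ₂).reg .out = C.out := (reg_den _ rfl _).trans o₂
  have m₃ : Marked st (allGates.den C.input σ₂) := by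
    intro i
    rw [arr_den _ rfl, arr_den _ rfl]
    exact m₂ i
  generalize allGates.den C.input σ₂ = σ₃ at *
  refine ⟨den_finish b₃ o₃ m₃ l1, fun i => ?_⟩
  have ha : ∀ k, (finish.den C.input σ₃).arr k = σ₃.arr k :=
    fun k => arr_den _ (by cases k <;> rfl) _
  simp only [ha]
  exact l2 i

end Imp

/-! ### The choice of the live variables -/

namespace Imp

/-- Reads the dimensions. -/
def readInput : Cmd Var Arr :=
  .vars ≔ .inp (.lit 0) ;; .wires ≔ .inp (.lit 1) ;; .gates ≔ .inp (.lit 2) ;;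
  .out ≔ .inp (.lit 3) ;; .base ≔ .var .wires ∔ .lit 2

/-- One step of `logarithm`. -/
def logStep : Cmd Var Arr :=
  .ite (.var .base ∸ .var .w) (.w ≔ .var .w ∔ .var .w ;; .log ≔ .var .log ∔ .lit 1) .skip

/-- `log :=` the logarithm of `base`, rounded up. -/
def logarithm : Cmd Var Arr :=
  .log ≔ .lit 0 ;; .w ≔ .lit 1 ;; .rep .base logStep

/-- One step of `countLive`. -/
def countStep : Cmd Var Arr :=
  locate .i ;;
  .ite (.var .live ∸ .var .q) (.count ≔ .var .count ∔ .lit 1) .skip ;;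
  .i ≔ .var .i ∔ .lit 1

/-- `count :=` the number of wires whose variable is among the first `live` ones. -/
def countLive : Cmd Var Arr :=
  .count ≔ .lit 0 ;; .i ≔ .lit 0 ;; .rep .wires countStep

/-- Records the current shift and number of live variables if they are suitable. -/
def judge : Cmd Var Arr :=
  mul .ru .count .count ;; mul .rv .ru .log ;;
  .rv ≔ .var .rv ∔ .var .rv ;; .rv ≔ .var .rv ∔ .var .rv ;; .rv ≔ .var .rv ∔ .var .rv ;;
  .ite (.var .rv ∸ .var .vars ∔ (.var .live ∔ .var .live ∸ .var .vars)) .skip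
    (.best ≔ .var .live ;; .key ≔ .var .shift)

/-- Tries one shift. -/
def tryShift : Cmd Var Arr := countLive ;; judge ;; .shift ≔ .var .shift ∔ .lit 1

/-- Tries all shifts. -/
def tryLive : Cmd Var Arr := .shift ≔ .lit 0 ;; .rep .vars tryShift ;; .live ≔ .var .live ∔ .lit 1

/-- Finds the largest suitable number of live variables, and a shift for it. -/
def search : Cmd Var Arr :=
  .best ≔ .lit 0 ;; .key ≔ .lit 0 ;; .live ≔ .lit 0 ;; .rep .vars tryLive ;; .shift ≔ .var .key

/-- One step of `powers`. -/
def powerStep : Cmd Var Arr :=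
  .ite (.var .best ∸ .var .i) (.inner ≔ .var .inner ∔ .var .inner)
    (.outer ≔ .var .outer ∔ .var .outer) ;;
  .i ≔ .var .i ∔ .lit 1

/-- Computes the numbers of assignments of the live and of the other variables. -/
def powers : Cmd Var Arr :=
  .free ≔ .var .vars ∸ .var .best ;; .inner ≔ .lit 1 ;; .outer ≔ .lit 1 ;; .i ≔ .lit 0 ;;
  .rep .vars powerStep

/-! ### Correctness of the search -/

variable {n : ℕ} (C : ComparatorCircuit n)

/-- The variables describe the circuit. -/
structure Described (σ : St Var Arr) : Prop where
  vars : σ.reg .vars = n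
  wires : σ.reg .wires = C.wires
  gates : σ.reg .gates = C.gates.length
  out : σ.reg .out = C.out
  base : σ.reg .base = C.wires + 2

variable {C}

theorem Described.congr {σ τ : St Var Arr} (h : Described C σ)
    (hr : ∀ r ∈ [Var.vars, .wires, .gates, .out, .base], τ.reg r = σ.reg r) : Described C τ where
  vars := by rw [hr _ (by simp), h.vars]
  wires := by rw [hr _ (by simp), h.wires]
  gates := by rw [hr _ (by simp), h.gates]
  out := by rw [hr _ (by simp), h.out]
  base := by rw [hr _ (by simp), h.base]

theorem Described.den {σ : St Var Arr} (h : Described C σ) (I : ℕ → ℕ) {c : Cmd Var Arr}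
    (hc : ∀ r ∈ [Var.vars, .wires, .gates, .out, .base], c.sets r = false) :
    Described C (c.den I σ) :=
  h.congr fun r hr => reg_den I (hc r hr) σ

theorem described_readInput (C : ComparatorCircuit n) (σ : St Var Arr) :
    Described C (readInput.den C.input σ) := by
  constructor <;>
    simp [readInput, Cmd.den, Exp.eval, C.input_vars, C.input_wires, C.input_gates, C.input_out]

/-- As `B ≤ 2 ^ B`, doubling `B` times is enough. The bound of the logarithm by `B` makes it an
admissible factor for `mul`. -/
theorem den_logarithm {I : ℕ → ℕ} {σ : St Var Arr} {B : ℕ} (hB : σ.reg .base = B) :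
    B ≤ 2 ^ (logarithm.den I σ).reg .log ∧ (logarithm.den I σ).reg .log ≤ B ∧
      ((logarithm.den I σ).reg .log = 0 ∨ 2 ^ ((logarithm.den I σ).reg .log - 1) < B) := by
  unfold logarithm
  rw [den_seq, den_seq]
  set σ₁ := Cmd.den I (.w ≔ .lit 1) (Cmd.den I (.log ≔ .lit 0) σ) with hσ
  have b₁ : σ₁.reg .base = B := by simp [hσ, Cmd.den, hB]
  have := den_rep (I := I) (r := .base) (σ := σ₁) (c := logStep)
    (fun c τ => τ.reg .w = 2 ^ τ.reg .log ∧ (B ≤ τ.reg .w ∨ τ.reg .log = c) ∧ τ.reg .log ≤ c ∧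
      (τ.reg .log = 0 ∨ 2 ^ (τ.reg .log - 1) < B))
    ⟨by simp [hσ, Cmd.den, Exp.eval], by simp [hσ, Cmd.den, Exp.eval],
      by simp [hσ, Cmd.den, Exp.eval], by simp [hσ, Cmd.den, Exp.eval]⟩ (by
      rintro c hc τ hr ha ⟨h1, h2, h3, h4⟩
      have e : τ.reg .base = B := by rw [hr _ rfl, b₁]
      by_cases hw : B ≤ τ.reg .w
      · have : B - τ.reg .w = 0 := by omega
        simp only [logStep, Cmd.den, Exp.eval, e, this]
        simp
        exact ⟨h1, .inl hw, by omega, h4⟩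
      · have : B - τ.reg .w ≠ 0 := by omega
        simp only [logStep, Cmd.den, Exp.eval, Function.update_apply, reduceCtorEq, if_true,
          if_false, e, this, ne_eq, not_false_eq_true]
        rw [pow_succ, Nat.add_sub_cancel, ← h1]
        omega)
  rw [b₁] at this
  generalize Cmd.den I (.rep .base logStep) σ₁ = τ at *
  obtain ⟨h1, h2, h3, h4⟩ := this
  refine ⟨?_, h3, h4⟩
  rcases h2 with h | h
  · omega
  · rw [h]
    exact Nat.lt_two_pow_self.le

/-- The number of wires whose variable is among the first `m` ones after a shift by `s`. -/
def liveCount (C : ComparatorCircuit n) (s m : ℕ) : ℕ :=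
  (Finset.univ.filter fun i : Fin C.wires => rot n s (C.label i).1 < m).card

theorem liveCount_le (C : ComparatorCircuit n) (s m : ℕ) : liveCount C s m ≤ C.wires := by
  refine (Finset.card_filter_le _ _).trans ?_
  simp

theorem den_countLive {σ : St Var Arr} (h : Described C σ) :
    (countLive.den C.input σ).reg .count = liveCount C (σ.reg .shift) (σ.reg .live) := by
  unfold countLive
  rw [den_seq, den_seq]
  set σ₁ := Cmd.den C.input (.i ≔ .lit 0) (Cmd.den C.input (.count ≔ .lit 0) σ) with hσ
  have w₁ : σ₁.reg .wires = C.wires := by simp [hσ, Cmd.den, h.wires]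
  have v₁ : σ₁.reg .vars = n := by simp [hσ, Cmd.den, h.vars]
  have l₁ : σ₁.reg .live = σ.reg .live := by simp [hσ, Cmd.den]
  have s₁ : σ₁.reg .shift = σ.reg .shift := by simp [hσ, Cmd.den]
  have := den_rep (I := C.input) (r := .wires) (σ := σ₁) (c := countStep)
    (fun c τ => τ.reg .i = c ∧ τ.reg .count = (Finset.univ.filter fun i : Fin C.wires =>
      rot n (σ.reg .shift) (C.label i).1 < σ.reg .live ∧ (i : ℕ) < c).card)
    ⟨by simp [hσ, Cmd.den, Exp.eval], by simp [hσ, Cmd.den, Exp.eval]⟩ (by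
      rintro c hc τ hr ha ⟨h1, h2⟩
      rw [w₁] at hc
      have e1 : τ.reg .vars = n := by rw [hr _ rfl, v₁]
      have e2 : τ.reg .live = σ.reg .live := by rw [hr _ rfl, l₁]
      have e3 : τ.reg .shift = σ.reg .shift := by rw [hr _ rfl, s₁]
      have hloc := den_locate C e1 ⟨c, hc⟩ h1
      rw [e3] at hloc
      unfold countStep
      rw [den_seq, hloc]
      by_cases hq : rot n (σ.reg .shift) (C.label ⟨c, hc⟩).1 < σ.reg .live
      · have : σ.reg .live - rot n (σ.reg .shift) (C.label ⟨c, hc⟩).1 ≠ 0 := by omega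
        have ins : (Finset.univ.filter fun i : Fin C.wires =>
            rot n (σ.reg .shift) (C.label i).1 < σ.reg .live ∧ (i : ℕ) < c + 1) =
            insert ⟨c, hc⟩ (Finset.univ.filter fun i : Fin C.wires =>
              rot n (σ.reg .shift) (C.label i).1 < σ.reg .live ∧ (i : ℕ) < c) := by
          ext i
          simp only [Finset.mem_filter, Finset.mem_univ, true_and, Finset.mem_insert]
          constructor
          · rintro ⟨k1, k2⟩
            rcases Nat.lt_succ_iff_lt_or_eq.1 k2 with k | k
            · exact .inr ⟨k1, k⟩
            · exact .inl (Fin.ext k)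
          · rintro (rfl | ⟨k1, k2⟩)
            · exact ⟨hq, by simp⟩
            · exact ⟨k1, by omega⟩
        rw [ins, Finset.card_insert_of_notMem (by simp)]
        simp only [Cmd.den, Exp.eval, Function.update_apply, reduceCtorEq, if_true, if_false, e2,
          this, h1, h2, ne_eq, not_false_eq_true, and_self]
      · have : σ.reg .live - rot n (σ.reg .shift) (C.label ⟨c, hc⟩).1 = 0 := by omega
        have same : (Finset.univ.filter fun i : Fin C.wires =>
            rot n (σ.reg .shift) (C.label i).1 < σ.reg .live ∧ (i : ℕ) < c + 1) =
            Finset.univ.filter fun i : Fin C.wires =>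
              rot n (σ.reg .shift) (C.label i).1 < σ.reg .live ∧ (i : ℕ) < c := by
          ext i
          simp only [Finset.mem_filter, Finset.mem_univ, true_and]
          constructor
          · rintro ⟨k1, k2⟩
            rcases Nat.lt_succ_iff_lt_or_eq.1 k2 with k | k
            · exact ⟨k1, k⟩
            · obtain rfl : i = ⟨c, hc⟩ := Fin.ext k
              exact absurd k1 hq
          · rintro ⟨k1, k2⟩
            exact ⟨k1, by omega⟩
        rw [same]
        simp only [Cmd.den, Exp.eval, Function.update_apply, reduceCtorEq, if_true, if_false, e2,
          this, h1, h2, ne_eq, not_true_eq_false, and_self])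
  rw [w₁] at this
  rw [this.2, liveCount]
  congr 1
  ext i
  simp

/-- The criterion for the shift `s` and the number `m` of live variables. -/
def Suitable (C : ComparatorCircuit n) (L s m : ℕ) : Prop :=
  8 * (liveCount C s m ^ 2 * L) ≤ n ∧ 2 * m ≤ n

theorem den_judge {I : ℕ → ℕ} {σ : St Var Arr} (h : Described C σ) {L s m : ℕ}
    (hL : σ.reg .log = L) (hLB : L ≤ C.wires + 2) (hs : σ.reg .shift = s) (hm : σ.reg .live = m)
    (hc : σ.reg .count = liveCount C s m) :
    (Suitable C L s m ∧ (judge.den I σ).reg .best = m ∧ (judge.den I σ).reg .key = s) ∨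
      (¬ Suitable C L s m ∧ (judge.den I σ).reg .best = σ.reg .best ∧
        (judge.den I σ).reg .key = σ.reg .key) := by
  have hle := liveCount_le C s m
  unfold judge
  rw [den_seq, den_mul I (by decide) (by decide) (by decide) (by decide) (by decide) (by decide)
    (by rw [hc, h.base]; omega), den_seq, den_mul I (by decide) (by decide) (by decide)
    (by decide) (by decide) (by decide) (by simp [h.base, hL, hLB])]
  have e8 : ∀ a : ℕ, a + a + (a + a) + (a + a + (a + a)) = 8 * a := by intro a; ring
  have e2 : ∀ a : ℕ, a + a = 2 * a := by intro a; ring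
  by_cases hS : Suitable C L s m
  · left
    have hS' := hS
    obtain ⟨h1, h2⟩ := hS'
    rw [sq] at h1
    -- A sum of truncated differences is zero exactly when both inequalities of the criterion hold.
    have : 8 * (liveCount C s m * liveCount C s m * L) - n + (2 * m - n) = 0 := by omega
    refine ⟨hS, ?_, ?_⟩
    · simp only [Cmd.den, Exp.eval, Function.update_apply, reduceCtorEq, if_true, if_false, hc, hL,
        hm, hs, h.vars, e8, this, e2 m, ne_eq, not_true_eq_false]
    · simp only [Cmd.den, Exp.eval, Function.update_apply, reduceCtorEq, if_true, if_false, hc, hL,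
        hm, hs, h.vars, e8, this, e2 m, ne_eq, not_true_eq_false]
  · right
    have : 8 * (liveCount C s m * liveCount C s m * L) - n + (2 * m - n) ≠ 0 := by
      intro e
      apply hS
      rw [Suitable, sq]
      omega
    refine ⟨hS, ?_, ?_⟩
    · simp only [Cmd.den, Exp.eval, Function.update_apply, reduceCtorEq, if_true, if_false, hc, hL,
        hm, h.vars, e8, this, e2 m, ne_eq, not_false_eq_true]
    · simp only [Cmd.den, Exp.eval, Function.update_apply, reduceCtorEq, if_true, if_false, hc, hL,
        hm, h.vars, e8, this, e2 m, ne_eq, not_false_eq_true]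

theorem den_tryShift {σ : St Var Arr} (h : Described C σ) {L s m : ℕ}
    (hL : σ.reg .log = L) (hLB : L ≤ C.wires + 2) (hs : σ.reg .shift = s) (hm : σ.reg .live = m) :
    ((tryShift.den C.input σ).reg .shift = s + 1) ∧
    ((Suitable C L s m ∧ (tryShift.den C.input σ).reg .best = m ∧
        (tryShift.den C.input σ).reg .key = s) ∨
      (¬ Suitable C L s m ∧ (tryShift.den C.input σ).reg .best = σ.reg .best ∧
        (tryShift.den C.input σ).reg .key = σ.reg .key)) := by
  unfold tryShift
  rw [den_seq, den_seq]
  have hd : Described C (countLive.den C.input σ) := h.den _ (by decide)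
  have h1 := den_countLive h
  have k1 : (countLive.den C.input σ).reg .log = L := (reg_den _ rfl _).trans hL
  have k2 : (countLive.den C.input σ).reg .shift = s := (reg_den _ rfl _).trans hs
  have k3 : (countLive.den C.input σ).reg .live = m := (reg_den _ rfl _).trans hm
  have k4 : (countLive.den C.input σ).reg .best = σ.reg .best := reg_den _ rfl _
  have k5 : (countLive.den C.input σ).reg .key = σ.reg .key := reg_den _ rfl _
  rw [hs, hm] at h1
  rw [← k4, ← k5]
  generalize countLive.den C.input σ = τ at *
  have := den_judge (I := C.input) hd k1 hLB k2 k3 h1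
  have k6 : (judge.den C.input τ).reg .shift = s := (reg_den _ rfl _).trans k2
  generalize judge.den C.input τ = τ' at *
  refine ⟨?_, ?_⟩
  · simp [Cmd.den, Exp.eval, k6]
  · simpa [Cmd.den] using this

/-- Every success overwrites the record, and the candidates for `m` are tried in increasing order,
so the record ends with the largest suitable one. -/
theorem den_search {σ : St Var Arr} (h : Described C σ) {L : ℕ} (hn : 0 < n)
    (hL : σ.reg .log = L) (hLB : L ≤ C.wires + 2) :
    Suitable C L ((search.den C.input σ).reg .shift) ((search.den C.input σ).reg .best) ∧
      (search.den C.input σ).reg .shift < n ∧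
      ∀ m < n, ∀ s < n, Suitable C L s m → m ≤ (search.den C.input σ).reg .best := by
  unfold search
  rw [den_seq, den_seq, den_seq, den_seq]
  set σ₁ := Cmd.den C.input (.live ≔ .lit 0) (Cmd.den C.input (.key ≔ .lit 0)
    (Cmd.den C.input (.best ≔ .lit 0) σ)) with hσ
  have d₁ : Described C σ₁ := ((h.den _ (by decide)).den _ (by decide)).den _ (by decide)
  have L₁ : σ₁.reg .log = L := by simp [hσ, Cmd.den, hL]
  -- With no live variable the criterion holds trivially, so the initial record is already valid.
  have s0 : Suitable C L 0 0 := by simp [Suitable, liveCount]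
  have := den_rep (I := C.input) (r := .vars) (σ := σ₁) (c := tryLive)
    (fun m τ => τ.reg .live = m ∧ Suitable C L (τ.reg .key) (τ.reg .best) ∧ τ.reg .key < n ∧
      τ.reg .best ≤ m ∧ ∀ m' < m, ∀ s < n, Suitable C L s m' → m' ≤ τ.reg .best)
    ⟨by simp [hσ, Cmd.den, Exp.eval], by simp [hσ, Cmd.den, Exp.eval, s0],
      by simp [hσ, Cmd.den, Exp.eval, hn], by simp [hσ, Cmd.den, Exp.eval],
      fun m' hm' => absurd hm' (by omega)⟩ (by
      rintro m hm τ hr ha ⟨h1, h2, h3, h4, h5⟩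
      have hd : Described C τ := d₁.congr fun r hr' => by
        revert r
        simp only [List.mem_cons, List.not_mem_nil, or_false]
        rintro r (rfl | rfl | rfl | rfl | rfl) <;> exact hr _ rfl
      have eL : τ.reg .log = L := by rw [hr _ rfl, L₁]
      unfold tryLive
      rw [den_seq, den_seq]
      set τ₁ := Cmd.den C.input (.shift ≔ .lit 0) τ with hτ
      have d₂ : Described C τ₁ := hd.den _ (by decide)
      have L₂ : τ₁.reg .log = L := by simp [hτ, Cmd.den, eL]
      have m₂ : τ₁.reg .live = m := by simp [hτ, Cmd.den, h1]
      have key₂ : τ₁.reg .key = τ.reg .key := by simp [hτ, Cmd.den]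
      have best₂ : τ₁.reg .best = τ.reg .best := by simp [hτ, Cmd.den]
      have in_loop := den_rep (I := C.input) (r := .vars) (σ := τ₁) (c := tryShift)
        (fun s ρ => ρ.reg .shift = s ∧ Suitable C L (ρ.reg .key) (ρ.reg .best) ∧
          ρ.reg .key < n ∧ ρ.reg .best ≤ m ∧
          (∀ m' < m, ∀ s < n, Suitable C L s m' → m' ≤ ρ.reg .best) ∧
          ∀ s' < s, Suitable C L s' m → m ≤ ρ.reg .best)
        ⟨by simp [hτ, Cmd.den, Exp.eval], by rw [key₂, best₂]; exact h2, by rw [key₂]; exact h3,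
          by rw [best₂]; exact h4, by rw [best₂]; exact h5, fun s' hs' => absurd hs' (by omega)⟩
        (by
          rintro s hs ρ hr' ha' ⟨k1, k2, k3, k4, k5, k6⟩
          have hd' : Described C ρ := d₂.congr fun r hr'' => by
            revert r
            simp only [List.mem_cons, List.not_mem_nil, or_false]
            rintro r (rfl | rfl | rfl | rfl | rfl) <;> exact hr' _ rfl
          rw [d₂.vars] at hs
          obtain ⟨l1, l2⟩ := den_tryShift hd' ((hr' _ rfl).trans L₂) hLB k1 ((hr' _ rfl).trans m₂)
          generalize tryShift.den C.input ρ = ρ' at *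
          refine ⟨l1, ?_⟩
          rcases l2 with ⟨j1, j2, j3⟩ | ⟨j1, j2, j3⟩
          · rw [j2, j3]
            exact ⟨j1, hs, le_rfl, fun m' hm' _ _ _ => hm'.le, fun _ _ _ => le_rfl⟩
          · rw [j2, j3]
            refine ⟨k2, k3, k4, k5, fun s' hs' hS => ?_⟩
            rcases Nat.lt_succ_iff_lt_or_eq.1 hs' with e | rfl
            · exact k6 s' e hS
            · exact absurd hS j1)
      rw [d₂.vars] at in_loop
      have m₃ : (Cmd.den C.input (.rep .vars tryShift) τ₁).reg .live = m :=
        (reg_den _ rfl _).trans m₂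
      generalize Cmd.den C.input (.rep .vars tryShift) τ₁ = τ₂ at *
      obtain ⟨-, k2, k3, k4, k5, k6⟩ := in_loop
      simp only [Cmd.den, Exp.eval, Function.update_apply, reduceCtorEq, if_true, if_false, m₃]
      refine ⟨trivial, k2, k3, by omega, fun m' hm' s hs hS => ?_⟩
      rcases Nat.lt_succ_iff_lt_or_eq.1 hm' with e | rfl
      · exact k5 m' e s hs hS
      · exact k6 s hs hS)
  rw [d₁.vars] at this
  generalize Cmd.den C.input (.rep .vars tryLive) σ₁ = τ at *
  obtain ⟨-, h2, h3, -, h5⟩ := this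
  simp only [Cmd.den, Exp.eval, Function.update_apply, reduceCtorEq, if_true, if_false]
  exact ⟨h2, h3, h5⟩

theorem den_powers {I : ℕ → ℕ} {σ : St Var Arr} {m : ℕ} (hv : σ.reg .vars = n)
    (hb : σ.reg .best = m) (hm : m ≤ n) :
    (powers.den I σ).reg .free = n - m ∧ (powers.den I σ).reg .inner = 2 ^ m ∧
      (powers.den I σ).reg .outer = 2 ^ (n - m) := by
  unfold powers
  rw [den_seq, den_seq, den_seq, den_seq]
  set σ₁ := Cmd.den I (.i ≔ .lit 0) (Cmd.den I (.outer ≔ .lit 1) (Cmd.den I (.inner ≔ .lit 1)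
    (Cmd.den I (.free ≔ .var .vars ∸ .var .best) σ))) with hσ
  have v₁ : σ₁.reg .vars = n := by simp [hσ, Cmd.den, hv]
  have b₁ : σ₁.reg .best = m := by simp [hσ, Cmd.den, hb]
  have f₁ : σ₁.reg .free = n - m := by simp [hσ, Cmd.den, Exp.eval, hv, hb]
  have := den_rep (I := I) (r := .vars) (σ := σ₁) (c := powerStep)
    (fun c τ => τ.reg .i = c ∧ τ.reg .inner = 2 ^ min c m ∧ τ.reg .outer = 2 ^ (c - m))
    ⟨by simp [hσ, Cmd.den, Exp.eval], by simp [hσ, Cmd.den, Exp.eval],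
      by simp [hσ, Cmd.den, Exp.eval]⟩ (by
      rintro c hc τ hr ha ⟨h1, h2, h3⟩
      have e1 : τ.reg .best = m := by rw [hr _ rfl, b₁]
      by_cases hcm : c < m
      · have e : m - c ≠ 0 := by omega
        simp only [powerStep, Cmd.den, Exp.eval, Function.update_apply, reduceCtorEq, if_true,
          if_false, h1, h2, h3, e1, e, ne_eq, not_false_eq_true]
        rw [min_eq_left hcm.le, min_eq_left (by omega : c + 1 ≤ m), pow_succ,
          show c + 1 - m = c - m by omega]
        exact ⟨trivial, by ring, rfl⟩
      · have e : m - c = 0 := by omega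
        simp only [powerStep, Cmd.den, Exp.eval, Function.update_apply, reduceCtorEq, if_true,
          if_false, h1, h2, h3, e1, e, ne_eq, not_true_eq_false]
        rw [min_eq_right (by omega : m ≤ c), min_eq_right (by omega : m ≤ c + 1),
          show c + 1 - m = c - m + 1 by omega, pow_succ]
        exact ⟨trivial, rfl, by ring⟩)
  rw [v₁, min_eq_right hm] at this
  exact ⟨(reg_den _ rfl _).trans f₁, this.2.1, this.2.2⟩

end Imp

/-! ### Assignments as pairs of numbers -/

namespace Imp

variable {n : ℕ}

/-- The bits of `b` at the positions below `m`, and those of `a` at the positions from `m` to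
`n - 1`. -/
def bits (n m b a : ℕ) : ℕ → ℕ :=
  fun i => if i < m then b / 2 ^ i % 2 else if i < n then a / 2 ^ (i - m) % 2 else 0

theorem bits_le_one (n m b a i : ℕ) : bits n m b a i ≤ 1 := by
  unfold bits
  split_ifs <;> omega

/-- The assignment that is stored in `A` with the positions shifted by `s`. -/
def assignment (n s : ℕ) (A : ℕ → ℕ) : Fin n → Bool := fun x => decide (A (rot n s x) = 1)

theorem exists_rot_eq {s i : ℕ} (hs : s < n) (hi : i < n) : ∃ x : Fin n, rot n s x = i := by
  by_cases h : i + s < n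
  · refine ⟨⟨i + s, h⟩, ?_⟩
    simp [rot]
  · refine ⟨⟨i + s - n, by omega⟩, ?_⟩
    simp only [rot]
    split_ifs <;> omega

theorem eq_of_bits_eq {k a b : ℕ} (ha : a < 2 ^ k) (hb : b < 2 ^ k)
    (h : ∀ i < k, a / 2 ^ i % 2 = b / 2 ^ i % 2) : a = b := by
  refine Nat.eq_of_testBit_eq fun i => ?_
  by_cases hi : i < k
  · rw [Nat.testBit_eq_decide_div_mod_eq, Nat.testBit_eq_decide_div_mod_eq, h i hi]
  · have : 2 ^ k ≤ 2 ^ i := Nat.pow_le_pow_right (by omega) (by omega)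
    rw [Nat.testBit_lt_two_pow (by omega), Nat.testBit_lt_two_pow (by omega)]

theorem assignment_bits_injOn {s m : ℕ} (hs : s < n) (hm : m ≤ n) {b a b' a' : ℕ}
    (hb : b < 2 ^ m) (ha : a < 2 ^ (n - m)) (hb' : b' < 2 ^ m) (ha' : a' < 2 ^ (n - m))
    (h : assignment n s (bits n m b a) = assignment n s (bits n m b' a')) : b = b' ∧ a = a' := by
  have key : ∀ i < n, bits n m b a i = bits n m b' a' i := by
    intro i hi
    obtain ⟨x, hx⟩ := exists_rot_eq hs hi
    have := congrFun h x
    simp only [assignment, hx, decide_eq_decide] at this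
    have h1 := bits_le_one n m b a i
    have h2 := bits_le_one n m b' a' i
    omega
  constructor
  · refine eq_of_bits_eq hb hb' fun i hi => ?_
    have := key i (by omega)
    simpa [bits, hi] using this
  · refine eq_of_bits_eq ha ha' fun i hi => ?_
    have h1 : ¬ i + m < m := by omega
    have h2 : i + m < n := by omega
    have := key (i + m) h2
    simpa [bits, h1, h2] using this

variable (C : ComparatorCircuit n)

/-- The number of satisfying assignments with the bits `a` at the positions from `m` on. -/
def partialCount (s m a : ℕ) : ℕ :=
  ∑ b ∈ Finset.range (2 ^ m), (C.eval (assignment n s (bits n m b a))).toNat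

/-- The signature of the circuit with the bits `a` at the positions from `m` on. -/
def partialCode (s m a : ℕ) : ℕ :=
  Tokens.signature (status C s m (bits n m 0 a)) C.gates C.out

/-- Pairs of numbers map injectively to assignments, and `2 ^ (n - m) * 2 ^ m = 2 ^ n`, so every
assignment is hit once; no inverse map is needed. -/
theorem sum_partialCount {s m : ℕ} (hs : s < n) (hm : m ≤ n) :
    ∑ a ∈ Finset.range (2 ^ (n - m)), partialCount C s m a = C.numSat := by
  have h1 : C.numSat = ∑ x : Fin n → Bool, (C.eval x).toNat := by
    rw [ComparatorCircuit.numSat, Finset.card_filter]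
    refine Finset.sum_congr rfl fun x _ => ?_
    cases C.eval x <;> rfl
  unfold partialCount
  rw [h1, ← Finset.sum_product']
  have inj : Set.InjOn (fun p : ℕ × ℕ => assignment n s (bits n m p.2 p.1))
      (Finset.range (2 ^ (n - m)) ×ˢ Finset.range (2 ^ m) : Finset (ℕ × ℕ)) := by
    rintro ⟨a, b⟩ hab ⟨a', b'⟩ hab' h
    simp only [Finset.coe_product, Finset.coe_range, Set.mem_prod, Set.mem_Iio] at hab hab'
    obtain ⟨rfl, rfl⟩ := assignment_bits_injOn hs hm hab.2 hab.1 hab'.2 hab'.1 h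
    rfl
  rw [← Finset.sum_image (f := fun x => (C.eval x).toNat) inj]
  congr 1
  refine Finset.eq_univ_of_card _ ?_
  rw [Finset.card_image_of_injOn inj]
  simp [← pow_add, Nat.sub_add_cancel hm]

theorem partialCount_le (s m a : ℕ) : partialCount C s m a ≤ 2 ^ m := by
  unfold partialCount
  refine (Finset.sum_le_card_nsmul _ _ 1 fun b _ => Bool.toNat_le _).trans ?_
  simp

/-- For each fixed `b` both networks have the same live inputs and the same signature, so the two
sums agree term by term. -/
theorem partialCount_eq_of_partialCode_eq {s m a a' : ℕ}
    (h : partialCode C s m a = partialCode C s m a') :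
    partialCount C s m a = partialCount C s m a' := by
  unfold partialCount
  refine Finset.sum_congr rfl fun b _ => ?_
  have consistent : ∀ c, Tokens.Consistent (status C s m (bits n m 0 c))
      (C.initVal (assignment n s (bits n m b c))) := by
    intro c i v hv
    unfold status at hv
    split_ifs at hv with hi
    simp only [Option.some.injEq] at hv
    rw [← hv]
    simp only [ComparatorCircuit.initVal, assignment, bits, hi, if_false]
  have := Tokens.foldl_eq_of_signature_eq (consistent a) (consistent a') (fun i hi => ?_) h
  · unfold ComparatorCircuit.eval
    rw [this]
  · unfold status at hi
    split_ifs at hi with hq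
    simp only [ComparatorCircuit.initVal, assignment, bits, hq, if_true]

/-- The live tokens are the wires counted by `liveCount`, whatever the assignment, so all signatures
share one bound. It limits the number of brute force runs. -/
theorem partialCode_lt {L : ℕ} (hL : C.wires + 2 ≤ 2 ^ L) (s m a : ℕ) :
    partialCode C s m a < 2 ^ (2 * (liveCount C s m ^ 2 * L)) * (C.wires + 2) := by
  have h := Tokens.signature_lt (status C s m (bits n m 0 a)) C.gates C.out
  have e : (Tokens.liveSet (status C s m (bits n m 0 a))).card = liveCount C s m := by
    unfold Tokens.liveSet liveCount
    congr 1
    ext i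
    by_cases hi : rot n s (C.label i).1 < m <;> simp [status, hi]
  rw [e] at h
  refine h.trans_le (Nat.mul_le_mul_right _ ?_)
  refine (Nat.pow_le_pow_left hL _).trans_eq ?_
  rw [← pow_mul]
  congr 1
  ring

/-- With no live position the signature is the output bit. One routine thus serves both for the
table keys and for evaluating the circuit. -/
theorem signature_status_zero (s : ℕ) (A : ℕ → ℕ) :
    Tokens.signature (status C s 0 A) C.gates C.out = (C.eval (assignment n s A)).toNat :=
  Tokens.signature_const (C.initVal (assignment n s A)) C.gates C.out

/-- Each wire is live for at most `m` of the `n` shifts; double counting and averaging give the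
shift. -/
theorem exists_liveCount_le {m : ℕ} (hn : 0 < n) :
    ∃ s < n, n * liveCount C s m ≤ m * C.wires := by
  have column : ∀ x : Fin n, ((Finset.range n).filter fun s => rot n s x < m).card ≤ m := by
    intro x
    refine (Finset.card_le_card_of_injOn (t := Finset.range m) (fun s => rot n s x) ?_ ?_).trans
      (by simp)
    · intro s hs
      simpa using (Finset.mem_filter.1 hs).2
    · intro s hs s' hs' h
      have h1 := Finset.mem_range.1 (Finset.mem_filter.1 hs).1
      have h2 := Finset.mem_range.1 (Finset.mem_filter.1 hs').1
      have := x.2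
      simp only [rot] at h
      split_ifs at h <;> omega
  have total : ∑ s ∈ Finset.range n, liveCount C s m ≤ m * C.wires := by
    simp only [liveCount, Finset.card_filter]
    rw [Finset.sum_comm]
    calc ∑ i : Fin C.wires, ∑ s ∈ Finset.range n, (if rot n s (C.label i).1 < m then 1 else 0)
        ≤ ∑ _i : Fin C.wires, m := by
          refine Finset.sum_le_sum fun i _ => ?_
          rw [← Finset.card_filter]
          exact column _
      _ = m * C.wires := by simp [mul_comm]
  obtain ⟨s, hs, h⟩ := Finset.exists_le_of_sum_le (s := Finset.range n)
    (f := fun s => n * liveCount C s m) (g := fun _ => m * C.wires) (by simpa using hn.ne') (by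
      rw [← Finset.mul_sum, Finset.sum_const, Finset.card_range, smul_eq_mul]
      exact Nat.mul_le_mul_left _ total)
  exact ⟨s, Finset.mem_range.1 hs, h⟩

end Imp

/-! ### The enumeration of the assignments -/

namespace Imp

/-- Sets variables to zero. -/
def clear : List Var → Cmd Var Arr
  | [] => .skip
  | r :: X => r ≔ .lit 0 ;; clear X

/-- The variables that are used for a single assignment. -/
def scratch : List Var :=
  [.live, .i, .j, .q, .x, .w, .row, .t, .u, .v, .ru, .rv, .code, .cc, .res, .gp, .left, .right,
    .carry]

/-- One step of `increment`. -/
def incrementStep : Cmd Var Arr :=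
  .x ≔ .get .asg (.var .j) ;;
  .put .asg (.var .j) (.var .x ∸ .var .carry ∔ (.var .carry ∸ .var .x)) ;;
  .carry ≔ .var .x ∸ (.var .x ∸ .var .carry) ;;
  .j ≔ .var .j ∔ .lit 1

/-- Adds one to the number whose bits are stored in `asg` from position `p` on. -/
def increment (p : Exp Var Arr) (r : Var) : Cmd Var Arr :=
  .j ≔ p ;; .carry ≔ .lit 1 ;; .rep r incrementStep

/-- Evaluates the circuit and passes to the next assignment of the live variables. -/
def evaluate : Cmd Var Arr :=
  .live ≔ .lit 0 ;; sig ;; .count ≔ .var .count ∔ .var .res ;; increment (.lit 0) .best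

/-- One step of `bruteForce`. -/
def innerStep : Cmd Var Arr := clear scratch ;; evaluate

/-- Stores a result in the table. -/
def record : Cmd Var Arr := .put .table (.var .key) (.var .count ∔ .lit 1)

/-- Counts the satisfying assignments of the live variables. -/
def bruteForce : Cmd Var Arr := .count ≔ .lit 0 ;; .rep .inner innerStep ;; record

/-- Computes the address in the table. -/
def lookup : Cmd Var Arr := .live ≔ .var .best ;; sig ;; .key ≔ .var .res

/-- Adds the result from the table and passes to the next assignment. -/
def account : Cmd Var Arr :=
  .total ≔ .var .total ∔ (.get .table (.var .key) ∸ .lit 1) ;; increment (.var .best) .free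

/-- One step of `enumerate`. -/
def outerStep : Cmd Var Arr :=
  clear (.key :: .count :: scratch) ;; lookup ;; .ite (.get .table (.var .key)) .skip bruteForce ;;
  account

/-- Enumerates the assignments of the variables that are not live. -/
def enumerate : Cmd Var Arr := .total ≔ .lit 0 ;; .rep .outer outerStep

/-- The variables that control the repetitions of polynomial length. -/
def bounds (r : Var) : Bool := decide (r ∈ [Var.vars, .wires, .gates, .base, .best, .free])

/-! ### Correctness and cost of the enumeration -/

theorem vol_seq (I : ℕ → ℕ) (c d : Cmd Var Arr) (σ : St Var Arr) :
    (c ;; d).vol I σ = c.vol I σ + d.vol I (c.den I σ) := rfl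

theorem clear_sets {X : List Var} {r : Var} (h : r ∉ X) : (clear X).sets r = false := by
  induction X with
  | nil => rfl
  | cons s X ih =>
    simp only [List.mem_cons, not_or] at h
    simp [clear, Cmd.sets, Ne.symm h.1, ih h.2]

theorem clear_puts (X : List Var) (k : Arr) : (clear X).puts k = false := by
  induction X with
  | nil => rfl
  | cons s X ih => simp [clear, Cmd.puts, ih]

theorem clear_mem {I : ℕ → ℕ} {X : List Var} {r : Var} (h : r ∈ X) (σ : St Var Arr) :
    ((clear X).den I σ).reg r = 0 := by
  induction X generalizing σ with
  | nil => simp at h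
  | cons s X ih =>
    rw [clear, den_seq]
    by_cases hr : r ∈ X
    · exact ih hr _
    · rw [reg_den I (clear_sets hr)]
      obtain rfl : r = s := by simpa [hr] using h
      simp [Cmd.den, Exp.eval]

theorem clear_vol (I : ℕ → ℕ) (X : List Var) (σ : St Var Arr) :
    (clear X).vol I σ = 2 * X.length + 1 := by
  induction X generalizing σ with
  | nil => rfl
  | cons s X ih =>
    rw [clear, Cmd.vol, ih]
    simp [Cmd.vol, Exp.vol, Exp.eval]
    ring

/-- Cleared variables need no bound beforehand. This resets the size bound at the start of each
round of an exponentially long loop. -/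
theorem bdd_clear {I : ℕ → ℕ} {X : List Var} {b : ℕ} {σ : St Var Arr}
    (hr : ∀ r, r ∉ X → Nat.size (σ.reg r) ≤ b) (ha : ∀ k i, Nat.size (σ.arr k i) ≤ b) :
    Bdd b ((clear X).den I σ) where
  reg r := by
    by_cases h : r ∈ X
    · simp [clear_mem h]
    · rw [reg_den I (clear_sets h)]
      exact hr r h
  arr k i := by
    rw [arr_den I (clear_puts X k)]
    exact ha k i

theorem den_increment {I : ℕ → ℕ} {σ : St Var Arr} {e : Exp Var Arr} {r : Var} {p K a : ℕ}
    (he : e.eval I σ = p) (hr : σ.reg r = K) (hrs : r ∉ [Var.j, .carry, .x])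
    (h : ∀ i < K, σ.arr .asg (p + i) = a / 2 ^ i % 2) (i : ℕ) :
    ((increment e r).den I σ).arr .asg i =
      if p ≤ i ∧ i < p + K then (a + 1) / 2 ^ (i - p) % 2 else σ.arr .asg i := by
  simp only [List.mem_cons, List.not_mem_nil, or_false, not_or] at hrs
  unfold increment
  rw [den_seq, den_seq]
  set σ₁ := Cmd.den I (.carry ≔ .lit 1) (Cmd.den I (.j ≔ e) σ) with hσ
  have r₁ : σ₁.reg r = K := by simp [hσ, Cmd.den, hrs, hr]
  -- The carry into place `c` is the difference between the quotients of `a + 1` and `a` by `2 ^ c`.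
  -- A carry out of the last place is dropped.
  have := den_rep (I := I) (r := r) (σ := σ₁) (c := incrementStep)
    (fun c τ => τ.reg .j = p + c ∧ (a + 1) / 2 ^ c = a / 2 ^ c + τ.reg .carry ∧
      τ.reg .carry ≤ 1 ∧ ∀ i, τ.arr .asg i =
        if p ≤ i ∧ i < p + c then (a + 1) / 2 ^ (i - p) % 2 else σ.arr .asg i)
    ⟨by simp [hσ, Cmd.den, he], by simp [hσ, Cmd.den, Exp.eval], by simp [hσ, Cmd.den, Exp.eval],
      fun i => by rw [if_neg (by omega)]; rfl⟩ (by
      rintro c hc τ - - ⟨h1, h2, h3, h4⟩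
      rw [r₁] at hc
      have hx : τ.arr .asg (p + c) = a / 2 ^ c % 2 := by
        rw [h4, if_neg (by omega), h c hc]
      simp only [incrementStep, Cmd.den, Exp.eval, Function.update_apply, reduceCtorEq, if_true,
        if_false, h1, hx]
      have d1 : (a + 1) / 2 ^ (c + 1) = (a + 1) / 2 ^ c / 2 := by
        rw [pow_succ, Nat.div_div_eq_div_mul]
      have d2 : a / 2 ^ (c + 1) = a / 2 ^ c / 2 := by
        rw [pow_succ, Nat.div_div_eq_div_mul]
      refine ⟨by ring, ?_, by omega, fun i => ?_⟩
      · rw [d1, d2, h2]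
        omega
      · by_cases hi : i = p + c
        · rw [if_pos hi, if_pos (by omega), show i - p = c by omega, h2]
          omega
        · rw [if_neg hi, h4]
          have : (p ≤ i ∧ i < p + c) ↔ (p ≤ i ∧ i < p + (c + 1)) := by omega
          simp only [this])
  rw [r₁] at this
  exact this.2.2.2 i

variable {n : ℕ} {C : ComparatorCircuit n}

/-- The state between two assignments, with shift `s` and `m` live variables. -/
structure Ready (C : ComparatorCircuit n) (s m : ℕ) (σ : St Var Arr) : Prop where
  described : Described C σ
  shift : σ.reg .shift = s
  best : σ.reg .best = m
  free : σ.reg .free = n - m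
  inner : σ.reg .inner = 2 ^ m
  outer : σ.reg .outer = 2 ^ (n - m)

theorem Ready.congr {s m : ℕ} {σ τ : St Var Arr} (h : Ready C s m σ)
    (hr : ∀ r ∈ [Var.vars, .wires, .gates, .out, .base, .shift, .best, .free, .inner, .outer],
      τ.reg r = σ.reg r) : Ready C s m τ where
  described := h.described.congr fun r hr' => hr r (by
    revert r
    decide)
  shift := by rw [hr _ (by simp), h.shift]
  best := by rw [hr _ (by simp), h.best]
  free := by rw [hr _ (by simp), h.free]
  inner := by rw [hr _ (by simp), h.inner]
  outer := by rw [hr _ (by simp), h.outer]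

theorem Ready.den {s m : ℕ} {σ : St Var Arr} (h : Ready C s m σ) (I : ℕ → ℕ) {c : Cmd Var Arr}
    (hc : ∀ r ∈ [Var.vars, .wires, .gates, .out, .base, .shift, .best, .free, .inner, .outer],
      c.sets r = false) : Ready C s m (c.den I σ) :=
  h.congr fun r hr => reg_den I (hc r hr) σ

theorem Small.den {ℓ : ℕ} {σ : St Var Arr} (h : Small ℓ σ) (I : ℕ → ℕ) {c : Cmd Var Arr}
    (hc : ∀ k ∈ [Arr.pos, .zero, .one, .rel], c.puts k = false) : Small ℓ (c.den I σ) := by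
  intro i
  rw [arr_den I (hc _ (by simp)), arr_den I (hc _ (by simp)), arr_den I (hc _ (by simp)),
    arr_den I (hc _ (by simp))]
  exact h i

theorem Ready.bounds_le {s m N : ℕ} {σ : St Var Arr} (h : Ready C s m σ) (hm : m ≤ n)
    (hN : n + C.wires + C.gates.length + 2 ≤ N) : ∀ r, bounds r = true → σ.reg r ≤ N := by
  intro r hr
  simp only [bounds, List.mem_cons, List.not_mem_nil, or_false, decide_eq_true_eq] at hr
  rcases hr with rfl | rfl | rfl | rfl | rfl | rfl
  · rw [h.described.vars]; omega
  · rw [h.described.wires]; omega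
  · rw [h.described.gates]; omega
  · rw [h.described.base]; omega
  · rw [h.best]; omega
  · rw [h.free]; omega

/-- All arrays have entries of at most `b` bits if the assignment and the table have. -/
theorem size_arr_le {σ : St Var Arr} {ℓ b : ℕ} (hs : Small ℓ σ) (hℓ : ℓ + 1 ≤ b)
    (hA : ∀ i, σ.arr .asg i ≤ 1) (hT : ∀ i, Nat.size (σ.arr .table i) ≤ b) (k : Arr) (i : ℕ) :
    Nat.size (σ.arr k i) ≤ b := by
  have h := hs i
  cases k with
  | asg => exact (size_le_self _).trans ((hA i).trans (by omega))
  | pos => exact (size_le_self _).trans (h.1.trans (by omega))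
  | zero => exact (size_le_self _).trans (h.2.1.trans (by omega))
  | one => exact (size_le_self _).trans (h.2.2.1.trans (by omega))
  | rel => exact (size_le_self _).trans (h.2.2.2.trans (by omega))
  | table => exact hT i

theorem size_two_pow_le (m : ℕ) : Nat.size (2 ^ m) ≤ m + 1 := by
  rw [Nat.size_le, pow_succ]
  have : 0 < 2 ^ m := by positivity
  omega

theorem bits_succ_inner (n m b a i : ℕ) :
    (if 0 ≤ i ∧ i < 0 + m then (b + 1) / 2 ^ (i - 0) % 2 else bits n m b a i) =
      bits n m (b + 1) a i := by
  unfold bits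
  by_cases h : i < m <;> simp [h]

/-- The counter on the live positions overflows to zero after a full brute force run, so these
positions are ready for the next one without a reset. -/
theorem bits_two_pow (n m a : ℕ) : bits n m (2 ^ m) a = bits n m 0 a := by
  funext i
  unfold bits
  split_ifs with h
  · obtain ⟨k, rfl⟩ : ∃ k, m = i + 1 + k := ⟨m - (i + 1), by omega⟩
    rw [show 2 ^ (i + 1 + k) = 2 ^ i * (2 * 2 ^ k) by ring,
      Nat.mul_div_cancel_left _ (by positivity)]
    simp
  · rfl
  · rfl

theorem bits_succ_outer {m : ℕ} (hm : m ≤ n) (b a i : ℕ) :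
    (if m ≤ i ∧ i < m + (n - m) then (a + 1) / 2 ^ (i - m) % 2 else bits n m b a i) =
      bits n m b (a + 1) i := by
  unfold bits
  by_cases h : i < m
  · rw [if_neg (by omega), if_pos h, if_pos h]
  · by_cases h' : i < n
    · rw [if_pos (by omega), if_neg h, if_pos h']
    · rw [if_neg (by omega), if_neg h, if_neg h', if_neg h, if_neg h']

theorem den_sig_of_ready {s m : ℕ} {σ : St Var Arr} (h : Ready C s m σ)
    (hA : ∀ i, σ.arr .asg i ≤ 1) (hs : Small C.wires σ) :
    (sig.den C.input σ).reg .res =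
      Tokens.signature (status C s (σ.reg .live) (σ.arr .asg)) C.gates C.out ∧
      Small C.wires (sig.den C.input σ) := by
  have := den_sig C h.described.vars h.described.wires h.described.base h.described.gates
    h.described.out hA hs
  rwa [h.shift] at this

theorem den_evaluate {s m b a : ℕ} {σ : St Var Arr} (h : Ready C s m σ)
    (hA : σ.arr .asg = bits n m b a) (hs : Small C.wires σ) :
    (evaluate.den C.input σ).reg .count =
        σ.reg .count + (C.eval (assignment n s (bits n m b a))).toNat ∧
      (evaluate.den C.input σ).arr .asg = bits n m (b + 1) a ∧
      Small C.wires (evaluate.den C.input σ) := by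
  unfold evaluate
  rw [den_seq, den_seq, den_seq]
  set σ₁ := Cmd.den C.input (.live ≔ .lit 0) σ with hσ
  have h₁ : Ready C s m σ₁ := h.den _ (by decide)
  have l₁ : σ₁.reg .live = 0 := by simp [hσ, Cmd.den, Exp.eval]
  have c₁ : σ₁.reg .count = σ.reg .count := by simp [hσ, Cmd.den]
  have a₁ : σ₁.arr .asg = bits n m b a := hA
  obtain ⟨k1, k2⟩ := den_sig_of_ready h₁ (fun i => by rw [a₁]; exact bits_le_one _ _ _ _ _)
    (hs.den _ (by decide))
  rw [l₁, a₁, signature_status_zero] at k1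
  have h₂ : Ready C s m (sig.den C.input σ₁) := h₁.den _ (by decide)
  have c₂ : (sig.den C.input σ₁).reg .count = σ.reg .count := (reg_den _ rfl _).trans c₁
  have a₂ : (sig.den C.input σ₁).arr .asg = bits n m b a := (arr_den _ rfl _).trans a₁
  generalize sig.den C.input σ₁ = σ₂ at *
  have h₃ : Ready C s m (Cmd.den C.input (.count ≔ .var .count ∔ .var .res) σ₂) :=
    h₂.den _ (by decide)
  refine ⟨?_, ?_, ?_⟩
  · rw [reg_den _ rfl]
    simp [Cmd.den, Exp.eval, k1, c₂]
  · funext i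
    rw [den_increment (p := 0) (K := m) (a := b) rfl h₃.best (by decide)]
    · change (if _ then _ else σ₂.arr .asg i) = _
      rw [a₂, bits_succ_inner]
    · intro i hi
      change σ₂.arr .asg (0 + i) = _
      simp [a₂, bits, hi]
  · exact (k2.den _ (by decide)).den _ (by decide)

/-- The generic growth bound is useless over `2 ^ m` rounds. The sizes are instead bounded afresh in
each round, so the exit bound exceeds `b` by the cost of a single evaluation only. -/
theorem den_innerLoop {s m a b N M : ℕ} {σ : St Var Arr} (h : Ready C s m σ) (hm : m ≤ n)
    (hN : n + C.wires + C.gates.length + 2 ≤ N) (hNb : N ≤ b) (hM : b + evaluate.cost N ≤ M)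
    (hA : σ.arr .asg = bits n m 0 a) (hs : Small C.wires σ) (hc : σ.reg .count = 0)
    (hb : Bdd b σ) :
    ((Cmd.rep .inner innerStep).den C.input σ).reg .count = partialCount C s m a ∧
      ((Cmd.rep .inner innerStep).den C.input σ).arr .asg = bits n m 0 a ∧
      Small C.wires ((Cmd.rep .inner innerStep).den C.input σ) ∧
      Bdd (b + evaluate.cost N) ((Cmd.rep .inner innerStep).den C.input σ) ∧
      (Cmd.rep .inner innerStep).vol C.input σ ≤
        2 ^ m * (50 + 2 * n + evaluate.cost N * (5 + 2 * M + N)) := by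
  have hI : ∀ i, Nat.size (C.input i) ≤ b := fun i =>
    (size_le_self _).trans ((C.input_lt i).trans (by omega))
  obtain ⟨T, ⟨h1, h2, h3, h4, h5⟩, h6⟩ := vol_rep (I := C.input) (r := .inner) (σ := σ)
    (c := innerStep) (fun t T τ => τ.reg .count =
        ∑ b ∈ Finset.range t, (C.eval (assignment n s (bits n m b a))).toNat ∧
      τ.arr .asg = bits n m t a ∧ Small C.wires τ ∧ Bdd (b + evaluate.cost N) τ ∧
      T ≤ t * (39 + evaluate.cost N * (5 + 2 * M + N)))
    ⟨by simp [hc], hA, hs, hb.mono (by omega), by simp⟩ (by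
      rintro t ht T τ hr ha ⟨k1, k2, k3, k4, k5⟩
      rw [h.inner] at ht
      have hτ : Ready C s m τ := h.congr fun r hr' => hr r (by
        revert r
        decide)
      have hcount : Nat.size (τ.reg .count) ≤ b := by
        have : τ.reg .count ≤ t := by
          rw [k1]
          refine (Finset.sum_le_card_nsmul _ _ 1 fun b _ => Bool.toNat_le _).trans ?_
          simp
        refine (Nat.size_le_size (this.trans ht.le)).trans ((size_two_pow_le m).trans ?_)
        omega
      -- Every register is cleared, untouched since the loop began, or the count, which is at most
      -- `2 ^ m`; the array entries are bounded by the invariant.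
      have hclear : Bdd b ((clear scratch).den C.input τ) := by
        refine bdd_clear (fun r hr' => ?_) ?_
        · by_cases hrc : r = .count
          · rw [hrc]; exact hcount
          · rw [hr r (by
              revert hr' hrc
              cases r <;> simp [scratch] <;> rfl)]
            exact hb.reg r
        · refine size_arr_le k3 (by omega) (fun i => ?_) fun i => ?_
          · rw [k2]; exact bits_le_one _ _ _ _ _
          · rw [ha _ rfl]; exact hb.arr _ _
      have hτ₁ : Ready C s m ((clear scratch).den C.input τ) := hτ.den _ (by decide)
      have a₁ : ((clear scratch).den C.input τ).arr .asg = bits n m t a :=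
        (arr_den _ (clear_puts _ _) _).trans k2
      have s₁ : Small C.wires ((clear scratch).den C.input τ) :=
        k3.den _ fun k _ => clear_puts _ k
      have c₁ : ((clear scratch).den C.input τ).reg .count = τ.reg .count :=
        reg_den _ (clear_sets (by decide)) _
      have v₁ : (clear scratch).vol C.input τ = 39 := clear_vol _ _ _
      unfold innerStep
      rw [den_seq, Cmd.vol, v₁]
      generalize (clear scratch).den C.input τ = τ₁ at *
      obtain ⟨l1, l2, l3⟩ := den_evaluate hτ₁ a₁ s₁
      obtain ⟨l4, l5⟩ := bdd_den_and_vol_le (N := N) (M := M) (F := bounds) evaluate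
        (by intro r; cases r <;> decide) (by decide) b τ₁ hclear hI (hτ₁.bounds_le hm hN) hM
      refine ⟨?_, l2, l3, l4, ?_⟩
      · rw [l1, c₁, k1, Finset.sum_range_succ]
      · rw [add_mul, one_mul]
        omega)
  rw [h.inner] at h1 h2 h5 h6
  rw [bits_two_pow] at h2
  refine ⟨h1, h2, h3, h4, ?_⟩
  rw [h6]
  have hsz := size_two_pow_le m
  have pos : 1 ≤ 2 ^ m := Nat.one_le_two_pow
  have e1 : 2 ^ m * (2 + Nat.size (2 ^ m)) ≤ 2 ^ m * (n + 3) := Nat.mul_le_mul_left _ (by omega)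
  have e2 : n + 2 ≤ 2 ^ m * (n + 2) := Nat.le_mul_of_pos_left _ (by omega)
  calc 1 + Nat.size (2 ^ m) + 2 ^ m * (2 + Nat.size (2 ^ m)) + T
      ≤ 2 ^ m * (n + 2) + 2 ^ m * (n + 3) +
        2 ^ m * (39 + evaluate.cost N * (5 + 2 * M + N)) := by omega
    _ = 2 ^ m * (44 + 2 * n + evaluate.cost N * (5 + 2 * M + N)) := by ring
    _ ≤ _ := Nat.mul_le_mul_left _ (by omega)

theorem den_lookup {s m a : ℕ} {σ : St Var Arr} (h : Ready C s m σ)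
    (hA : σ.arr .asg = bits n m 0 a) (hs : Small C.wires σ) :
    (lookup.den C.input σ).reg .key = partialCode C s m a ∧
      Small C.wires (lookup.den C.input σ) := by
  unfold lookup
  rw [den_seq, den_seq]
  set σ₁ := Cmd.den C.input (.live ≔ .var .best) σ with hσ
  have h₁ : Ready C s m σ₁ := h.den _ (by decide)
  have l₁ : σ₁.reg .live = m := by simp [hσ, Cmd.den, Exp.eval, h.best]
  have a₁ : σ₁.arr .asg = bits n m 0 a := hA
  obtain ⟨k1, k2⟩ := den_sig_of_ready h₁ (fun i => by rw [a₁]; exact bits_le_one _ _ _ _ _)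
    (hs.den _ (by decide))
  rw [l₁, a₁] at k1
  refine ⟨?_, k2.den _ (by decide)⟩
  simp [Cmd.den, Exp.eval, k1, partialCode]

/-- The cost of the parts of polynomial length of `outerStep`. -/
def stepCost (N : ℕ) : ℕ :=
  lookup.cost N + 2 + evaluate.cost N + record.cost N + account.cost N + 4

theorem den_bruteForce {s m a b N M : ℕ} {σ : St Var Arr} (h : Ready C s m σ) (hm : m ≤ n)
    (hN : n + C.wires + C.gates.length + 2 ≤ N) (hNb : N ≤ b)
    (hM : b + 2 + evaluate.cost N + record.cost N ≤ M)
    (hA : σ.arr .asg = bits n m 0 a) (hs : Small C.wires σ) (hb : Bdd b σ) :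
    (bruteForce.den C.input σ).arr .table =
        Function.update (σ.arr .table) (σ.reg .key) (partialCount C s m a + 1) ∧
      (bruteForce.den C.input σ).arr .asg = bits n m 0 a ∧
      Small C.wires (bruteForce.den C.input σ) ∧
      Bdd (b + 2 + evaluate.cost N + record.cost N) (bruteForce.den C.input σ) ∧
      bruteForce.vol C.input σ ≤ 2 ^ m * (60 + 2 * n +
        (2 + evaluate.cost N + record.cost N) * (5 + 2 * M + N)) := by
  have hI : ∀ i, Nat.size (C.input i) ≤ b := fun i =>
    (size_le_self _).trans ((C.input_lt i).trans (by omega))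
  unfold bruteForce
  rw [den_seq, den_seq, vol_seq, vol_seq]
  have cost_set : (Cmd.set .count (.lit 0) : Cmd Var Arr).cost N = 2 := by
    simp [Cmd.cost, Exp.cost]
  obtain ⟨b₁, v₁⟩ := bdd_den_and_vol_le (N := N) (M := M) (F := bounds)
    (.count ≔ .lit 0 : Cmd Var Arr) (by intro r; cases r <;> decide) (by decide) b σ hb hI
    (h.bounds_le hm hN) (by omega)
  rw [cost_set] at b₁ v₁
  have h₁ : Ready C s m (Cmd.den C.input (.count ≔ .lit 0) σ) := h.den _ (by decide)
  have c₁ : (Cmd.den C.input (.count ≔ .lit 0) σ).reg .count = 0 := by simp [Cmd.den, Exp.eval]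
  have key₁ : (Cmd.den C.input (.count ≔ .lit 0) σ).reg .key = σ.reg .key := reg_den _ rfl _
  have a₁ : (Cmd.den C.input (.count ≔ .lit 0) σ).arr = σ.arr := rfl
  have s₁ : Small C.wires (Cmd.den C.input (.count ≔ .lit 0) σ) := hs.den _ (by decide)
  generalize Cmd.den C.input (.count ≔ .lit 0) σ = σ₁ at *
  obtain ⟨k1, k2, k3, k4, k5⟩ := den_innerLoop (M := M) h₁ hm hN (by omega : N ≤ b + 2)
    (by omega) (by rw [a₁, hA]) s₁ c₁ b₁
  have h₂ : Ready C s m ((Cmd.rep .inner innerStep).den C.input σ₁) := h₁.den _ (by decide)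
  have key₂ : ((Cmd.rep .inner innerStep).den C.input σ₁).reg .key = σ₁.reg .key :=
    reg_den _ rfl _
  have t₂ : ((Cmd.rep .inner innerStep).den C.input σ₁).arr .table = σ₁.arr .table :=
    arr_den _ rfl _
  generalize (Cmd.rep .inner innerStep).den C.input σ₁ = σ₂ at *
  obtain ⟨b₃, v₃⟩ := bdd_den_and_vol_le (N := N) (M := M) (F := bounds) record
    (by intro r; cases r <;> decide) (by decide) _ σ₂ k4 (fun i => (hI i).trans (by omega))
    (h₂.bounds_le hm hN) hM
  refine ⟨?_, ?_, k3.den _ (by decide), b₃, ?_⟩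
  · simp [record, Cmd.den, Exp.eval, key₂, key₁, t₂, a₁, k1]
  · rw [arr_den _ rfl, k2]
  · have pos : 1 ≤ 2 ^ m := Nat.one_le_two_pow
    have e1 : 2 * (5 + 2 * M + N) ≤ 2 ^ m * (2 * (5 + 2 * M + N)) :=
      Nat.le_mul_of_pos_left _ (by omega)
    have e2 : record.cost N * (5 + 2 * M + N) ≤ 2 ^ m * (record.cost N * (5 + 2 * M + N)) :=
      Nat.le_mul_of_pos_left _ (by omega)
    calc _ ≤ 2 ^ m * (2 * (5 + 2 * M + N)) +
          (2 ^ m * (50 + 2 * n + evaluate.cost N * (5 + 2 * M + N)) +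
          2 ^ m * (record.cost N * (5 + 2 * M + N))) := by omega
      _ = 2 ^ m * (50 + 2 * n +
          (2 + evaluate.cost N + record.cost N) * (5 + 2 * M + N)) := by ring
      _ ≤ _ := Nat.mul_le_mul_left _ (by omega)

theorem den_account {s m a c : ℕ} {σ : St Var Arr} (h : Ready C s m σ) (hm : m ≤ n)
    (hA : σ.arr .asg = bits n m 0 a) (hs : Small C.wires σ)
    (ht : σ.arr .table (σ.reg .key) = c + 1) :
    (account.den C.input σ).reg .total = σ.reg .total + c ∧
      (account.den C.input σ).arr .asg = bits n m 0 (a + 1) ∧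
      Small C.wires (account.den C.input σ) := by
  unfold account
  rw [den_seq]
  set σ₁ := Cmd.den C.input (.total ≔ .var .total ∔ (.get .table (.var .key) ∸ .lit 1)) σ with hσ
  have h₁ : Ready C s m σ₁ := h.den _ (by decide)
  have a₁ : σ₁.arr .asg = bits n m 0 a := hA
  refine ⟨?_, ?_, (hs.den _ (by decide)).den _ (by decide)⟩
  · rw [reg_den _ rfl]
    simp [hσ, Cmd.den, Exp.eval, ht]
  · funext i
    rw [den_increment (e := .var .best) (p := m) (K := n - m) (a := a) h₁.best h₁.free (by decide)]
    · rw [a₁, bits_succ_outer hm]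
    · intro i hi
      have e1 : ¬ m + i < m := by omega
      have e2 : m + i < n := by omega
      simp [a₁, bits, e1, e2]

/-- The signatures of the first `t` assignments. -/
def seen (C : ComparatorCircuit n) (s m t : ℕ) : Finset ℕ :=
  (Finset.range t).image (partialCode C s m)

/-- The invariant of the enumeration. -/
structure Invariant (C : ComparatorCircuit n) (s m t : ℕ) (σ : St Var Arr) : Prop where
  asg : σ.arr .asg = bits n m 0 t
  small : Small C.wires σ
  total : σ.reg .total = ∑ a ∈ Finset.range t, partialCount C s m a
  hit : ∀ a < t, σ.arr .table (partialCode C s m a) = partialCount C s m a + 1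
  miss : ∀ k ∉ seen C s m t, σ.arr .table k = 0

theorem Invariant.table_le {s m t : ℕ} {σ : St Var Arr} (h : Invariant C s m t σ) (k : ℕ) :
    σ.arr .table k ≤ 2 ^ m + 1 := by
  by_cases hk : k ∈ seen C s m t
  · obtain ⟨a, ha, rfl⟩ := Finset.mem_image.1 hk
    rw [h.hit a (Finset.mem_range.1 ha)]
    have := partialCount_le C s m a
    omega
  · rw [h.miss k hk]
    exact Nat.zero_le _

/-- The cost is amortised: a round costs polynomially much, except that a brute force run is charged
to the growth of the set of signatures seen so far. -/
theorem den_outerStep {s m t b N M : ℕ} {σ : St Var Arr} (h : Ready C s m σ) (hm : m ≤ n)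
    (hN : n + C.wires + C.gates.length + 2 ≤ N) (hNb : N ≤ b) (hM : b + stepCost N ≤ M)
    (ht : t < 2 ^ (n - m)) (hi : Invariant C s m t σ)
    (hb : ∀ r, outerStep.sets r = false → Nat.size (σ.reg r) ≤ b) :
    Invariant C s m (t + 1) (outerStep.den C.input σ) ∧
      outerStep.vol C.input σ + (seen C s m t).card *
          (2 ^ m * (60 + 2 * n + stepCost N * (5 + 2 * M + N))) ≤
        (50 + stepCost N * (5 + 2 * M + N)) + (seen C s m (t + 1)).card *
          (2 ^ m * (60 + 2 * n + stepCost N * (5 + 2 * M + N))) := by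
  have hM' : b + (lookup.cost N + 2 + evaluate.cost N + record.cost N + account.cost N + 4) ≤ M :=
    hM
  have hI : ∀ i, Nat.size (C.input i) ≤ b := fun i =>
    (size_le_self _).trans ((C.input_lt i).trans (by omega))
  -- Besides the cleared variables only the running total changes from round to round; it is a sum
  -- of fewer than `2 ^ (n - m)` terms of size at most `2 ^ m`.
  have htotal : Nat.size (σ.reg .total) ≤ b := by
    have : σ.reg .total ≤ 2 ^ n := by
      rw [hi.total]
      refine (Finset.sum_le_card_nsmul _ _ (2 ^ m) fun a _ => partialCount_le C s m a).trans ?_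
      rw [Finset.card_range, smul_eq_mul]
      calc t * 2 ^ m ≤ 2 ^ (n - m) * 2 ^ m := Nat.mul_le_mul_right _ ht.le
        _ = 2 ^ n := by rw [← pow_add, Nat.sub_add_cancel hm]
    refine (Nat.size_le_size this).trans ((size_two_pow_le n).trans ?_)
    omega
  have hclear : Bdd b ((clear (.key :: .count :: scratch)).den C.input σ) := by
    refine bdd_clear (fun r hr' => ?_) ?_
    · by_cases hrc : r = .total
      · rw [hrc]; exact htotal
      · refine hb r ?_
        revert hr' hrc
        cases r <;> simp [scratch] <;> rfl
    · refine size_arr_le hi.small (by omega) (fun i => ?_) fun i => ?_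
      · rw [hi.asg]; exact bits_le_one _ _ _ _ _
      · refine (Nat.size_le_size (hi.table_le i)).trans ((size_add_le _ _).trans ?_)
        have := size_two_pow_le m
        -- Table entries have up to `m + 3` bits; the existence of an output wire makes `C.wires`
        -- positive and supplies the last of them.
        have := C.out.pos
        rw [Nat.size_one]
        omega
  have h₁ : Ready C s m ((clear (.key :: .count :: scratch)).den C.input σ) :=
    h.den _ (by decide)
  have a₁ : ∀ k, ((clear (.key :: .count :: scratch)).den C.input σ).arr k = σ.arr k :=
    fun k => arr_den _ (clear_puts _ _) _
  have t₁ : ((clear (.key :: .count :: scratch)).den C.input σ).reg .total = σ.reg .total :=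
    reg_den _ (clear_sets (by decide)) _
  have v₁ : (clear (.key :: .count :: scratch)).vol C.input σ = 43 := clear_vol _ _ _
  have s₁ : Small C.wires ((clear (.key :: .count :: scratch)).den C.input σ) :=
    hi.small.den _ fun k _ => clear_puts _ k
  unfold outerStep
  rw [den_seq, den_seq, den_seq, vol_seq, vol_seq, vol_seq, v₁]
  generalize (clear (.key :: .count :: scratch)).den C.input σ = σ₁ at *
  obtain ⟨k1, k2⟩ := den_lookup h₁ ((a₁ _).trans hi.asg) s₁
  obtain ⟨b₂, v₂⟩ := bdd_den_and_vol_le (N := N) (M := M) (F := bounds) lookup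
    (by intro r; cases r <;> decide) (by decide) b σ₁ hclear hI (h₁.bounds_le hm hN) (by omega)
  have h₂ : Ready C s m (lookup.den C.input σ₁) := h₁.den _ (by decide)
  have asg₂ : (lookup.den C.input σ₁).arr .asg = bits n m 0 t :=
    (arr_den _ rfl _).trans ((a₁ _).trans hi.asg)
  have table₂ : (lookup.den C.input σ₁).arr .table = σ.arr .table :=
    (arr_den _ rfl _).trans (a₁ _)
  have t₂ : (lookup.den C.input σ₁).reg .total = σ.reg .total := (reg_den _ rfl _).trans t₁
  generalize lookup.den C.input σ₁ = σ₂ at *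
  have hseen : seen C s m (t + 1) = insert (partialCode C s m t) (seen C s m t) := by
    unfold seen
    rw [Finset.range_add_one, Finset.image_insert]
  set c := Cmd.ite (.get .table (.var .key)) .skip bruteForce with hcdef
  have middle : (c.den C.input σ₂).arr .asg = bits n m 0 t ∧ Small C.wires (c.den C.input σ₂) ∧
      Bdd (b + lookup.cost N + 2 + evaluate.cost N + record.cost N) (c.den C.input σ₂) ∧
      (∀ a < t + 1, (c.den C.input σ₂).arr .table (partialCode C s m a) =
        partialCount C s m a + 1) ∧
      (∀ k ∉ seen C s m (t + 1), (c.den C.input σ₂).arr .table k = 0) ∧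
      c.vol C.input σ₂ + (seen C s m t).card *
          (2 ^ m * (60 + 2 * n + stepCost N * (5 + 2 * M + N))) ≤
        2 * (2 + 2 * M) + 2 + M + (seen C s m (t + 1)).card *
          (2 ^ m * (60 + 2 * n + stepCost N * (5 + 2 * M + N))) := by
    have test : (Exp.get .table (.var .key) : Exp Var Arr).eval C.input σ₂ =
        σ.arr .table (partialCode C s m t) := by
      simp [Exp.eval, k1, table₂]
    have e1 := (Exp.get .table (.var .key) : Exp Var Arr).vol_le (M := M) b₂
      (fun i => (hI i).trans (by omega)) (by simp [Exp.cost]; omega)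
    have e2 := size_eval_le b₂ (fun i => (hI i).trans (by omega : b ≤ b + lookup.cost N))
      (Exp.get .table (.var .key) : Exp Var Arr)
    have e3 : (Exp.get .table (.var .key) : Exp Var Arr).cost = 2 := rfl
    rw [e3] at e1 e2
    -- Stored counts are increased by one, so a zero in the table means precisely that the signature
    -- is new.
    by_cases hk : partialCode C s m t ∈ seen C s m t
    · obtain ⟨a, ha, e⟩ := Finset.mem_image.1 hk
      have hit := hi.hit a (Finset.mem_range.1 ha)
      rw [e, partialCount_eq_of_partialCode_eq C e] at hit
      have hden : c.den C.input σ₂ = σ₂ := by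
        rw [hcdef, Cmd.den, test, hit]
        rfl
      have hvol : c.vol C.input σ₂ ≤ 2 * (2 + 2 * M) + 2 + M := by
        rw [hcdef, Cmd.vol, test, hit, if_pos (by omega), Cmd.vol]
        rw [test, hit] at e2
        omega
      rw [hden, hseen, Finset.insert_eq_of_mem hk]
      refine ⟨asg₂, k2, b₂.mono (by omega), ?_, ?_, by omega⟩
      · intro a ha
        rw [table₂]
        rcases Nat.lt_succ_iff_lt_or_eq.1 ha with h' | rfl
        · exact hi.hit a h'
        · exact hit
      · intro k hk
        rw [table₂, hi.miss k hk]
    · have hmiss := hi.miss _ hk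
      have hden : c.den C.input σ₂ = bruteForce.den C.input σ₂ := by
        rw [hcdef, Cmd.den, test, hmiss]
        rfl
      obtain ⟨l1, l2, l3, l4, l5⟩ := den_bruteForce (M := M) h₂ hm hN
        (by omega : N ≤ b + lookup.cost N) (by omega) asg₂ k2 b₂
      rw [hden, hseen, Finset.card_insert_of_notMem hk]
      refine ⟨l2, l3, l4, ?_, ?_, ?_⟩
      · intro a ha
        rw [l1, k1, table₂, Function.update_apply]
        rcases Nat.lt_succ_iff_lt_or_eq.1 ha with h' | rfl
        · rw [if_neg, hi.hit a h']
          intro e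
          exact hk (e ▸ Finset.mem_image_of_mem _ (Finset.mem_range.2 h'))
        · rw [if_pos rfl]
      · intro k hk'
        rw [Finset.mem_insert, not_or] at hk'
        rw [l1, k1, table₂, Function.update_apply, if_neg hk'.1, hi.miss k hk'.2]
      · have hvol : c.vol C.input σ₂ ≤ 2 * (2 + 2 * M) + 2 + M +
            bruteForce.vol C.input σ₂ := by
          rw [hcdef, Cmd.vol, test, hmiss, if_neg (by simp)]
          simp only [Nat.size_zero]
          omega
        have l6 : (2 + evaluate.cost N + record.cost N) * (5 + 2 * M + N) ≤
            stepCost N * (5 + 2 * M + N) := Nat.mul_le_mul_right _ (by unfold stepCost; omega)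
        have l7 : 2 ^ m * (60 + 2 * n + (2 + evaluate.cost N + record.cost N) * (5 + 2 * M + N)) ≤
            2 ^ m * (60 + 2 * n + stepCost N * (5 + 2 * M + N)) :=
          Nat.mul_le_mul_left _ (by omega)
        rw [add_mul _ 1, one_mul]
        omega
  have h₃ : Ready C s m (c.den C.input σ₂) := h₂.den _ (by decide)
  have key₃ : (c.den C.input σ₂).reg .key = partialCode C s m t := (reg_den _ rfl _).trans k1
  have t₃ : (c.den C.input σ₂).reg .total = σ.reg .total := (reg_den _ rfl _).trans t₂
  generalize c.den C.input σ₂ = σ₃ at *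
  obtain ⟨m1, m2, m3, m4, m5, m6⟩ := middle
  obtain ⟨n1, n2, n3⟩ := den_account h₃ hm m1 m2 (by rw [key₃]; exact m4 t (by omega))
  obtain ⟨-, v₄⟩ := bdd_den_and_vol_le (N := N) (M := M) (F := bounds) account
    (by intro r; cases r <;> decide) (by decide) _ σ₃ m3 (fun i => (hI i).trans (by omega))
    (h₃.bounds_le hm hN) (by omega)
  refine ⟨⟨n2, n3, ?_, ?_, ?_⟩, ?_⟩
  · rw [n1, t₃, hi.total, Finset.sum_range_succ]
  · rw [arr_den _ rfl]
    exact m4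
  · rw [arr_den _ rfl]
    exact m5
  -- The summand 4 in `stepCost` pays for the test of the table entry.
  · have split : (lookup.cost N + 4 + account.cost N) * (5 + 2 * M + N) ≤
        stepCost N * (5 + 2 * M + N) := Nat.mul_le_mul_right _ (by unfold stepCost; omega)
    rw [add_mul, add_mul] at split
    omega

/-- The amortised bounds telescope: `2 ^ (n - m)` cheap rounds and one brute force run of length `2
^ m` for each signature that occurs. -/
theorem den_enumerate {s m b N M L : ℕ} {σ : St Var Arr} (h : Ready C s m σ) (hm : m ≤ n)
    (hs : s < n) (hN : n + C.wires + C.gates.length + 2 ≤ N) (hNb : N ≤ b)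
    (hM : b + stepCost N ≤ M) (hL : C.wires + 2 ≤ 2 ^ L)
    (hA : ∀ k i, σ.arr k i = 0) (hb : ∀ r, outerStep.sets r = false → Nat.size (σ.reg r) ≤ b) :
    (enumerate.den C.input σ).reg .total = C.numSat ∧
      enumerate.vol C.input σ ≤
        (2 ^ (n - m) + 2 ^ (2 * (liveCount C s m ^ 2 * L) + m) * (C.wires + 2)) *
          (100 + 4 * n + stepCost N * (5 + 2 * M + N)) := by
  unfold enumerate
  rw [den_seq, vol_seq]
  have v₀ : Cmd.vol C.input (.total ≔ .lit 0 : Cmd Var Arr) σ = 2 := by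
    simp [Cmd.vol, Exp.vol, Exp.eval]
  rw [v₀]
  set σ₁ := Cmd.den C.input (.total ≔ .lit 0) σ with hσ
  have h₁ : Ready C s m σ₁ := h.den _ (by decide)
  have r₁ : ∀ r, outerStep.sets r = false → σ₁.reg r = σ.reg r := by
    intro r hr
    refine reg_den _ ?_ _
    revert hr
    cases r <;> decide
  have a₁ : ∀ k i, σ₁.arr k i = 0 := hA
  set Z := 60 + 2 * n + stepCost N * (5 + 2 * M + N) with hZ
  have b0 : bits n m 0 0 = fun _ => 0 := by
    funext i
    simp [bits]
  obtain ⟨T, ⟨k1, k2⟩, k3⟩ := vol_rep (I := C.input) (r := .outer) (σ := σ₁) (c := outerStep)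
    (fun t T τ => Invariant C s m t τ ∧ T ≤ t * Z + (seen C s m t).card * (2 ^ m * Z))
    ⟨⟨by rw [b0]; funext i; exact a₁ _ i, fun i => by simp [a₁],
      by simp [hσ, Cmd.den, Exp.eval], fun a ha => absurd ha (by omega), fun k _ => a₁ _ k⟩,
      by simp⟩ (by
      rintro t ht T τ hr - ⟨k1, k2⟩
      rw [h₁.outer] at ht
      have hτ : Ready C s m τ := h₁.congr fun r hr' => hr r (by
        revert r
        decide)
      obtain ⟨l1, l2⟩ := den_outerStep hτ hm hN hNb hM ht k1 fun r hr' => by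
        rw [hr r hr', r₁ r hr']
        exact hb r hr'
      refine ⟨l1, ?_⟩
      rw [← hZ] at l2
      rw [add_mul t, one_mul]
      omega)
  rw [h₁.outer] at k1 k2 k3
  refine ⟨?_, ?_⟩
  · rw [k1.total, sum_partialCount C hs hm]
  · rw [k3]
    -- All signatures lie below the bound of `partialCode_lt`, which therefore also bounds their
    -- number.
    have hcard : (seen C s m (2 ^ (n - m))).card ≤
        2 ^ (2 * (liveCount C s m ^ 2 * L)) * (C.wires + 2) := by
      rw [← Finset.card_range (2 ^ (2 * (liveCount C s m ^ 2 * L)) * (C.wires + 2))]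
      refine Finset.card_le_card fun k hk => ?_
      obtain ⟨a, -, rfl⟩ := Finset.mem_image.1 hk
      exact Finset.mem_range.2 (partialCode_lt C hL s m a)
    have hsz : Nat.size (2 ^ (n - m)) ≤ n + 1 := (size_two_pow_le _).trans (by omega)
    have pos : 1 ≤ 2 ^ (n - m) := Nat.one_le_two_pow
    have e1 : 2 ^ (n - m) * (2 + Nat.size (2 ^ (n - m))) ≤ 2 ^ (n - m) * (n + 3) :=
      Nat.mul_le_mul_left _ (by omega)
    have e2 : n + 4 ≤ 2 ^ (n - m) * (n + 4) := Nat.le_mul_of_pos_left _ (by omega)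
    have e3 := Nat.mul_le_mul_right (2 ^ m * Z) hcard
    have e4 : (2 ^ (n - m) + 2 ^ (2 * (liveCount C s m ^ 2 * L) + m) * (C.wires + 2)) *
        (100 + 4 * n + stepCost N * (5 + 2 * M + N)) =
        2 ^ (n - m) * (n + 3) + 2 ^ (n - m) * (n + 4) + 2 ^ (n - m) * Z +
          2 ^ (2 * (liveCount C s m ^ 2 * L)) * (C.wires + 2) * (2 ^ m * Z) +
          (2 ^ (n - m) * 33 +
            2 ^ (2 * (liveCount C s m ^ 2 * L) + m) * (C.wires + 2) * (40 + 2 * n)) := by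
      rw [hZ, pow_add]
      ring
    omega

end Imp

/-! ### The counting program -/

namespace Imp

/-- The computation before the enumeration. -/
def setup : Cmd Var Arr := readInput ;; logarithm ;; search ;; powers

/-- Counts the satisfying assignments. -/
def countSat : Cmd Var Arr := setup ;; enumerate

/-- The state in which all variables are zero. -/
def start : St Var Arr := ⟨fun _ => 0, fun _ _ => 0⟩

variable {n : ℕ}

theorem den_setup (C : ComparatorCircuit n) (hn : 0 < n) :
    ∃ L s m, C.wires + 2 ≤ 2 ^ L ∧ (L = 0 ∨ 2 ^ (L - 1) < C.wires + 2) ∧ Suitable C L s m ∧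
      s < n ∧ (∀ m' < n, ∀ s' < n, Suitable C L s' m' → m' ≤ m) ∧
      Ready C s m (setup.den C.input start) := by
  have h₁ := described_readInput C start
  unfold setup
  rw [den_seq, den_seq, den_seq]
  generalize readInput.den C.input start = σ₁ at *
  obtain ⟨l1, l2, l3⟩ := den_logarithm (I := C.input) h₁.base
  have h₂ : Described C (logarithm.den C.input σ₁) := h₁.den _ (by decide)
  generalize logarithm.den C.input σ₁ = σ₂ at *
  obtain ⟨s1, s2, s3⟩ := den_search h₂ hn rfl l2
  have h₃ : Described C (search.den C.input σ₂) := h₂.den _ (by decide)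
  generalize search.den C.input σ₂ = σ₃ at *
  have hm : σ₃.reg .best ≤ n := by
    have := s1.2
    omega
  obtain ⟨p1, p2, p3⟩ := den_powers (I := C.input) h₃.vars rfl hm
  exact ⟨_, _, _, l1, l3, s1, s2, s3, h₃.den _ (by decide), reg_den _ rfl _, reg_den _ rfl _,
    p1, p2, p3⟩

/-- Reading the input is treated separately, because the loop bounds of the remaining setup have
known values only after it. -/
theorem bdd_setup (C : ComparatorCircuit n) {N M : ℕ}
    (hN : n + C.wires + C.gates.length + 2 ≤ N) (hM : N + setup.cost N ≤ M) :
    Bdd (N + setup.cost N) (setup.den C.input start) ∧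
      setup.vol C.input start ≤ setup.cost N * (5 + 2 * M + N) := by
  have hI : ∀ i, Nat.size (C.input i) ≤ N := fun i =>
    (size_le_self _).trans ((C.input_lt i).trans (by omega))
  have cost_eq : setup.cost N = readInput.cost N + (logarithm ;; search ;; powers).cost N := rfl
  obtain ⟨b₁, v₁⟩ := bdd_den_and_vol_le (N := N) (M := M) (F := fun _ => false) readInput
    (by simp) (by decide) N start ⟨fun r => by simp [start], fun k i => by simp [start]⟩ hI
    (by simp) (by omega)
  have h₁ := described_readInput C start
  rw [cost_eq, setup, den_seq, vol_seq]
  generalize readInput.den C.input start = σ₁ at *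
  obtain ⟨b₂, v₂⟩ := bdd_den_and_vol_le (N := N) (M := M)
    -- The search and the powers set `best` and `free`, so these cannot yet serve as loop bounds.
    (F := fun r => decide (r ∈ [Var.vars, .wires, .base])) (logarithm ;; search ;; powers)
    (by intro r; cases r <;> decide) (by decide) _ σ₁ b₁ (fun i => (hI i).trans (by omega))
    (by
      intro r hr
      simp only [List.mem_cons, List.not_mem_nil, or_false, decide_eq_true_eq] at hr
      rcases hr with rfl | rfl | rfl
      · rw [h₁.vars]; omega
      · rw [h₁.wires]; omega
      · rw [h₁.base]; omega) (by omega)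
  refine ⟨b₂.mono (by omega), ?_⟩
  rw [add_mul (readInput.cost N)]
  omega

/-- A bound on the sizes of the numbers that `countSat` computes. -/
def sizeBound (N : ℕ) : ℕ := N + setup.cost N + stepCost N

/-- A polynomial bound on the volume of one step of `countSat`. -/
def factor (N : ℕ) : ℕ :=
  setup.cost N * (5 + 2 * sizeBound N + N) +
    N * (100 + 4 * N + stepCost N * (5 + 2 * sizeBound N + N))

/-- The program does not know `k`; it enters only through the maximality of the chosen `m`, which is
compared with the candidate `2 * k`. -/
theorem den_countSat (C : ComparatorCircuit n) {k N : ℕ} (hk : 1 ≤ k) (hkn : 4 * k ≤ n)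
    (hN : n + C.wires + C.gates.length + 3 ≤ N)
    (hS : ∀ L, (L = 0 ∨ 2 ^ (L - 1) < C.wires + 2) → ∃ s < n, Suitable C L s (2 * k)) :
    (countSat.den C.input start).reg .total = C.numSat ∧
      countSat.vol C.input start ≤ 2 ^ (n - k) * factor N := by
  obtain ⟨L, s, m, h1, h2, h3, h4, h5, h6⟩ := den_setup C (by omega)
  obtain ⟨s', h7, h8⟩ := hS L h2
  have hm := h5 (2 * k) (by omega) s' h7 h8
  obtain ⟨h9, h10⟩ := h3
  obtain ⟨b₁, v₁⟩ := bdd_setup C (M := sizeBound N) (by omega : _ ≤ N)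
    (by unfold sizeBound; omega)
  have a₁ : ∀ k i, (setup.den C.input start).arr k i = 0 := by
    intro k i
    rw [arr_den]
    · rfl
    · cases k <;> rfl
  unfold countSat
  rw [den_seq, vol_seq]
  generalize setup.den C.input start = σ₁ at *
  obtain ⟨k1, k2⟩ := den_enumerate (M := sizeBound N) h6 (by omega) h4 (by omega : _ ≤ N)
    (by omega : N ≤ N + setup.cost N) le_rfl h1 a₁ fun r _ => b₁.reg r
  refine ⟨k1, (Nat.add_le_add v₁ k2).trans ?_⟩
  have pos : 1 ≤ 2 ^ (n - k) := Nat.one_le_two_pow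
  have e1 : 2 ^ (n - m) ≤ 2 ^ (n - k) := Nat.pow_le_pow_right (by omega) (by omega)
  -- The criterion gives `2 * w ^ 2 * L ≤ n / 4` and `m ≤ n / 2`, and `k ≤ n / 4` leaves room for
  -- their sum.
  have e2 : 2 ^ (2 * (liveCount C s m ^ 2 * L) + m) ≤ 2 ^ (n - k) :=
    Nat.pow_le_pow_right (by omega) (by omega)
  rw [factor, mul_add (2 ^ (n - k))]
  refine Nat.add_le_add (Nat.le_mul_of_pos_left _ pos) ?_
  rw [← mul_assoc (2 ^ (n - k))]
  refine Nat.mul_le_mul ?_ (by omega)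
  calc _ ≤ 2 ^ (n - k) + 2 ^ (n - k) * (C.wires + 2) :=
        Nat.add_le_add e1 (Nat.mul_le_mul_right _ e2)
    _ = 2 ^ (n - k) * (C.wires + 3) := by ring
    _ ≤ _ := Nat.mul_le_mul_left _ (by omega)

theorem factor_exists_polynomial : ∃ q : Polynomial ℕ, ∀ N, factor N = q.eval N := by
  obtain ⟨q₁, h₁⟩ := setup.exists_polynomial
  obtain ⟨q₂, h₂⟩ := (lookup ;; evaluate ;; record ;; account).exists_polynomial
  have h₃ : ∀ N, stepCost N = q₂.eval N + 6 := by
    intro N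
    rw [← h₂, stepCost, Cmd.cost, Cmd.cost, Cmd.cost]
    ring
  refine ⟨q₁ * (5 + 2 * (.X + q₁ + (q₂ + 6)) + .X) +
    .X * (100 + 4 * .X + (q₂ + 6) * (5 + 2 * (.X + q₁ + (q₂ + 6)) + .X)), fun N => ?_⟩
  simp [factor, sizeBound, h₁, h₃]

/-! ### Transfer to the random access machine -/

/-- The register of a variable. -/
def Var.number (r : Var) : ℕ := r.ctorIdx

/-- The track of an array. -/
def Arr.number (k : Arr) : ℕ := k.ctorIdx

theorem Var.number_injective : Function.Injective Var.number := by
  intro r s h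
  cases r <;> cases s <;> first | rfl | exact absurd h (by decide)

theorem Arr.number_injective : Function.Injective Arr.number := by
  intro r s h
  cases r <;> cases s <;> first | rfl | exact absurd h (by decide)

theorem Arr.number_lt (k : Arr) : k.number < 8 := by
  cases k <;> decide

/-- Stores the length of the input in register 1. -/
def computeLength : RAM.Program :=
  .seq (.const 4 1) <| .seq (.load 5 4) <| .seq (.const 4 2) <| .seq (.load 8 4) <|
  .seq (.add 5 5 8) <| .seq (.add 5 5 5) <| .seq (.const 4 4) <| .add 1 5 4

theorem exec_computeLength (C : ComparatorCircuit n) {N : ℕ}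
    (hN : n + C.wires + C.gates.length + 3 ≤ N) :
    ∃ t ρ, RAM.Exec computeLength (RAM.initState C.encode) t ρ ∧ t ≤ 10 * N + 40 ∧
      Sim Var.number Arr.number C.input (4 + 2 * C.wires + 2 * C.gates.length) start ρ := by
  refine ⟨_, _, .seq (.const _ _ _) (.seq (.load _ _ _) (.seq (.const _ _ _) (.seq (.load _ _ _)
    (.seq (.add _ _ _ _) (.seq (.add _ _ _ _) (.seq (.const _ _ _) (.add _ _ _ _))))))), ?_, ?_⟩
  · have e1 : (RAM.initState C.encode).mem 1 = C.wires := C.input_wires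
    have e2 : (RAM.initState C.encode).mem 2 = C.gates.length := C.input_gates
    simp only [RAM.State.setReg, Function.update_apply, e1, e2, if_true, Nat.reduceEqDiff,
      if_false]
    have f1 := size_le_self C.wires
    have f2 := size_le_self C.gates.length
    have f3 := size_le_self (C.wires + C.gates.length)
    have f4 := size_le_self (C.wires + C.gates.length + (C.wires + C.gates.length))
    have f5 := size_le_self 1
    have f6 := size_le_self 2
    have f7 := size_le_self 4
    omega
  · have e1 : (RAM.initState C.encode).mem 1 = C.wires := C.input_wires
    have e2 : (RAM.initState C.encode).mem 2 = C.gates.length := C.input_gates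
    constructor
    · simp only [RAM.State.setReg, Function.update_apply, e1, e2, if_true, Nat.reduceEqDiff,
        if_false]
      ring
    · simp [RAM.State.setReg, RAM.initState]
    · intro r
      have h1 : 3 * r.number + 3 ≠ 1 := by omega
      have h4 : 3 * r.number + 3 ≠ 4 := by omega
      have h5 : 3 * r.number + 3 ≠ 5 := by omega
      have h8 : 3 * r.number + 3 ≠ 8 := by omega
      simp only [RAM.State.setReg, RAM.initState, Function.update_apply, h1, h4, h5, h8, if_false]
      rfl
    -- The memory beyond the input is zero, so all arrays, in particular the table, start out empty.
    · intro k i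
      exact C.input_of_le (by omega)
    · intro i _
      rfl

/-- The counting program for the random access machine. -/
def machine : RAM.Program :=
  .seq computeLength <| .seq (countSat.compile Var.number Arr.number 0)
    (.add 0 (3 * Var.total.number + 3) 2)

theorem numSat_le (C : ComparatorCircuit n) : C.numSat ≤ 2 ^ n := by
  refine (Finset.card_filter_le _ _).trans ?_
  simp

theorem outputsWithin_machine (C : ComparatorCircuit n) {k N : ℕ} (hk : 1 ≤ k)
    (hkn : 4 * k ≤ n) (hN : n + C.wires + C.gates.length + 3 ≤ N)
    (hS : ∀ L, (L = 0 ∨ 2 ^ (L - 1) < C.wires + 2) → ∃ s < n, Suitable C L s (2 * k)) :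
    RAM.OutputsWithin machine C.encode C.numSat
      (2 ^ (n - k) * (11 * N + 42 + 64 * ((2 * N + 1) * factor N))) := by
  obtain ⟨t₁, ρ₁, x₁, b₁, s₁⟩ := exec_computeLength C hN
  obtain ⟨d, v⟩ := den_countSat C hk hkn hN hS
  obtain ⟨t₂, ρ₂, x₂, s₂, -, b₂⟩ := exec_cmd Var.number_injective Arr.number_lt
    Arr.number_injective (fun i => C.input_of_le) countSat 0 start ρ₁ s₁
  refine ⟨_, _, .seq x₁ (.seq x₂ (.add _ _ _ _)), ?_, ?_⟩
  · rw [s₂.reg, d, s₂.zero, Nat.size_zero]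
    have e1 : Nat.size C.numSat ≤ n + 1 :=
      (Nat.size_le_size (numSat_le C)).trans (size_two_pow_le n)
    have e2 : Nat.size (4 + 2 * C.wires + 2 * C.gates.length) ≤ 2 * N :=
      (size_le_self _).trans (by omega)
    have e3 := Nat.mul_le_mul (Nat.add_le_add_right e2 1) v
    have e4 : 11 * N + 42 ≤ 2 ^ (n - k) * (11 * N + 42) :=
      Nat.le_mul_of_pos_left _ (by positivity)
    have e5 : 2 ^ (n - k) * (11 * N + 42 + 64 * ((2 * N + 1) * factor N)) =
        2 ^ (n - k) * (11 * N + 42) + 64 * ((2 * N + 1) * (2 ^ (n - k) * factor N)) := by ring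
    omega
  · simp [RAM.State.setReg, s₂.reg, d, s₂.zero]

/-! ### The numerical conditions -/

/-- The consequences of the bound on the number of wires. -/
theorem wires_bounds {n k ℓ : ℕ} (hk : 1 ≤ k) (hkn : 4 * k ≤ n)
    (h : (ℓ : ℝ) ≤ (n : ℝ) ^ (1.5 : ℝ) / (20 * (k : ℝ) * √(Real.logb 2 (n : ℝ)))) :
    ℓ + 2 ≤ n ^ 2 ∧ 2 ≤ Real.logb 2 n ∧
      400 * (k : ℝ) ^ 2 * (ℓ : ℝ) ^ 2 * Real.logb 2 n ≤ (n : ℝ) ^ 3 := by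
  have hn : (4 : ℝ) ≤ n := by exact_mod_cast (by omega : 4 ≤ n)
  have hk' : (1 : ℝ) ≤ k := by exact_mod_cast hk
  have hlog : 2 ≤ Real.logb 2 n := by
    rw [Real.le_logb_iff_rpow_le (by norm_num) (by linarith)]
    norm_num
    omega
  have hs : 0 < √(Real.logb 2 (n : ℝ)) := Real.sqrt_pos.2 (by linarith)
  rw [le_div_iff₀ (by positivity)] at h
  have main : 400 * (k : ℝ) ^ 2 * (ℓ : ℝ) ^ 2 * Real.logb 2 n ≤ (n : ℝ) ^ 3 := by
    have h2 := pow_le_pow_left₀ (by positivity) h 2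
    have e : ((n : ℝ) ^ (1.5 : ℝ)) ^ 2 = (n : ℝ) ^ 3 := by
      rw [← Real.rpow_natCast, ← Real.rpow_mul (by linarith), ← Real.rpow_natCast]
      norm_num
    rw [e] at h2
    calc _ = (ℓ * (20 * k * √(Real.logb 2 (n : ℝ)))) ^ 2 := by
          rw [mul_pow, mul_pow, Real.sq_sqrt (by linarith)]
          ring
      _ ≤ _ := h2
  refine ⟨?_, hlog, main⟩
  -- A crude bound suffices here: `ℓ + 2 ≤ n ^ 2` is needed for the logarithm and for a polynomial
  -- input length.
  have h3 : (ℓ : ℝ) ^ 2 ≤ ((n : ℝ) ^ 2 / 4) ^ 2 := by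
    have e1 : (1 : ℝ) ≤ (k : ℝ) ^ 2 := one_le_pow₀ hk'
    have e2 : (ℓ : ℝ) ^ 2 * 1 ≤ (ℓ : ℝ) ^ 2 * ((k : ℝ) ^ 2 * Real.logb 2 n) :=
      mul_le_mul_of_nonneg_left (by nlinarith) (by positivity)
    have e3 : (n : ℝ) ^ 3 * 1 ≤ (n : ℝ) ^ 3 * n :=
      mul_le_mul_of_nonneg_left (by linarith) (by positivity)
    have e4 : (0 : ℝ) ≤ (n : ℝ) ^ 4 := by positivity
    nlinarith
  have h4 : (ℓ : ℝ) ≤ (n : ℝ) ^ 2 / 4 := (sq_le_sq₀ (by positivity) (by positivity)).1 h3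
  have h5 : (ℓ + 2 : ℝ) ≤ (n : ℝ) ^ 2 := by nlinarith
  exact_mod_cast h5

/-- The averaged shift has `w ≤ 2 * k * ℓ / n`, so the bound on the wires gives `100 * w ^ 2 * log₂
n ≤ n`. The rounded logarithm is at most `3 * log₂ n`, which turns the criterion into `24 ≤ 100`;
the constant 20 is far from tight. -/
theorem exists_suitable {n k : ℕ} (C : ComparatorCircuit n) (hk : 1 ≤ k) (hkn : 4 * k ≤ n)
    (h : (C.wires : ℝ) ≤ (n : ℝ) ^ (1.5 : ℝ) / (20 * (k : ℝ) * √(Real.logb 2 (n : ℝ)))) {L : ℕ}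
    (hL : L = 0 ∨ 2 ^ (L - 1) < C.wires + 2) : ∃ s < n, Suitable C L s (2 * k) := by
  obtain ⟨h1, h2, h3⟩ := wires_bounds hk hkn h
  obtain ⟨s, hs, hw⟩ := exists_liveCount_le C (m := 2 * k) (by omega : 0 < n)
  refine ⟨s, hs, ?_, by omega⟩
  have hn : (4 : ℝ) ≤ n := by exact_mod_cast (by omega : 4 ≤ n)
  -- From `2 ^ (L - 1) ≤ n ^ 2` one gets `L ≤ 2 * log₂ n + 1`, and the logarithm is at least 2
  -- because `n ≥ 4`.
  have hLlog : (L : ℝ) ≤ 3 * Real.logb 2 n := by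
    rcases hL with rfl | hL
    · push_cast
      linarith
    · rcases Nat.eq_zero_or_pos L with rfl | hpos
      · push_cast
        linarith
      · have e1 : (2 : ℝ) ^ (L - 1) ≤ (n : ℝ) ^ 2 := by exact_mod_cast (hL.le.trans h1)
        have e2 := Real.logb_le_logb_of_le (by norm_num : (1 : ℝ) < 2) (by positivity) e1
        rw [Real.logb_pow, Real.logb_pow, Real.logb_self_eq_one (by norm_num),
          Nat.cast_sub hpos] at e2
        push_cast at e2
        linarith
  have hw' : (n : ℝ) * liveCount C s (2 * k) ≤ 2 * k * C.wires := by exact_mod_cast hw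
  have sq := pow_le_pow_left₀ (by positivity) hw' 2
  have e1 : (100 * (liveCount C s (2 * k) : ℝ) ^ 2 * Real.logb 2 n) * (n : ℝ) ^ 2 ≤
      n * (n : ℝ) ^ 2 := by
    have := mul_le_mul_of_nonneg_right sq (by linarith : 0 ≤ 100 * Real.logb 2 n)
    calc _ = (n * (liveCount C s (2 * k) : ℝ)) ^ 2 * (100 * Real.logb 2 n) := by ring
      _ ≤ (2 * k * C.wires : ℝ) ^ 2 * (100 * Real.logb 2 n) := this
      _ = 400 * (k : ℝ) ^ 2 * (C.wires : ℝ) ^ 2 * Real.logb 2 n := by ring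
      _ ≤ (n : ℝ) ^ 3 := h3
      _ = _ := by ring
  have e2 := le_of_mul_le_mul_right e1 (by positivity)
  have e3 := mul_le_mul_of_nonneg_left hLlog
    (by positivity : (0 : ℝ) ≤ 8 * (liveCount C s (2 * k) : ℝ) ^ 2)
  have e4 : (0 : ℝ) ≤ (liveCount C s (2 * k) : ℝ) ^ 2 * Real.logb 2 n :=
    mul_nonneg (by positivity) (by linarith)
  have : (8 * ((liveCount C s (2 * k) : ℝ) ^ 2 * L)) ≤ n := by nlinarith
  exact_mod_cast this

end Imp

theorem theorem1p2 :
    ∃ (d : ℝ) (P : RAM.Program), 1 < d ∧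
      ∀ p : Polynomial ℕ, ∃ q : Polynomial ℕ,
        ∀ (n k : ℕ), 1 ≤ k → (k : ℝ) ≤ (n : ℝ) / 4 →
          ∀ C : ComparatorCircuit n,
            (C.wires : ℝ) ≤ (n : ℝ) ^ (1.5 : ℝ) / (d * (k : ℝ) * √(Real.logb 2 (n : ℝ))) →
            C.gates.length ≤ p.eval n →
            RAM.OutputsWithin P C.encode C.numSat (2 ^ (n - k) * q.eval n) := by
  refine ⟨20, Imp.machine, by norm_num, fun p => ?_⟩
  obtain ⟨q, hq⟩ := Imp.factor_exists_polynomial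
  -- The inner polynomial bounds the size `N` of the circuit: at most `n ^ 2` wires and `p n` gates.
  -- The outer one is the machine's overhead as a function of `N`.
  refine ⟨(11 * .X + 42 + 64 * ((2 * .X + 1) * q)).comp (.X + .X ^ 2 + p + 3),
    fun n k hk hkn C hC hG => ?_⟩
  have hkn' : 4 * k ≤ n := by
    have : (4 * k : ℝ) ≤ n := by linarith
    exact_mod_cast this
  have := Imp.outputsWithin_machine C (N := n + n ^ 2 + p.eval n + 3) hk hkn'
    (by have := (Imp.wires_bounds hk hkn' hC).1; omega)
    fun L hL => Imp.exists_suitable C hk hkn' hC hL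
  simpa [hq] using this
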